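/- **Setting.** All vector spaces are over $\mathbf{C}$. Let $\mathbf{CBVS}$ be the symmetric monoidal category of complete (convex) bornological vector spaces with bounded linear maps and the completed tensor product. A map from an open subset of $\mathbf{C}^n$ to a complete bornological space is *holomorphic* if locally it is a holomorphic map into a completely normable subobject; contour integrals are likewise taken in completely normable subobjects. A bornological vector space is *discrete* if its bounded sets are the bounded subsets of its finite-dimensional subspaces. For bornological spaces $X,Y$, a set of bounded linear maps is bounded in $\mathbf{BVS}(X,Y)$ if it is equibounded. Let $F$ be an affine-linearly invariant unital prefactorization algebra on $\mathbf{C}$ with values in $\mathbf{CBVS}$: it has objects $F(U)$ for $U\subseteq\mathbf{C}$ open, multiplication maps $M^{U,V}_W:F(U)\mathbin{\bar\otimes}F(V)\to F(W)$ for disjoint open $U,V\subseteq W$ and a unit in $F(\emptyset)$, which are associative, unital and compatible with the braiding ($M^{V,U}_{U\sqcup V}\circ\beta=M^{U,V}_{U\sqcup V}$), together with maps $\sigma_g:F(U)\to F(gU)$ for $g\in\mathbf{C}^\times\ltimes\mathbf{C}$ that satisfy $\sigma_{1}=\mathrm{id}$ and $\sigma_g\sigma_h=\sigma_{gh}$ and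 are compatible with units and multiplications. Write $M^U_W:F(U)\to F(W)$ for the extension maps (multiplication with the unit) and $M^{U_1,\dots,U_m}_W$ for the $m$-ary multiplication maps. Assume that $F$ is *holomorphic*: for all open $U,V$, the map $g\mapsto M^{gU}_V\circ\sigma_g\in\mathbf{BVS}(F(U),F(V))$ is holomorphic on the interior of $\{g\mid gU\subseteq V\}$. For $r>0$ let $q$ with $0<|q|<1$ act on $F(B_r(0))$ by $\rho(q)=M^{qB_r(0)}_{B_r(0)}\circ\sigma_q$. The costalk $F(0)=\lim_{r>0}F(B_r(0))$ carries the componentwise action; for $k\in\mathbf{Z}$ let $F(0)_k$ be its weight space $\{x\mid\rho(q)x=q^kx \text{ for all } 0<|q|<1\}$, with the subspace bornology. Assume that $F$ has *discrete weight spaces*, i.e. every $F(0)_k$ is discrete. Put $\mathbf{V}F=\bigoplus_k F(0)_k$ and $\overline{\mathbf{V}F}=\prod_kF(0)_k$. Let $P_r:\mathbf{V}F\to F(B_r(0))$ be the map given on each $F(0)_k$ by the projection of the limit, and let $L^R:F(B_R(0))\to\overline{\mathbf{V}F}$ be the map whose $k$-th component sends $x$ to the element of $F(0)_k$ whose image in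 $F(B_R(0))$ is $$l_k^R(x)=\frac1{2\pi i}\oint_{|q|=t}q^{-k-1}\rho(q)(x)\,dq,\qquad 0<t<1 .$$ For $a_1,\dots,a_m\in\mathbf{V}F$ and pairwise distinct $z_1,\dots,z_m\in\mathbf{C}$ ($m\ge0$) put $$\mu(a_1,z_1,\dots,a_m,z_m)=L^R\bigl(M^{B_{r_1}(z_1),\dots,B_{r_m}(z_m)}_{B_R(0)}(\sigma_{(+z_1)}P_{r_1}a_1,\dots,\sigma_{(+z_m)}P_{r_m}a_m)\bigr)\in\overline{\mathbf{V}F},$$ where $r_1,\dots,r_m,R>0$ are such that the discs $B_{r_i}(z_i)$ are pairwise disjoint and contained in $B_R(0)$. **Geometric vertex algebras.** Let $\mathcal V=\bigoplus_{k\in\mathbf Z}\mathcal V_k$ be a graded vector space, $\overline{\mathcal V}=\prod_k\mathcal V_k$, and let $p_k$ be the projection to $\mathcal V_k$. A function on an open subset of $\mathbf{C}^n$ with values in $\overline{\mathcal V}$ is called holomorphic if each of its components takes values in a finite-dimensional subspace and is holomorphic. A *geometric vertex algebra* is such a $\mathcal V$ with linear maps $\mu:\mathcal V^{\otimes m}\to\mathcal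 O(\mathbf{C}^m\setminus\Delta;\overline{\mathcal V})$, $m\ge0$ (where $\Delta$ is the set of tuples whose entries are not pairwise distinct), such that the following hold. * (permutation invariance) $\mu(a_{s(1)},z_{s(1)},\dots,a_{s(m)},z_{s(m)})=\mu(a_1,z_1,\dots,a_m,z_m)$ for all permutations $s$. * (insertion at zero) $\mu(a,0)=a$. * ($\mathbf{C}^\times$-equivariance) $\mu(q.a_1,qz_1,\dots,q.a_m,qz_m)=q.\mu(a_1,z_1,\dots,a_m,z_m)$ for $q\in\mathbf{C}^\times$, which acts on $\mathcal V_k$ by $q^k$. * (associativity) For all $m,n\ge0$ and $a_1,\dots,a_m,b_1,\dots,b_n\in\mathcal V$, $$\sum_{k\in\mathbf Z}\mu(a_1,z_1,\dots,a_m,z_m,p_k\mu(b_1,w_1,\dots,b_n,w_n),z_{m+1})=\mu(a_1,z_1,\dots,a_m,z_m,b_1,w_1+z_{m+1},\dots,b_n,w_n+z_{m+1})$$ on the set of $(z,w)\in(\mathbf{C}^{m+1}\setminus\Delta)\times(\mathbf{C}^n\setminus\Delta)$ with $|w_j|<|z_i-z_{m+1}|$ for all $1\le i\le m$, $1\le j\le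 n$; in each component and on each compact subset, all summands take values in a common finite-dimensional space and the sum converges absolutely and uniformly (the suprema of the norms of the summands have a finite sum). * (meromorphicity) For all $a,b\in\mathcal V$ there is $N\ge0$ such that $z^N\mu(a,z,b,0)$ extends to a holomorphic function of $z\in\mathbf{C}$ with values in $\overline{\mathcal V}$. **Proposition.** Let $F$ be a holomorphic affine-linearly invariant prefactorization algebra on $\mathbf{C}$ with discrete weight spaces, and assume that $F$ has *meromorphic OPE*, i.e. that the maps $\mu$ satisfy the meromorphicity axiom. Then the maps $\mu$ are well defined (the formula for $\mu$ holds for every choice of the radii $r_1,\dots,r_m,R$ and $t$), and $(\mathbf{V}F,\mu)$ is a geometric vertex algebra. -/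

import Mathlib

open TopologicalSpace Pointwise DirectSum

universe u

/-! ## Complete bornological vector spaces over `ℂ` -/

/-- `A` is absolutely convex. -/
def IsAbsolutelyConvex {X : Type u} [AddCommGroup X] [Module ℂ X] (A : Set X) : Prop :=
  ∀ x ∈ A, ∀ y ∈ A, ∀ c d : ℂ, ‖c‖ + ‖d‖ ≤ 1 → c • x + d • y ∈ A

/-- The absolutely convex hull `⟨A⟩`. -/
def absolutelyConvexHull {X : Type u} [AddCommGroup X] [Module ℂ X] (A : Set X) : Set X :=
  ⋂₀ {C | A ⊆ C ∧ IsAbsolutelyConvex C}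

/-- A (convex) bornological vector space over `ℂ`. -/
class IsBornologicalVectorSpace (X : Type u) [AddCommGroup X] [Module ℂ X] [Bornology X] :
    Prop where
  isBounded_smul : ∀ (B : Set X) (t : ℝ), Bornology.IsBounded B → 0 < t →
    Bornology.IsBounded ((t : ℂ) • B)
  isBounded_hull : ∀ B : Set X, Bornology.IsBounded B →
    Bornology.IsBounded (absolutelyConvexHull B)

/-- A completely normable subobject of `X`: a complex Banach space `E` with an injective linear map
`E → X` which sends norm bounded sets to bounded sets. (The subspace of `X` is the range of `incl`
with the norm transported from `E`.) -/
structure BanachSubobject (X : Type u) [AddCommGroup X] [Module ℂ X] [Bornology X] where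
  E : Type u
  [normedAddCommGroup : NormedAddCommGroup E]
  [normedSpace : NormedSpace ℂ E]
  [completeSpace : CompleteSpace E]
  incl : E →ₗ[ℂ] X
  injective : Function.Injective incl
  bounded : ∀ B : Set E, Bornology.IsBounded B → Bornology.IsBounded (incl '' B)

attribute [instance] BanachSubobject.normedAddCommGroup BanachSubobject.normedSpace
  BanachSubobject.completeSpace

/-- Completeness: every bounded set is contained, as a bounded set, in some completely normable
subobject. -/
def IsBornologicallyComplete (X : Type u) [AddCommGroup X] [Module ℂ X] [Bornology X] : Prop :=
  ∀ B : Set X, Bornology.IsBounded B →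
    ∃ (Y : BanachSubobject X) (C : Set Y.E), Bornology.IsBounded C ∧ Y.incl '' C = B

/-- Discreteness: a set is bounded if and only if it is a bounded subset of a finite-dimensional
subspace, i.e. the image of a bounded subset of some `ℂⁿ` under a linear map. -/
def IsDiscreteBornological (X : Type u) [AddCommGroup X] [Module ℂ X] [Bornology X] : Prop :=
  ∀ B : Set X, Bornology.IsBounded B ↔
    ∃ (n : ℕ) (φ : (Fin n → ℂ) →ₗ[ℂ] X) (C : Set (Fin n → ℂ)),
      Bornology.IsBounded C ∧ φ '' C = B

/-- A complete bornological vector space. -/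
structure CBVS where
  carrier : Type u
  [addCommGroup : AddCommGroup carrier]
  [module : Module ℂ carrier]
  [bornology : Bornology carrier]
  [isBornological : IsBornologicalVectorSpace carrier]
  complete : IsBornologicallyComplete carrier

instance : CoeSort CBVS.{u} (Type u) := ⟨CBVS.carrier⟩

attribute [instance] CBVS.addCommGroup CBVS.module CBVS.bornology CBVS.isBornological

/-- The sum of two bounded sets is bounded. -/
theorem isBounded_add_of_bornological {X : Type u} [AddCommGroup X] [Module ℂ X] [Bornology X]
    [IsBornologicalVectorSpace X] {A B : Set X} (hA : Bornology.IsBounded A)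
    (hB : Bornology.IsBounded B) : Bornology.IsBounded (A + B) := by
  refine (IsBornologicalVectorSpace.isBounded_hull _
    (IsBornologicalVectorSpace.isBounded_smul _ 2 (hA.union hB) two_pos)).subset ?_
  rintro _ ⟨a, ha, b, hb, rfl⟩
  rintro C ⟨hC, hC'⟩
  have h := hC' _ (hC (Set.smul_mem_smul_set (Or.inl ha))) _
    (hC (Set.smul_mem_smul_set (Or.inr hb))) (1 / 2) (1 / 2) (by norm_num)
  simpa [smul_smul] using h

/-- A scalar multiple of a bounded set is bounded. -/
theorem isBounded_smul_of_bornological {X : Type u} [AddCommGroup X] [Module ℂ X] [Bornology X]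
    [IsBornologicalVectorSpace X] (c : ℂ) {A : Set X} (hA : Bornology.IsBounded A) :
    Bornology.IsBounded (c • A) := by
  have hpos : 0 < ‖c‖ + 1 := by positivity
  refine (IsBornologicalVectorSpace.isBounded_hull _
    (IsBornologicalVectorSpace.isBounded_smul _ (‖c‖ + 1) hA hpos)).subset ?_
  rintro _ ⟨a, ha, rfl⟩
  rintro C ⟨hC, hC'⟩
  have hm := hC (Set.smul_mem_smul_set ha)
  have hn : ‖((‖c‖ + 1 : ℝ) : ℂ)‖ = ‖c‖ + 1 := by
    rw [Complex.norm_real, Real.norm_of_nonneg hpos.le]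
  have hne : ((‖c‖ + 1 : ℝ) : ℂ) ≠ 0 := by exact_mod_cast hpos.ne'
  have h := hC' _ hm _ hm (c / ((‖c‖ + 1 : ℝ) : ℂ)) 0 (by
    rw [norm_zero, add_zero, norm_div, hn, div_le_one hpos]
    linarith)
  rw [zero_smul, add_zero, smul_smul, div_mul_cancel₀ _ hne] at h
  exact h

/-- The vector space of bounded linear maps `X → Y`. -/
def boundedMaps (X Y : Type u) [AddCommGroup X] [Module ℂ X] [Bornology X]
    [AddCommGroup Y] [Module ℂ Y] [Bornology Y] [IsBornologicalVectorSpace Y] :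
    Submodule ℂ (X →ₗ[ℂ] Y) where
  carrier := {f | ∀ B : Set X, Bornology.IsBounded B → Bornology.IsBounded (f '' B)}
  add_mem' := by
    intro f g hf hg B hB
    refine (isBounded_add_of_bornological (hf B hB) (hg B hB)).subset ?_
    rintro _ ⟨x, hx, rfl⟩
    exact ⟨f x, ⟨x, hx, rfl⟩, g x, ⟨x, hx, rfl⟩, rfl⟩
  zero_mem' := by
    intro B _
    refine (Bornology.isBounded_singleton (x := (0 : Y))).subset ?_
    rintro _ ⟨x, _, rfl⟩
    simp
  smul_mem' := by
    intro c f hf B hB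
    refine (isBounded_smul_of_bornological c (hf B hB)).subset ?_
    rintro _ ⟨x, hx, rfl⟩
    exact ⟨f x, ⟨x, hx, rfl⟩, rfl⟩

/-- The bornology of equibounded sets on the space of bounded linear maps. -/
instance boundedMaps.instBornology (X Y : Type u) [AddCommGroup X] [Module ℂ X] [Bornology X]
    [AddCommGroup Y] [Module ℂ Y] [Bornology Y] [IsBornologicalVectorSpace Y] :
    Bornology (boundedMaps X Y) :=
  Bornology.ofBounded
    {B : Set (boundedMaps X Y) | ∀ C : Set X, Bornology.IsBounded C →
      ∃ D : Set Y, Bornology.IsBounded D ∧ ∀ f ∈ B, f.1 '' C ⊆ D}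
    (fun C _ => ⟨∅, Bornology.isBounded_empty, fun _ hf => hf.elim⟩)
    (fun s hs t hts C hC => by
      obtain ⟨D, hD, h⟩ := hs C hC
      exact ⟨D, hD, fun f hf => h f (hts hf)⟩)
    (fun s hs t ht C hC => by
      obtain ⟨D, hD, h⟩ := hs C hC
      obtain ⟨D', hD', h'⟩ := ht C hC
      refine ⟨D ∪ D', hD.union hD', ?_⟩
      rintro f (hf | hf)
      · exact (h f hf).trans Set.subset_union_left
      · exact (h' f hf).trans Set.subset_union_right)
    (fun f C hC => ⟨f.1 '' C, f.2 C hC, by rintro g rfl; exact subset_rfl⟩)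

/-- A function `f` on an open set `S` with values in a complete bornological vector space is
holomorphic if locally it is a holomorphic map into some completely normable subobject. -/
def BornHolomorphicOn {E : Type*} [NormedAddCommGroup E] [NormedSpace ℂ E]
    {X : Type u} [AddCommGroup X] [Module ℂ X] [Bornology X] (f : E → X) (S : Set E) : Prop :=
  ∀ p ∈ S, ∃ (N : Set E) (Y : BanachSubobject X) (g : E → Y.E),
    IsOpen N ∧ p ∈ N ∧ N ⊆ S ∧ DifferentiableOn ℂ g N ∧ ∀ x ∈ N, Y.incl (g x) = f x

/-- `v` is the contour integral of `f` over the circle of radius `t` around `0`: the restriction of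
`f` to the circle is a continuous map into some completely normable subobject, and `v` is its
integral there. -/
def HasContourIntegral {X : Type u} [AddCommGroup X] [Module ℂ X] [Bornology X]
    (f : ℂ → X) (t : ℝ) (v : X) : Prop :=
  ∃ (Y : BanachSubobject X) (g : ℂ → Y.E), ContinuousOn g (Metric.sphere 0 t) ∧
    (∀ z ∈ Metric.sphere (0 : ℂ) t, Y.incl (g z) = f z) ∧ Y.incl (∮ z in C(0, t), g z) = v

open Classical in
/-- The contour integral over the circle of radius `t` around `0` (and `0` if it does not exist). -/
noncomputable def contourIntegral {X : Type u} [AddCommGroup X] [Module ℂ X] [Bornology X]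
    (f : ℂ → X) (t : ℝ) : X :=
  if h : ∃ v, HasContourIntegral f t v then h.choose else 0

/-! ## Affine-linearly invariant prefactorization algebras on `ℂ` -/

/-- A unital prefactorization algebra on `ℂ` with values in complete bornological vector spaces.
A map out of the completed tensor product of `F(U)` and `F(V)` into a complete space is the same
thing as a bounded bilinear map. -/
structure PrefactorizationAlgebra where
  obj : Opens ℂ → CBVS.{u}
  mul : ∀ {U V W : Opens ℂ}, Disjoint U V → U ≤ W → V ≤ W →
    (obj U →ₗ[ℂ] obj V →ₗ[ℂ] obj W)
  one : obj ⊥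
  mul_bounded : ∀ {U V W : Opens ℂ} (hd : Disjoint U V) (hU : U ≤ W) (hV : V ≤ W)
    (A : Set (obj U)) (B : Set (obj V)), Bornology.IsBounded A → Bornology.IsBounded B →
    Bornology.IsBounded (Set.image2 (fun x y => mul hd hU hV x y) A B)
  mul_assoc : ∀ {U₁ U₂ U₃ V₁ V₂ W : Opens ℂ} (h₁₂ : Disjoint U₁ U₂) (h₂₃ : Disjoint U₂ U₃)
    (_ : Disjoint U₁ U₃) (hV₁ : V₁ ≤ W) (hV₂ : V₂ ≤ W)
    (h₁₁ : U₁ ≤ V₁) (h₂₁ : U₂ ≤ V₁) (h₂₂ : U₂ ≤ V₂) (h₃₂ : U₃ ≤ V₂)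
    (hd₁ : Disjoint V₁ U₃) (hd₂ : Disjoint U₁ V₂) (x : obj U₁) (y : obj U₂) (z : obj U₃),
    mul hd₁ hV₁ (h₃₂.trans hV₂) (mul h₁₂ h₁₁ h₂₁ x y) z =
      mul hd₂ (h₁₁.trans hV₁) hV₂ x (mul h₂₃ h₂₂ h₃₂ y z)
  mul_one : ∀ (U : Opens ℂ) (x : obj U), mul disjoint_bot_right le_rfl bot_le x one = x
  mul_comm : ∀ {U V : Opens ℂ} (hd : Disjoint U V) (x : obj U) (y : obj V),
    mul hd.symm (le_sup_right : V ≤ U ⊔ V) le_sup_left y x = mul hd le_sup_left le_sup_right x y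

namespace PrefactorizationAlgebra

variable (F : PrefactorizationAlgebra.{u})

/-- The extension map `M^U_W : F(U) → F(W)`, multiplication with the unit. -/
noncomputable def ext {U W : Opens ℂ} (h : U ≤ W) : F.obj U →ₗ[ℂ] F.obj W :=
  (F.mul disjoint_bot_right h bot_le).flip F.one

/-- The `m`-ary multiplication map `M^{U₁,…,Uₘ}_W`. -/
noncomputable def mulN : ∀ {m : ℕ} (U : Fin m → Opens ℂ) (W : Opens ℂ)
    (_ : Pairwise fun i j => Disjoint (U i) (U j)) (_ : ∀ i, U i ≤ W),
    (∀ i, F.obj (U i)) → F.obj W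
  | 0, _, _, _, _, _ => F.ext bot_le F.one
  | _ + 1, U, W, hd, hW, x =>
    F.mul (U := U 0) (V := ⨆ i, U (Fin.succ i)) (W := W)
      (disjoint_iSup_iff.2 fun i => hd (Fin.succ_ne_zero i).symm) (hW 0)
      (iSup_le fun i => hW i.succ) (x 0)
      (mulN (fun i => U i.succ) (⨆ i, U (Fin.succ i))
        (fun _ _ hij => hd fun h => hij (Fin.succ_injective _ h))
        (fun i => le_iSup (fun i => U (Fin.succ i)) i) (fun i => x i.succ))

end PrefactorizationAlgebra

/-- The group `ℂˣ ⋉ ℂ` of affine-linear automorphisms of `ℂ`. -/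
abbrev AffGroup := ℂ ≃ᵃ[ℂ] ℂ

/-- The affine map `z ↦ a * z + b`. -/
noncomputable def affOf (a : ℂ) (ha : a ≠ 0) (b : ℂ) : AffGroup :=
  (LinearEquiv.smulOfNeZero ℂ ℂ a ha).toAffineEquiv.trans (AffineEquiv.constVAdd ℂ ℂ b)

theorem affOf_apply (a : ℂ) (ha : a ≠ 0) (b z : ℂ) : affOf a ha b z = a * z + b := by
  simp [affOf, add_comm]

/-- The open set `gU`. -/
def affImage (g : AffGroup) (U : Opens ℂ) : Opens ℂ :=
  ⟨g '' U, (AffineEquiv.toContinuousAffineEquiv g).toHomeomorph.isOpenMap _ U.isOpen⟩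

/-- An affine-linearly invariant prefactorization algebra on `ℂ`. The isomorphism
`σ_g : F(U) → F(gU)` is indexed by an open set `V` with a proof of `gU = V`. -/
structure AffInvPrefactorizationAlgebra extends PrefactorizationAlgebra.{u} where
  act : ∀ (g : AffGroup) {U V : Opens ℂ}, affImage g U = V → (obj U →ₗ[ℂ] obj V)
  act_bounded : ∀ (g : AffGroup) {U V : Opens ℂ} (h : affImage g U = V) (B : Set (obj U)),
    Bornology.IsBounded B → Bornology.IsBounded (act g h '' B)
  act_one : ∀ {U : Opens ℂ} (h : affImage 1 U = U) (x : obj U), act 1 h x = x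
  act_act : ∀ (g h : AffGroup) {U V W : Opens ℂ} (hUV : affImage h U = V)
    (hVW : affImage g V = W) (hUW : affImage (g * h) U = W) (x : obj U),
    act g hVW (act h hUV x) = act (g * h) hUW x
  act_unit : ∀ (g : AffGroup) (h : affImage g ⊥ = ⊥), act g h one = one
  act_mul : ∀ (g : AffGroup) {U V W U' V' W' : Opens ℂ}
    (hU : affImage g U = U') (hV : affImage g V = V') (hW : affImage g W = W')
    (hd : Disjoint U V) (hUW : U ≤ W) (hVW : V ≤ W)
    (hd' : Disjoint U' V') (hUW' : U' ≤ W') (hVW' : V' ≤ W') (x : obj U) (y : obj V),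
    act g hW (mul hd hUW hVW x y) = mul hd' hUW' hVW' (act g hU x) (act g hV y)

/-- The open disc `B_r(c)`. -/
def disc (c : ℂ) (r : ℝ) : Opens ℂ := ⟨Metric.ball c r, Metric.isOpen_ball⟩

theorem disc_mono {r R : ℝ} (c : ℂ) (h : r ≤ R) : disc c r ≤ disc c R :=
  Metric.ball_subset_ball h

theorem affImage_translation_disc (c : ℂ) (r : ℝ) :
    affImage (affOf 1 one_ne_zero c) (disc 0 r) = disc c r := by
  ext z
  constructor
  · rintro ⟨w, hw, rfl⟩
    have hw' : ‖w‖ < r := by simpa [disc] using hw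
    simpa [disc, affOf_apply] using hw'
  · intro hz
    refine ⟨z - c, ?_, by simp [affOf_apply]⟩
    have hz' : dist z c < r := by simpa [disc] using hz
    simpa [disc, dist_eq_norm] using hz'

/-- The set `𝒟_{U,V}` of affine maps sending `U` into `V`, in the global coordinates `(a, b)`,
`a ≠ 0`, of the complex Lie group of affine maps `z ↦ a * z + b`. -/
def transporter (U V : Opens ℂ) : Set (ℂ × ℂ) :=
  {p | ∃ ha : p.1 ≠ 0, affImage (affOf p.1 ha p.2) U ≤ V}

namespace AffInvPrefactorizationAlgebra

variable (F : AffInvPrefactorizationAlgebra.{u})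

theorem ext_act_bounded (g : AffGroup) {U V : Opens ℂ} (h : affImage g U ≤ V) :
    (F.ext h).comp (F.act g rfl) ∈ boundedMaps (F.obj U) (F.obj V) := by
  intro B hB
  refine (F.mul_bounded disjoint_bot_right h bot_le (F.act g rfl '' B) {F.one}
    (F.act_bounded g rfl B hB) Bornology.isBounded_singleton).subset ?_
  rintro _ ⟨x, hx, rfl⟩
  exact ⟨F.act g rfl x, ⟨x, hx, rfl⟩, F.one, rfl, rfl⟩

open Classical in
/-- The map `ρ_{U,V} : 𝒟_{U,V} → BVS(F(U), F(V))`, `g ↦ M^{gU}_V ∘ σ_g`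
(extended by zero outside of its domain). -/
noncomputable def rho (U V : Opens ℂ) (p : ℂ × ℂ) : boundedMaps (F.obj U) (F.obj V) :=
  if h : p ∈ transporter U V then
    ⟨(F.ext h.choose_spec).comp (F.act (affOf p.1 h.choose p.2) rfl), F.ext_act_bounded _ _⟩
  else 0

/-- `F` is holomorphic: every `ρ_{U,V}` is holomorphic on the interior of its domain. -/
def IsHolomorphic : Prop :=
  ∀ U V : Opens ℂ, BornHolomorphicOn (F.rho U V) (interior (transporter U V))

/-- The action of `q`, `0 < |q| < 1`, on `F(B_r(0))`. -/
noncomputable def discAction (r : ℝ) (q : ℂ) : F.obj (disc 0 r) →ₗ[ℂ] F.obj (disc 0 r) :=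
  (F.rho (disc 0 r) (disc 0 r) (q, 0)).1

/-- The projection `l_k^r : F(B_r(0)) → F(B_r(0))_k` to the `k`-th weight space,
`x ↦ (2πi)⁻¹ ∮ z^(-k-1) ρ(z)(x) dz`, the integral being over a circle of radius less than `1`. -/
noncomputable def weightProj (r : ℝ) (k : ℤ) (x : F.obj (disc 0 r)) : F.obj (disc 0 r) :=
  (2 * Real.pi * Complex.I : ℂ)⁻¹ •
    contourIntegral (fun z : ℂ => z ^ (-k - 1) • F.discAction r z x) (1 / 2)

/-- The costalk `F(0) = lim_{r > 0} F(B_r(0))`, with the subspace bornology of the product. -/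
def costalk : Submodule ℂ (∀ r : {r : ℝ // 0 < r}, F.obj (disc 0 r)) where
  carrier := {x | ∀ (r R : {r : ℝ // 0 < r}) (h : r.1 ≤ R.1), F.ext (disc_mono 0 h) (x r) = x R}
  add_mem' := by
    intro x y hx hy r R h
    simp [hx r R h, hy r R h]
  zero_mem' := by
    intro r R h
    simp
  smul_mem' := by
    intro c x hx r R h
    simp [hx r R h]

/-- The weight space `F(0)_k` of the costalk (on which the punctured unit disc acts
componentwise), with the subspace bornology. -/
def weightSpace (k : ℤ) : Submodule ℂ F.costalk where
  carrier := {x | ∀ q : ℂ, 0 < ‖q‖ → ‖q‖ < 1 → ∀ r : {r : ℝ // 0 < r},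
    F.discAction r.1 q (x.1 r) = q ^ k • x.1 r}
  add_mem' := by
    intro x y hx hy q h0 h1 r
    simp [hx q h0 h1 r, hy q h0 h1 r]
  zero_mem' := by
    intro q _ _ r
    simp
  smul_mem' := by
    intro c x hx q h0 h1 r
    simp [hx q h0 h1 r, smul_comm c]

/-- The restriction of `π_r : F(0) → F(B_r(0))` to `F(0)_k`. -/
def weightToDisc (r : {r : ℝ // 0 < r}) (k : ℤ) : F.weightSpace k →ₗ[ℂ] F.obj (disc 0 r) :=
  (LinearMap.proj r).comp (F.costalk.subtype.comp (F.weightSpace k).subtype)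

/-- `F` has discrete weight spaces. -/
def HasDiscreteWeightSpaces : Prop := ∀ k : ℤ, IsDiscreteBornological (F.weightSpace k)

/-- The map `P_r : VF = ⨁ₖ F(0)_k → F(B_r(0))`. -/
noncomputable def P (r : {r : ℝ // 0 < r}) : (⨁ k, F.weightSpace k) →ₗ[ℂ] F.obj (disc 0 r) :=
  DirectSum.toModule ℂ ℤ _ (F.weightToDisc r)

/-- The map `L^R : F(B_R(0)) → ∏ₖ F(0)_k`: the `k`-th component of `L^R(x)` is the element of
`F(0)_k` which is mapped to `l_k^R(x)` by the bijection `F(0)_k → F(B_R(0))_k`. -/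
noncomputable def L (R : {r : ℝ // 0 < r}) (x : F.obj (disc 0 R)) (k : ℤ) : F.weightSpace k :=
  Function.invFun (F.weightToDisc R k) (F.weightProj R.1 k x)

end AffInvPrefactorizationAlgebra

/-- `z ∈ D(r₁,…,rₘ;R)`: the discs `B_{rᵢ}(zᵢ)` are pairwise disjoint and contained in `B_R(0)`. -/
structure DiscConfig {m : ℕ} (z : Fin m → ℂ) (r : Fin m → {r : ℝ // 0 < r})
    (R : {r : ℝ // 0 < r}) : Prop where
  disjoint : Pairwise fun i j => Disjoint (disc (z i) (r i)) (disc (z j) (r j))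
  le : ∀ i, disc (z i) (r i) ≤ disc 0 R

/-- `ℂᵐ ∖ Δ`. -/
abbrev Conf (m : ℕ) := {z : Fin m → ℂ // Function.Injective z}

theorem exists_discConfig {m : ℕ} (z : Conf m) :
    ∃ p : (Fin m → {r : ℝ // 0 < r}) × {r : ℝ // 0 < r}, DiscConfig z.1 p.1 p.2 := by
  have h1 : ∀ᶠ r in nhdsWithin (0 : ℝ) (Set.Ioi 0),
      ∀ i j : Fin m, i ≠ j → r + r ≤ dist (z.1 i) (z.1 j) := by
    rw [Filter.eventually_all]
    intro i
    rw [Filter.eventually_all]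
    intro j
    by_cases hij : i = j
    · exact Filter.Eventually.of_forall fun r h => absurd hij h
    · have hpos : 0 < dist (z.1 i) (z.1 j) / 2 := half_pos (dist_pos.2 fun h => hij (z.2 h))
      filter_upwards [nhdsWithin_le_nhds (Iio_mem_nhds hpos)] with r hr _
      have : r < dist (z.1 i) (z.1 j) / 2 := hr
      linarith
  obtain ⟨r, hr, hr0⟩ := (h1.and self_mem_nhdsWithin).exists
  have hr0' : 0 < r := hr0
  have hS : ∀ i, ‖z.1 i‖ ≤ ∑ j, ‖z.1 j‖ := fun i =>
    Finset.single_le_sum (f := fun j => ‖z.1 j‖) (fun j _ => norm_nonneg _) (Finset.mem_univ i)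
  refine ⟨(fun _ => ⟨r, hr0'⟩, ⟨r + ∑ j, ‖z.1 j‖,
    add_pos_of_pos_of_nonneg hr0' (Finset.sum_nonneg fun _ _ => norm_nonneg _)⟩), ?_, ?_⟩
  · intro i j hij
    exact Opens.coe_disjoint.1 (Metric.ball_disjoint_ball (hr i j hij))
  · intro i
    refine Metric.ball_subset_ball' ?_
    have := hS i
    simp only [dist_zero_right]
    linarith

namespace AffInvPrefactorizationAlgebra

variable (F : AffInvPrefactorizationAlgebra.{u})

/-- The product of `a₁,…,aₘ` inserted at `z₁,…,zₘ` by means of the discs `B_{rᵢ}(zᵢ) ⊆ B_R(0)`: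
`M(σ_{+z₁}(P_{r₁} a₁), …, σ_{+zₘ}(P_{rₘ} aₘ)) ∈ F(B_R(0))`. -/
noncomputable def discProduct {m : ℕ} (z : Fin m → ℂ) (r : Fin m → {r : ℝ // 0 < r})
    (R : {r : ℝ // 0 < r}) (h : DiscConfig z r R) (a : Fin m → ⨁ k, F.weightSpace k) :
    F.obj (disc 0 R) :=
  F.mulN (fun i => disc (z i) (r i)) (disc 0 R) h.disjoint h.le fun i =>
    F.act (affOf 1 one_ne_zero (z i)) (affImage_translation_disc (z i) (r i)) (F.P (r i) (a i))

/-- The maps `μ` of `VF`: `μ(a₁,z₁,…,aₘ,zₘ) = L^R(M(σ_{+z₁}(P_{r₁} a₁), …, σ_{+zₘ}(P_{rₘ} aₘ)))`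
for some choice of radii with `z ∈ D(r₁,…,rₘ;R)`. -/
noncomputable def mu (m : ℕ) (a : Fin m → ⨁ k, F.weightSpace k) (z : Conf m) (k : ℤ) :
    F.weightSpace k :=
  F.L (exists_discConfig z).choose.2
    (F.discProduct z.1 _ _ (exists_discConfig z).choose_spec a) k

end AffInvPrefactorizationAlgebra

/-! ## Geometric vertex algebras -/

/-- A function on an open set `S` with values in `∏ₖ V k` is holomorphic if each of its components
takes values in a finite-dimensional subspace and is holomorphic. -/
def ProdHolomorphic {E : Type*} [NormedAddCommGroup E] [NormedSpace ℂ E] (V : ℤ → Type u)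
    [∀ k, AddCommGroup (V k)] [∀ k, Module ℂ (V k)] (S : Set E) (f : S → ∀ k, V k) : Prop :=
  ∀ k, ∃ (n : ℕ) (φ : (Fin n → ℂ) →ₗ[ℂ] V k) (g : E → Fin n → ℂ),
    DifferentiableOn ℂ g S ∧ ∀ x : S, φ (g x) = f x k

/-- The set of `(z, w)` with `max |wⱼ| < min |zᵢ - z_{m+1}|`. -/
def assocDomain (m n : ℕ) : Set ((Fin (m + 1) → ℂ) × (Fin n → ℂ)) :=
  {p | Function.Injective p.1 ∧ Function.Injective p.2 ∧
    ∀ (i : Fin m) (j : Fin n), ‖p.2 j‖ < ‖p.1 i.castSucc - p.1 (Fin.last m)‖}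

/-- The configuration `(z₁,…,zₘ, w₁+z_{m+1},…,wₙ+z_{m+1})`. -/
def assocConf {m n : ℕ} (p : (Fin (m + 1) → ℂ) × (Fin n → ℂ)) (hp : p ∈ assocDomain m n) :
    Conf (m + n) :=
  ⟨Fin.append (fun i : Fin m => p.1 i.castSucc) (fun j => p.2 j + p.1 (Fin.last m)), by
    obtain ⟨h1, h2, h3⟩ := hp
    refine Fin.append_injective_iff.2
      ⟨fun i j h => Fin.castSucc_injective _ (h1 h), fun i j h => h2 (add_right_cancel h), ?_⟩
    intro i j h
    have := h3 i j
    have h' : p.1 i.castSucc = p.2 j + p.1 (Fin.last m) := h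
    rw [h', add_sub_cancel_right] at this
    exact lt_irrefl _ this⟩

/-- The action of `q ∈ ℂˣ` on `⨁ₖ V k`, by `q ^ k` on the `k`-th summand. -/
noncomputable def gradedScale (V : ℤ → Type u) [∀ k, AddCommGroup (V k)] [∀ k, Module ℂ (V k)]
    (q : ℂˣ) : (⨁ k, V k) →ₗ[ℂ] (⨁ k, V k) :=
  DirectSum.lmap fun k => ((q : ℂ) ^ k) • LinearMap.id

/-- The configuration `(σz)ᵢ = z_{σ(i)}`. -/
def Conf.perm {m : ℕ} (z : Conf m) (s : Equiv.Perm (Fin m)) : Conf m :=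
  ⟨fun i => z.1 (s i), z.2.comp s.injective⟩

/-- The configuration `(q z₁, …, q zₘ)`. -/
def Conf.scale {m : ℕ} (z : Conf m) (q : ℂˣ) : Conf m :=
  ⟨fun i => q * z.1 i, fun _ _ h => z.2 (mul_left_cancel₀ q.ne_zero h)⟩

/-- The configuration consisting of the single point `x`. -/
def Conf.single (x : ℂ) : Conf 1 := ⟨fun _ => x, Function.injective_of_subsingleton _⟩

/-- The configuration `(x, 0)` for `x ≠ 0`. -/
def Conf.withZero (x : ℂ) (hx : x ≠ 0) : Conf 2 :=
  ⟨![x, 0], by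
    intro i j h
    fin_cases i <;> fin_cases j <;> simp_all [eq_comm]⟩

/-- The meromorphicity axiom: for all `a`, `b` there is an `N` such that
`z ^ N • μ(a, z, b, 0)` extends to a holomorphic function of `z ∈ ℂ`. -/
def IsMeromorphicOPE (V : ℤ → Type u) [∀ k, AddCommGroup (V k)] [∀ k, Module ℂ (V k)]
    (μ : ∀ m : ℕ, (Fin m → ⨁ k, V k) → Conf m → ∀ k, V k) : Prop :=
  ∀ a b : ⨁ k, V k, ∃ (N : ℕ) (f : ℂ → ∀ k, V k),
    ProdHolomorphic V Set.univ (fun x : (Set.univ : Set ℂ) => f x.1) ∧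
    ∀ (x : ℂ) (hx : x ≠ 0), f x = x ^ N • μ 2 ![a, b] (Conf.withZero x hx)

/-- `(⨁ₖ V k, μ)` is a geometric vertex algebra. -/
structure IsGeometricVertexAlgebra (V : ℤ → Type u) [∀ k, AddCommGroup (V k)]
    [∀ k, Module ℂ (V k)] (μ : ∀ m : ℕ, (Fin m → ⨁ k, V k) → Conf m → ∀ k, V k) : Prop where
  /-- `μ(a, z)` is multilinear in `a`, i.e. defined on the `m`-th tensor power. -/
  multilinear : ∀ m : ℕ, ∃ T : MultilinearMap ℂ (fun _ : Fin m => ⨁ k, V k)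
    (Conf m → ∀ k, V k), ⇑T = μ m
  /-- `μ(a)` is a holomorphic function on `ℂᵐ ∖ Δ`. -/
  holomorphic : ∀ (m : ℕ) (a : Fin m → ⨁ k, V k),
    ProdHolomorphic V {z : Fin m → ℂ | Function.Injective z} (μ m a)
  permutation : ∀ (m : ℕ) (a : Fin m → ⨁ k, V k) (z : Conf m) (s : Equiv.Perm (Fin m)),
    μ m (fun i => a (s i)) (z.perm s) = μ m a z
  insertion_at_zero : ∀ (a : ⨁ k, V k) (k : ℤ), μ 1 (fun _ => a) (Conf.single 0) k = a k
  equivariance : ∀ (m : ℕ) (a : Fin m → ⨁ k, V k) (z : Conf m) (q : ℂˣ) (k : ℤ),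
    μ m (fun i => gradedScale V q (a i)) (z.scale q) k = (q : ℂ) ^ k • μ m a z k
  /-- The sum over `k` of the functions
  `μ(a₁,z₁,…,aₘ,zₘ, p_k μ(b₁,w₁,…,bₙ,wₙ), z_{m+1})` of `(z, w)` is
  `μ(a₁,z₁,…,aₘ,zₘ, b₁,w₁+z_{m+1},…,bₙ,wₙ+z_{m+1})`. For each component `l` and each compact set `K`
  the convergence takes place absolutely and uniformly on `K` in some finite-dimensional space. -/
  associativity : ∀ (m n : ℕ) (a : Fin m → ⨁ k, V k) (b : Fin n → ⨁ k, V k)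
    (K : Set ((Fin (m + 1) → ℂ) × (Fin n → ℂ))) (hK : K ⊆ assocDomain m n), IsCompact K →
    ∀ l : ℤ, ∃ (d : ℕ) (φ : (Fin d → ℂ) →ₗ[ℂ] V l)
      (g : ℤ → (Fin (m + 1) → ℂ) × (Fin n → ℂ) → Fin d → ℂ) (C : ℤ → ℝ),
      Summable C ∧ ∀ (p : (Fin (m + 1) → ℂ) × (Fin n → ℂ)) (hp : p ∈ K),
        (∀ k, ‖g k p‖ ≤ C k) ∧
        (∀ k, φ (g k p) = μ (m + 1)
          (Fin.snoc a (DirectSum.of V k (μ n b ⟨p.2, (hK hp).2.1⟩ k))) ⟨p.1, (hK hp).1⟩ l) ∧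
        φ (∑' k, g k p) = μ (m + n) (Fin.append a b) (assocConf p (hK hp)) l
  meromorphicity : IsMeromorphicOPE V μ

/-- `F` has meromorphic operator product expansion. -/
def AffInvPrefactorizationAlgebra.HasMeromorphicOPE (F : AffInvPrefactorizationAlgebra.{u}) :
    Prop :=
  IsMeromorphicOPE (fun k => F.weightSpace k) F.mu

/-! ## Lifts to completely normable subobjects -/

/-! Everything rests on the scaling maps `ρ(q) : F(B_R(0)) → F(B_s(0))`, which are holomorphic in
`q` and multiplicative. Expand `ρ(q)x` into a Laurent series in `q`. The substitution `p ↦ qp` in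
the contour integral shows that the `k`-th coefficient is a weight vector of weight `k`. A weight
vector on one disc determines one on every other disc, by scaling and dividing by `p ^ k`. Hence
`F(0)_k` embeds in each `F(B_R(0))` with image the full weight space, and `L` is well defined,
linear, bounded and compatible with scaling (`weightProj_of_lift`, `scal_weightProj`,
`exists_weightToDisc_eq`, `L_scal`).

The algebraic axioms and the independence of the radii then follow from commutativity, associativity
and equivariance of the multiplication. These are used through products of lists (`lprod_perm`,
`lprod_nested`, `tr_lprod`).

Holomorphy: near a configuration the insertions are holomorphic maps into fixed spaces, and
multiplication is bounded. Applying a component of `L` gives values in a discrete space, so locally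
in a finite-dimensional one. The identity theorem along complex lines shows that a single
finite-dimensional space serves all configurations (`exists_global_finite`).

Associativity: if `r < r'`, then `ρ(q) : F(B_r(0)) → F(B_{r'}(0))` is holomorphic on an annulus
around the unit circle, and `ρ(1)` is the extension map. Its Laurent series at `q = 1` therefore
converges absolutely and writes `x` as the sum of its weight components (`exists_expansion`).
Multiplying with the remaining insertions and applying `L` is a bounded linear operation,
equibounded for nearby insertion points, so it can be applied termwise with uniform estimates
(`exists_local_assoc`). Compactness passes from neighbourhoods to compact sets. Meromorphicity is a
hypothesis.

Analysis takes place in Banach spaces throughout: a bounded linear map from a normed space to a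
complete bornological space factors through a completely normable subobject
(`IsBornologicallyComplete.exists_lift`), and any two such subobjects lie in a third. -/

/-- Injectivity of `i` makes preimages unique, so choosing them is automatically linear; homogeneity
carries the bound from the unit ball to all of `A`. -/
theorem LinearMap.exists_lift_of_ball {A E X : Type*} [NormedAddCommGroup A] [NormedSpace ℂ A]
    [NormedAddCommGroup E] [NormedSpace ℂ E] [AddCommGroup X] [Module ℂ X] (i : E →ₗ[ℂ] X)
    (hi : Function.Injective i) (T : A →ₗ[ℂ] X) {M : ℝ}
    (h : ∀ a, ‖a‖ ≤ 1 → ∃ e, ‖e‖ ≤ M ∧ i e = T a) :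
    ∃ T' : A →L[ℂ] E, ‖T'‖ ≤ M ∧ ∀ a, i (T' a) = T a := by
  have hM : 0 ≤ M := by
    obtain ⟨e, he, -⟩ := h 0 (by simp)
    exact (norm_nonneg e).trans he
  have key : ∀ a, ∃ e, ‖e‖ ≤ M * ‖a‖ ∧ i e = T a := by
    intro a
    by_cases ha : a = 0
    · exact ⟨0, by simp [ha]⟩
    have hn : ‖a‖ ≠ 0 := norm_ne_zero_iff.2 ha
    obtain ⟨e, he, he'⟩ := h (((‖a‖⁻¹ : ℝ) : ℂ) • a) (by
      rw [norm_smul, Complex.norm_real, norm_inv, norm_norm, inv_mul_cancel₀ hn])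
    refine ⟨((‖a‖ : ℝ) : ℂ) • e, ?_, ?_⟩
    · rw [norm_smul, Complex.norm_real, norm_norm, mul_comm]
      gcongr
    · rw [map_smul, he', map_smul, smul_smul, ← Complex.ofReal_mul, mul_inv_cancel₀ hn,
        Complex.ofReal_one, one_smul]
  choose f hf hf' using key
  let L : A →ₗ[ℂ] E :=
    { toFun := f
      map_add' := fun a b => hi (by simp [hf'])
      map_smul' := fun c a => hi (by simp [hf']) }
  exact ⟨L.mkContinuous M hf, L.mkContinuous_norm_le hM hf, hf'⟩

/-- Currying: the unary statement is applied to each `T a`, then to `T` itself, with `B →L[ℂ] E`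
embedded in `B →ₗ[ℂ] X`. -/
theorem LinearMap.exists_lift_of_ball₂ {A B E X : Type*} [NormedAddCommGroup A] [NormedSpace ℂ A]
    [NormedAddCommGroup B] [NormedSpace ℂ B]
    [NormedAddCommGroup E] [NormedSpace ℂ E] [AddCommGroup X] [Module ℂ X] (i : E →ₗ[ℂ] X)
    (hi : Function.Injective i) (T : A →ₗ[ℂ] B →ₗ[ℂ] X) {M : ℝ}
    (h : ∀ a b, ‖a‖ ≤ 1 → ‖b‖ ≤ 1 → ∃ e, ‖e‖ ≤ M ∧ i e = T a b) :
    ∃ T' : A →L[ℂ] B →L[ℂ] E, ∀ a b, i (T' a b) = T a b := by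
  let i' : (B →L[ℂ] E) →ₗ[ℂ] (B →ₗ[ℂ] X) :=
    { toFun := fun S => i ∘ₗ S.toLinearMap
      map_add' := fun S S' => by ext; simp
      map_smul' := fun c S => by ext; simp }
  have hi' : Function.Injective i' := fun S S' hS => by
    ext b
    exact hi (LinearMap.congr_fun hS b)
  obtain ⟨T', -, hT'⟩ := LinearMap.exists_lift_of_ball i' hi' T (M := M) fun a ha => by
    obtain ⟨S, hS, hS'⟩ := LinearMap.exists_lift_of_ball i hi (T a) fun b hb => h a b ha hb
    exact ⟨S, hS, LinearMap.ext hS'⟩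
  exact ⟨T', fun a b => LinearMap.congr_fun (hT' a) b⟩

section Bornological

variable {X Y Z : Type u} [AddCommGroup X] [Module ℂ X] [Bornology X]
  [AddCommGroup Y] [Module ℂ Y] [Bornology Y]
  [AddCommGroup Z] [Module ℂ Z] [Bornology Z]

/-- The passage from bornologies to norms: completeness puts the image of the unit ball boundedly
into one Banach subobject, and the whole map follows. -/
theorem IsBornologicallyComplete.exists_lift {A : Type*} [NormedAddCommGroup A] [NormedSpace ℂ A]
    (hX : IsBornologicallyComplete X) (T : A →ₗ[ℂ] X)
    (hT : Bornology.IsBounded (T '' Metric.closedBall 0 1)) :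
    ∃ (W : BanachSubobject X) (T' : A →L[ℂ] W.E), ∀ a, W.incl (T' a) = T a := by
  obtain ⟨W, C, hC, hCT⟩ := hX _ hT
  obtain ⟨M, hM⟩ := isBounded_iff_forall_norm_le.1 hC
  obtain ⟨T', -, hT'⟩ := LinearMap.exists_lift_of_ball W.incl W.injective T (M := M) fun a ha => by
    have : T a ∈ W.incl '' C := hCT ▸ ⟨a, by simpa using ha, rfl⟩
    obtain ⟨e, he, he'⟩ := this
    exact ⟨e, hM e he, he'⟩
  exact ⟨W, T', hT'⟩

theorem IsBornologicallyComplete.exists_lift₂ {A B : Type*} [NormedAddCommGroup A]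
    [NormedSpace ℂ A] [NormedAddCommGroup B] [NormedSpace ℂ B]
    (hX : IsBornologicallyComplete X) (T : A →ₗ[ℂ] B →ₗ[ℂ] X)
    (hT : Bornology.IsBounded
      (Set.image2 (fun a b => T a b) (Metric.closedBall 0 1) (Metric.closedBall 0 1))) :
    ∃ (W : BanachSubobject X) (T' : A →L[ℂ] B →L[ℂ] W.E), ∀ a b, W.incl (T' a b) = T a b := by
  obtain ⟨W, C, hC, hCT⟩ := hX _ hT
  obtain ⟨M, hM⟩ := isBounded_iff_forall_norm_le.1 hC
  obtain ⟨T', hT'⟩ :=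
    LinearMap.exists_lift_of_ball₂ W.incl W.injective T (M := M) fun a b ha hb => by
      have : T a b ∈ W.incl '' C := hCT ▸ ⟨a, by simpa using ha, b, by simpa using hb, rfl⟩
      obtain ⟨e, he, he'⟩ := this
      exact ⟨e, hM e he, he'⟩
  exact ⟨W, T', hT'⟩

/-- The sum map `Y₁ × Y₂ → X` is bounded on the unit ball, so it lifts. This makes the Banach
subobjects a directed system. -/
theorem BanachSubobject.exists_sup [IsBornologicalVectorSpace X] (hX : IsBornologicallyComplete X)
    (Y₁ Y₂ : BanachSubobject X) :
    ∃ (W : BanachSubobject X) (i₁ : Y₁.E →L[ℂ] W.E) (i₂ : Y₂.E →L[ℂ] W.E),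
      (∀ y, W.incl (i₁ y) = Y₁.incl y) ∧ ∀ y, W.incl (i₂ y) = Y₂.incl y := by
  obtain ⟨W, T, hT⟩ := hX.exists_lift (Y₁.incl.coprod Y₂.incl) (by
    refine (isBounded_add_of_bornological (Y₁.bounded _ (Metric.isBounded_closedBall (x := 0)
      (r := 1))) (Y₂.bounded _ (Metric.isBounded_closedBall (x := 0) (r := 1)))).subset ?_
    rintro _ ⟨⟨a, b⟩, hab, rfl⟩
    have hab' : ‖(a, b)‖ ≤ 1 := by simpa using hab
    exact ⟨_, ⟨a, by simpa using (norm_fst_le (a, b)).trans hab', rfl⟩,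
      _, ⟨b, by simpa using (norm_snd_le (a, b)).trans hab', rfl⟩, rfl⟩)
  exact ⟨W, T.comp (ContinuousLinearMap.inl ℂ _ _), T.comp (ContinuousLinearMap.inr ℂ _ _),
    fun y => by simp [hT], fun y => by simp [hT]⟩

theorem IsBornologicallyComplete.exists_mem (hX : IsBornologicallyComplete X) (x : X) :
    ∃ (W : BanachSubobject X) (e : W.E), W.incl e = x := by
  obtain ⟨W, C, -, hC⟩ := hX {x} Bornology.isBounded_singleton
  have : x ∈ W.incl '' C := hC ▸ rfl
  obtain ⟨e, -, he⟩ := this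
  exact ⟨W, e, he⟩

theorem boundedMaps.isBounded_iff [IsBornologicalVectorSpace Y] {B : Set (boundedMaps X Y)} :
    Bornology.IsBounded B ↔ ∀ C : Set X, Bornology.IsBounded C →
      ∃ D : Set Y, Bornology.IsBounded D ∧ ∀ f ∈ B, f.1 '' C ⊆ D :=
  Bornology.isBounded_ofBounded_iff _

/-! ## Holomorphic maps -/

section Holomorphic

variable {E : Type*} [NormedAddCommGroup E] [NormedSpace ℂ E]

theorem BornHolomorphicOn.exists_isBounded_nhds {f : E → X} {S : Set E}
    (hf : BornHolomorphicOn f S) {p : E} (hp : p ∈ S) :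
    ∃ N : Set E, IsOpen N ∧ p ∈ N ∧ N ⊆ S ∧ Bornology.IsBounded (f '' N) := by
  obtain ⟨N, Y₀, g, hN, hpN, hNS, hg, hgf⟩ := hf p hp
  have hc : ContinuousAt g p := (hg.differentiableAt (hN.mem_nhds hpN)).continuousAt
  obtain ⟨N', hN'sub, hN', hpN'⟩ := mem_nhds_iff.1
    (Filter.inter_mem (hN.mem_nhds hpN) (hc (Metric.ball_mem_nhds (g p) one_pos)))
  refine ⟨N', hN', hpN', fun x hx => hNS (hN'sub hx).1,
    (Y₀.bounded _ (Metric.isBounded_ball (x := g p) (r := 1))).subset ?_⟩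
  rintro _ ⟨x, hx, rfl⟩
  exact ⟨g x, (hN'sub hx).2, hgf x (hN'sub hx).1⟩

theorem BornHolomorphicOn.comp_differentiableOn {E' : Type*} [NormedAddCommGroup E']
    [NormedSpace ℂ E'] {f : E → X} {S : Set E} (hf : BornHolomorphicOn f S) {h : E' → E}
    {S' : Set E'} (hS' : IsOpen S') (hh : DifferentiableOn ℂ h S') (hm : Set.MapsTo h S' S) :
    BornHolomorphicOn (fun x => f (h x)) S' := by
  intro p hp
  obtain ⟨N, Y₀, g, hN, hpN, hNS, hg, hgf⟩ := hf (h p) (hm hp)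
  refine ⟨S' ∩ h ⁻¹' N, Y₀, g ∘ h, hh.continuousOn.isOpen_inter_preimage hS' hN, ⟨hp, hpN⟩,
    Set.inter_subset_left, hg.comp (hh.mono Set.inter_subset_left) fun x hx => hx.2,
    fun x hx => hgf _ hx.2⟩

theorem BornHolomorphicOn.congr {f g : E → X} {S : Set E} (hf : BornHolomorphicOn f S)
    (h : ∀ x ∈ S, g x = f x) : BornHolomorphicOn g S := by
  intro p hp
  obtain ⟨N, Y₀, l, hN, hpN, hNS, hl, hlf⟩ := hf p hp
  exact ⟨N, Y₀, l, hN, hpN, hNS, hl, fun x hx => (hlf x hx).trans (h x (hNS hx)).symm⟩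

theorem bornHolomorphicOn_const (hX : IsBornologicallyComplete X) (x : X) {S : Set E}
    (hS : IsOpen S) : BornHolomorphicOn (fun _ => x) S := by
  intro p hp
  obtain ⟨W, e, he⟩ := hX.exists_mem x
  exact ⟨S, W, fun _ => e, hS, hp, subset_rfl, differentiableOn_const e, fun _ _ => he⟩

/-- On local Banach lifts of `f` and `g`, the form `β` becomes a continuous bilinear map, to which
the product rule applies. -/
theorem BornHolomorphicOn.bilinear (hZ : IsBornologicallyComplete Z) {β : X →ₗ[ℂ] Y →ₗ[ℂ] Z}
    (hβ : ∀ (A : Set X) (B : Set Y), Bornology.IsBounded A → Bornology.IsBounded B →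
      Bornology.IsBounded (Set.image2 (fun x y => β x y) A B))
    {f : E → X} {g : E → Y} {S : Set E} (hf : BornHolomorphicOn f S)
    (hg : BornHolomorphicOn g S) : BornHolomorphicOn (fun p => β (f p) (g p)) S := by
  intro p hp
  obtain ⟨N₁, Y₁, l₁, hN₁, hp₁, hS₁, hl₁, h₁⟩ := hf p hp
  obtain ⟨N₂, Y₂, l₂, hN₂, hp₂, hS₂, hl₂, h₂⟩ := hg p hp
  obtain ⟨W, T, hT⟩ := hZ.exists_lift₂ (β.compl₁₂ Y₁.incl Y₂.incl) (by
    refine (hβ _ _ (Y₁.bounded _ (Metric.isBounded_closedBall (x := 0) (r := 1)))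
      (Y₂.bounded _ (Metric.isBounded_closedBall (x := 0) (r := 1)))).subset ?_
    rintro _ ⟨a, ha, b, hb, rfl⟩
    exact ⟨_, ⟨a, ha, rfl⟩, _, ⟨b, hb, rfl⟩, rfl⟩)
  refine ⟨N₁ ∩ N₂, W, fun x => T (l₁ x) (l₂ x), hN₁.inter hN₂, ⟨hp₁, hp₂⟩,
    Set.inter_subset_left.trans hS₁, ?_, fun x hx => by simp [hT, h₁ x hx.1, h₂ x hx.2]⟩
  exact (T.differentiable.comp_differentiableOn (hl₁.mono Set.inter_subset_left)).clm_apply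
    (hl₂.mono Set.inter_subset_right)

/-- A holomorphic family of bounded maps restricts locally to a holomorphic family of continuous
operators between Banach spaces. -/
theorem BornHolomorphicOn.exists_operator_lift_nhds [IsBornologicalVectorSpace Y]
    {ρ : E → boundedMaps X Y} {S : Set E} (hρ : BornHolomorphicOn ρ S)
    (hY : IsBornologicallyComplete Y) {A : Type*} [NormedAddCommGroup A] [NormedSpace ℂ A]
    (j : A →ₗ[ℂ] X) (hj : Bornology.IsBounded (j '' Metric.closedBall 0 1)) {p : E} (hp : p ∈ S) :
    ∃ (N : Set E) (W : BanachSubobject Y) (G : E → (A →L[ℂ] W.E)), IsOpen N ∧ p ∈ N ∧ N ⊆ S ∧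
      DifferentiableOn ℂ G N ∧ ∀ x ∈ N, ∀ a, W.incl (G x a) = (ρ x).1 (j a) := by
  obtain ⟨N, Y₀, g, hN, hpN, hNS, hg, hgf⟩ := hρ p hp
  -- Elements of `Y₀` are operators. Evaluating them on `A` is a bounded bilinear map precisely
  -- because bounded sets of operators are equibounded.
  let B : Y₀.E →ₗ[ℂ] A →ₗ[ℂ] Y := LinearMap.mk₂ ℂ (fun y a => (Y₀.incl y).1 (j a))
    (by intros; simp) (by intros; simp) (by intros; simp) (by intros; simp)
  obtain ⟨W, T, hT⟩ := hY.exists_lift₂ B (by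
    obtain ⟨D, hD, hD'⟩ := boundedMaps.isBounded_iff.1
      (Y₀.bounded _ (Metric.isBounded_closedBall (x := 0) (r := 1))) _ hj
    refine hD.subset ?_
    rintro _ ⟨y, hy, a, ha, rfl⟩
    exact hD' _ ⟨y, hy, rfl⟩ ⟨j a, ⟨a, ha, rfl⟩, rfl⟩)
  refine ⟨N, W, fun x => T (g x), hN, hpN, hNS, T.differentiable.comp_differentiableOn hg, ?_⟩
  intro x hx a
  rw [hT, ← hgf x hx]
  rfl

/-- Over a compact set, a single Banach space suffices. -/
theorem BornHolomorphicOn.exists_operator_lift [IsBornologicalVectorSpace Y]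
    {ρ : E → boundedMaps X Y} {S : Set E} (hρ : BornHolomorphicOn ρ S)
    (hY : IsBornologicallyComplete Y) {A : Type*} [NormedAddCommGroup A] [NormedSpace ℂ A]
    (j : A →ₗ[ℂ] X) (hj : Bornology.IsBounded (j '' Metric.closedBall 0 1)) {K : Set E}
    (hK : IsCompact K) (hKS : K ⊆ S) :
    ∃ (W : BanachSubobject Y) (G : E → (A →L[ℂ] W.E)),
      ∀ p ∈ K, DifferentiableAt ℂ G p ∧ ∀ a, W.incl (G p a) = (ρ p).1 (j a) := by
  have push : ∀ (W W' : BanachSubobject Y) (i : W.E →L[ℂ] W'.E),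
      (∀ y, W'.incl (i y) = W.incl y) → ∀ p,
      (∃ (N : Set E) (G : E → (A →L[ℂ] W.E)), IsOpen N ∧ p ∈ N ∧ DifferentiableOn ℂ G N ∧
        ∀ x ∈ N, ∀ a, W.incl (G x a) = (ρ x).1 (j a)) →
      (∃ (N : Set E) (G : E → (A →L[ℂ] W'.E)), IsOpen N ∧ p ∈ N ∧ DifferentiableOn ℂ G N ∧
        ∀ x ∈ N, ∀ a, W'.incl (G x a) = (ρ x).1 (j a)) := by
    rintro W W' i hi p ⟨N, G, hN, hpN, hG, h⟩
    exact ⟨N, fun x => i.comp (G x), hN, hpN, (differentiableOn_const i).clm_comp hG,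
      fun x hx a => by simp [hi, h x hx]⟩
  have key : ∃ W : BanachSubobject Y, ∀ p ∈ K, ∃ (N : Set E) (G : E → (A →L[ℂ] W.E)),
      IsOpen N ∧ p ∈ N ∧ DifferentiableOn ℂ G N ∧
        ∀ x ∈ N, ∀ a, W.incl (G x a) = (ρ x).1 (j a) := by
    -- Compactness leaves finitely many local subobjects to merge, two at a time, by `exists_sup`.
    refine hK.induction_on (p := fun K => ∃ W : BanachSubobject Y, ∀ p ∈ K, ∃ (N : Set E)
      (G : E → (A →L[ℂ] W.E)), IsOpen N ∧ p ∈ N ∧ DifferentiableOn ℂ G N ∧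
        ∀ x ∈ N, ∀ a, W.incl (G x a) = (ρ x).1 (j a)) ?_ ?_ ?_ ?_
    · obtain ⟨W, -⟩ := hY.exists_mem 0
      exact ⟨W, fun p hp => hp.elim⟩
    · rintro s t hst ⟨W, h⟩
      exact ⟨W, fun p hp => h p (hst hp)⟩
    · rintro s t ⟨W₁, h₁⟩ ⟨W₂, h₂⟩
      obtain ⟨W, i₁, i₂, hi₁, hi₂⟩ := BanachSubobject.exists_sup hY W₁ W₂
      refine ⟨W, ?_⟩
      rintro p (hp | hp)
      · exact push W₁ W i₁ hi₁ p (h₁ p hp)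
      · exact push W₂ W i₂ hi₂ p (h₂ p hp)
    · intro p hp
      obtain ⟨N, W, G, hN, hpN, -, hG, h⟩ := hρ.exists_operator_lift_nhds hY j hj (hKS hp)
      exact ⟨N, mem_nhdsWithin_of_mem_nhds (hN.mem_nhds hpN), W, fun x hx => ⟨N, G, hN, hx, hG, h⟩⟩
  obtain ⟨W, hW⟩ := key
  classical
  -- A lift through the injective `W.incl` is unique, so this pointwise choice agrees with every
  -- local lift and inherits its differentiability. The value `0` off the domain is arbitrary.
  let G : E → (A →L[ℂ] W.E) := fun x =>
    if h : ∃ T : A →L[ℂ] W.E, ∀ a, W.incl (T a) = (ρ x).1 (j a) then h.choose else 0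
  have hG : ∀ (x : E) (T : A →L[ℂ] W.E), (∀ a, W.incl (T a) = (ρ x).1 (j a)) → G x = T := by
    intro x T hT
    have h : ∃ T : A →L[ℂ] W.E, ∀ a, W.incl (T a) = (ρ x).1 (j a) := ⟨T, hT⟩
    ext a
    apply W.injective
    simp only [G, dif_pos h]
    rw [h.choose_spec, hT]
  refine ⟨W, G, fun p hp => ?_⟩
  obtain ⟨N, G', hN, hpN, hG', h⟩ := hW p hp
  have hev : G =ᶠ[nhds p] G' := by
    filter_upwards [hN.mem_nhds hpN] with x hx
    exact hG x _ (h x hx)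
  refine ⟨(hG'.differentiableAt (hN.mem_nhds hpN)).congr_of_eventuallyEq hev, ?_⟩
  rw [hev.eq_of_nhds]
  exact h p hpN

theorem BornHolomorphicOn.apply [IsBornologicalVectorSpace X] [IsBornologicalVectorSpace Y]
    {ρ : E → boundedMaps X Y} {S : Set E} (hρ : BornHolomorphicOn ρ S)
    (hX : IsBornologicallyComplete X) (hY : IsBornologicallyComplete Y) (x : X) :
    BornHolomorphicOn (fun p => (ρ p).1 x) S := by
  intro p hp
  obtain ⟨W₀, e, he⟩ := hX.exists_mem x
  obtain ⟨N, W, G, hN, hpN, hNS, hG, h⟩ := hρ.exists_operator_lift_nhds hY W₀.incl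
    (W₀.bounded _ Metric.isBounded_closedBall) hp
  exact ⟨N, W, fun q => G q e, hN, hpN, hNS, hG.clm_apply (differentiableOn_const e),
    fun q hq => by rw [h q hq, he]⟩

end Holomorphic

/-! ## Contour integrals -/

theorem ContinuousLinearMap.circleIntegral_comp_comm {A B : Type*} [NormedAddCommGroup A]
    [NormedSpace ℂ A] [CompleteSpace A] [NormedAddCommGroup B] [NormedSpace ℂ B] [CompleteSpace B]
    (L : A →L[ℂ] B) {f : ℂ → A} {c : ℂ} {t : ℝ} (hf : CircleIntegrable f c t) :
    (∮ z in C(c, t), L (f z)) = L (∮ z in C(c, t), f z) := by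
  rw [circleIntegral, circleIntegral, ← L.intervalIntegral_comp_comm hf.out]
  simp only [map_smul]

/-- In a subobject containing both given ones the two integrands coincide on the circle, and
continuous maps commute with the integral. -/
theorem HasContourIntegral.unique [IsBornologicalVectorSpace X] (hX : IsBornologicallyComplete X)
    {f : ℂ → X} {t : ℝ} (ht : 0 ≤ t) {v w : X} (hv : HasContourIntegral f t v)
    (hw : HasContourIntegral f t w) : v = w := by
  obtain ⟨Y₁, g₁, hc₁, h₁, rfl⟩ := hv
  obtain ⟨Y₂, g₂, hc₂, h₂, rfl⟩ := hw
  obtain ⟨W, i₁, i₂, hi₁, hi₂⟩ := BanachSubobject.exists_sup hX Y₁ Y₂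
  rw [← hi₁, ← hi₂, ← i₁.circleIntegral_comp_comm (hc₁.circleIntegrable ht),
    ← i₂.circleIntegral_comp_comm (hc₂.circleIntegrable ht)]
  congr 1
  refine circleIntegral.integral_congr ht fun z hz => W.injective ?_
  rw [hi₁, hi₂, h₁ z hz, h₂ z hz]

theorem HasContourIntegral.contourIntegral_eq [IsBornologicalVectorSpace X]
    (hX : IsBornologicallyComplete X) {f : ℂ → X} {t : ℝ} (ht : 0 ≤ t) {v : X}
    (hv : HasContourIntegral f t v) : contourIntegral f t = v := by
  have h : ∃ v, HasContourIntegral f t v := ⟨v, hv⟩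
  rw [contourIntegral, dif_pos h]
  exact h.choose_spec.unique hX ht hv

theorem HasContourIntegral.congr {f g : ℂ → X} {t : ℝ} {v : X} (h : HasContourIntegral f t v)
    (hfg : ∀ z ∈ Metric.sphere (0 : ℂ) t, g z = f z) : HasContourIntegral g t v := by
  obtain ⟨Y₁, g₁, hc₁, h₁, hv⟩ := h
  exact ⟨Y₁, g₁, hc₁, fun z hz => (h₁ z hz).trans (hfg z hz).symm, hv⟩

theorem HasContourIntegral.map [IsBornologicalVectorSpace Y] (hY : IsBornologicallyComplete Y)
    {T : X →ₗ[ℂ] Y} (hT : T ∈ boundedMaps X Y) {f : ℂ → X} {t : ℝ} (ht : 0 ≤ t) {v : X}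
    (hv : HasContourIntegral f t v) : HasContourIntegral (fun z => T (f z)) t (T v) := by
  obtain ⟨Y₁, g₁, hc₁, h₁, rfl⟩ := hv
  obtain ⟨W, i, hi⟩ := hY.exists_lift (T ∘ₗ Y₁.incl) (by
    rw [LinearMap.coe_comp, Set.image_comp]
    exact hT _ (Y₁.bounded _ Metric.isBounded_closedBall))
  refine ⟨W, fun z => i (g₁ z), i.continuous.comp_continuousOn hc₁, fun z hz => ?_, ?_⟩
  · rw [hi, LinearMap.comp_apply, h₁ z hz]
  · rw [i.circleIntegral_comp_comm (hc₁.circleIntegrable ht), hi, LinearMap.comp_apply]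

theorem HasContourIntegral.add [IsBornologicalVectorSpace X] (hX : IsBornologicallyComplete X)
    {f g : ℂ → X} {t : ℝ} (ht : 0 ≤ t) {v w : X} (hv : HasContourIntegral f t v)
    (hw : HasContourIntegral g t w) : HasContourIntegral (fun z => f z + g z) t (v + w) := by
  obtain ⟨Y₁, g₁, hc₁, h₁, rfl⟩ := hv
  obtain ⟨Y₂, g₂, hc₂, h₂, rfl⟩ := hw
  obtain ⟨W, i₁, i₂, hi₁, hi₂⟩ := BanachSubobject.exists_sup hX Y₁ Y₂
  have hc₁' := i₁.continuous.comp_continuousOn hc₁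
  have hc₂' := i₂.continuous.comp_continuousOn hc₂
  refine ⟨W, fun z => i₁ (g₁ z) + i₂ (g₂ z), hc₁'.add hc₂', fun z hz => ?_, ?_⟩
  · rw [map_add, hi₁, hi₂, h₁ z hz, h₂ z hz]
  · rw [← hi₁, ← hi₂, ← i₁.circleIntegral_comp_comm (hc₁.circleIntegrable ht),
      ← i₂.circleIntegral_comp_comm (hc₂.circleIntegrable ht), ← map_add]
    congr 1
    exact circleIntegral.integral_add (hc₁'.circleIntegrable ht) (hc₂'.circleIntegrable ht)

theorem HasContourIntegral.const_smul {f : ℂ → X} {t : ℝ} {v : X} (c : ℂ)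
    (hv : HasContourIntegral f t v) : HasContourIntegral (fun z => c • f z) t (c • v) := by
  obtain ⟨Y₁, g₁, hc₁, h₁, rfl⟩ := hv
  exact ⟨Y₁, fun z => c • g₁ z, hc₁.const_smul c, fun z hz => by simp [h₁ z hz],
    by rw [circleIntegral.integral_smul, map_smul]⟩

end Bornological

/-! ## Discrete bornological spaces -/

/-- Factoring through a basis of the range provides an injective parametrization, as needed for
unique, hence linear, lifts. -/
theorem exists_injective_finite {X : Type*} [AddCommGroup X] [Module ℂ X] {n : ℕ}
    (φ : (Fin n → ℂ) →ₗ[ℂ] X) :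
    ∃ (d : ℕ) (φ' : (Fin d → ℂ) →ₗ[ℂ] X) (ψ : (Fin n → ℂ) →ₗ[ℂ] (Fin d → ℂ)),
      Function.Injective φ' ∧ φ = φ' ∘ₗ ψ := by
  let e := (Module.finBasis ℂ (LinearMap.range φ)).equivFun
  refine ⟨_, (LinearMap.range φ).subtype ∘ₗ e.symm.toLinearMap, e.toLinearMap ∘ₗ φ.rangeRestrict,
    ?_, ?_⟩
  · exact Subtype.val_injective.comp e.symm.injective
  · ext i
    simp

theorem IsDiscreteBornological.exists_injective {X : Type u} [AddCommGroup X] [Module ℂ X]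
    [Bornology X] (hX : IsDiscreteBornological X) {B : Set X} (hB : Bornology.IsBounded B) :
    ∃ (d : ℕ) (φ : (Fin d → ℂ) →ₗ[ℂ] X) (M : ℝ), Function.Injective φ ∧
      ∀ x ∈ B, ∃ e, ‖e‖ ≤ M ∧ φ e = x := by
  obtain ⟨n, φ, C, hC, hCB⟩ := (hX B).1 hB
  obtain ⟨d, φ', ψ, hφ', rfl⟩ := exists_injective_finite φ
  obtain ⟨M, hM⟩ := isBounded_iff_forall_norm_le.1
    ((LinearMap.toContinuousLinearMap ψ).lipschitz.isBounded_image hC)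
  refine ⟨d, φ', M, hφ', fun x hx => ?_⟩
  rw [← hCB] at hx
  obtain ⟨c, hc, rfl⟩ := hx
  exact ⟨ψ c, hM _ ⟨c, hc, rfl⟩, rfl⟩

/-- A uniformly bounded family of operators into a discrete space is a uniformly bounded family of
operators into a finite-dimensional space. -/
theorem IsDiscreteBornological.exists_lift {X : Type u} [AddCommGroup X] [Module ℂ X]
    [Bornology X] (hX : IsDiscreteBornological X) {A ι : Type*} [NormedAddCommGroup A]
    [NormedSpace ℂ A] (T : ι → A →ₗ[ℂ] X)
    (hT : Bornology.IsBounded (⋃ i, T i '' Metric.closedBall 0 1)) :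
    ∃ (d : ℕ) (φ : (Fin d → ℂ) →ₗ[ℂ] X) (M : ℝ) (T' : ι → A →L[ℂ] (Fin d → ℂ)),
      Function.Injective φ ∧ ∀ i, ‖T' i‖ ≤ M ∧ ∀ a, φ (T' i a) = T i a := by
  obtain ⟨d, φ, M, hφ, h⟩ := hX.exists_injective hT
  have : ∀ i, ∃ T' : A →L[ℂ] (Fin d → ℂ), ‖T'‖ ≤ M ∧ ∀ a, φ (T' a) = T i a := fun i =>
    LinearMap.exists_lift_of_ball φ hφ (T i) fun a ha =>
      h _ (Set.mem_iUnion.2 ⟨i, a, by simpa using ha, rfl⟩)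
  choose T' hT' using this
  exact ⟨d, φ, M, T', hφ, hT'⟩

/-! ## Laurent expansions -/

section Laurent

variable {B : Type*} [NormedAddCommGroup B] [NormedSpace ℂ B]

/-- The `k`-th Laurent coefficient of `G`, computed on the circle of radius `t`. -/
noncomputable def laurentCoeff (G : ℂ → B) (t : ℝ) (k : ℤ) : B :=
  (2 * Real.pi * Complex.I : ℂ)⁻¹ • ∮ q in C(0, t), q ^ (-k - 1) • G q

theorem differentiableAt_zpow_smul {G : ℂ → B} {q : ℂ} (hq : q ≠ 0) (hG : DifferentiableAt ℂ G q)
    (k : ℤ) : DifferentiableAt ℂ (fun q => q ^ k • G q) q :=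
  (differentiableAt_zpow.2 (Or.inl hq)).smul hG

theorem continuousOn_sphere_zpow_smul {G : ℂ → B} {t : ℝ} (ht : 0 < t)
    (hG : ContinuousOn G (Metric.sphere 0 t)) (k : ℤ) :
    ContinuousOn (fun q => q ^ k • G q) (Metric.sphere 0 t) := by
  refine ContinuousOn.smul (fun q hq => ?_) hG
  have : q ≠ 0 := by
    rintro rfl
    simp [ht.ne] at hq
  exact (continuousAt_zpow₀ q k (Or.inl this)).continuousWithinAt

theorem circleIntegral_zpow_smul_eq {G : ℂ → B} {t₁ t₂ : ℝ} (h₁ : 0 < t₁)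
    (h₁₂ : t₁ ≤ t₂) (hG : ∀ q : ℂ, t₁ ≤ ‖q‖ → ‖q‖ ≤ t₂ → DifferentiableAt ℂ G q) (k : ℤ) :
    (∮ q in C(0, t₂), q ^ k • G q) = ∮ q in C(0, t₁), q ^ k • G q := by
  have hd : ∀ q : ℂ, t₁ ≤ ‖q‖ → ‖q‖ ≤ t₂ → DifferentiableAt ℂ (fun q => q ^ k • G q) q :=
    fun q hq hq' => differentiableAt_zpow_smul (norm_pos_iff.1 (h₁.trans_le hq)) (hG q hq hq') k
  refine Complex.circleIntegral_eq_of_differentiable_on_annulus_off_countable h₁ h₁₂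
    Set.countable_empty ?_ ?_
  · rintro q ⟨hq, hq'⟩
    exact (hd q (by simpa using hq') (by simpa using hq)).continuousAt.continuousWithinAt
  · rintro q ⟨⟨hq, hq'⟩, -⟩
    have h1 : ‖q‖ < t₂ := by simpa using hq
    have h2 : t₁ < ‖q‖ := by simpa using hq'
    exact hd q h2.le h1.le

theorem norm_laurentCoeff_le {G : ℂ → B} {t M : ℝ} (ht : 0 < t)
    (hG : ∀ q : ℂ, ‖q‖ = t → ‖G q‖ ≤ M) (k : ℤ) : ‖laurentCoeff G t k‖ ≤ M * t ^ (-k) := by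
  refine (circleIntegral.norm_two_pi_i_inv_smul_integral_le_of_norm_le_const ht.le
    (C := t ^ (-k - 1) * M) fun q hq => ?_).trans_eq ?_
  · have hq' : ‖q‖ = t := by simpa using hq
    rw [norm_smul, norm_zpow, hq']
    gcongr
    exact hG q hq'
  · rw [zpow_sub_one₀ ht.ne']
    field_simp

/-- On the unit circle the Laurent coefficients are the Fourier coefficients of `θ ↦ G(exp(iθ))`,
and a Fourier series with summable coefficients converges pointwise. -/
theorem hasSum_laurentCoeff_complex {G : ℂ → ℂ} (hG : ContinuousOn G (Metric.sphere 0 1))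
    (hs : Summable (laurentCoeff G 1)) : HasSum (laurentCoeff G 1) (G 1) := by
  have : Fact (0 < 2 * Real.pi) := ⟨Real.two_pi_pos⟩
  let f : C(AddCircle (2 * Real.pi), ℂ) :=
    ⟨fun x => G (AddCircle.toCircle x), hG.comp_continuous
      (continuous_induced_dom.comp AddCircle.continuous_toCircle) fun x => by
        rw [mem_sphere_zero_iff_norm]
        exact Circle.norm_coe _⟩
  have hf : fourierCoeff f = laurentCoeff G 1 := by
    ext k
    rw [fourierCoeff_eq_intervalIntegral f k 0, laurentCoeff, circleIntegral, zero_add,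
      mul_comm (2 * (Real.pi : ℂ)) Complex.I, mul_inv, mul_comm Complex.I⁻¹, mul_smul]
    rw [show ((2 * (Real.pi : ℂ))⁻¹ : ℂ) = ((1 / (2 * Real.pi) : ℝ) : ℂ) by push_cast; simp,
      Complex.real_smul, smul_eq_mul]
    congr 1
    rw [← intervalIntegral.integral_smul]
    refine intervalIntegral.integral_congr fun x _ => ?_
    have hx : circleMap 0 1 x = Complex.exp (x * Complex.I) := by simp [circleMap]
    have hfx : f (x : AddCircle (2 * Real.pi)) = G (Complex.exp (x * Complex.I)) := by
      change G _ = _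
      rw [AddCircle.toCircle_apply_mk, Circle.coe_exp, div_self Real.two_pi_pos.ne', one_mul]
    simp only [smul_eq_mul, deriv_circleMap]
    rw [hfx, fourier_coe_apply, hx, ← Complex.exp_int_mul]
    -- The factor `exp(ix)` from `dq = i exp(ix) dx` accounts for the exponent `-k - 1` in place of
    -- `-k`.
    have : Complex.exp (2 * Real.pi * Complex.I * ((-k : ℤ) : ℂ) * x / ((2 * Real.pi : ℝ) : ℂ))
        = Complex.exp (x * Complex.I) *
          Complex.exp (((-k - 1 : ℤ) : ℂ) * (x * Complex.I)) := by
      rw [← Complex.exp_add]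
      congr 1
      have := Complex.ofReal_ne_zero.2 Real.pi_ne_zero
      push_cast
      field_simp
      ring
    rw [this]
    field_simp
  have := has_pointwise_sum_fourier_series_of_summable (f := f) (hf ▸ hs) 0
  simp only [fourier_eval_zero, smul_eq_mul, mul_one] at this
  rw [hf] at this
  simpa [f] using this

theorem ContinuousLinearMap.laurentCoeff_comp [CompleteSpace B] {B' : Type*}
    [NormedAddCommGroup B'] [NormedSpace ℂ B'] [CompleteSpace B'] (L : B →L[ℂ] B') {G : ℂ → B}
    {t : ℝ} (ht : 0 < t) (hG : ContinuousOn G (Metric.sphere 0 t)) (k : ℤ) :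
    laurentCoeff (fun q => L (G q)) t k = L (laurentCoeff G t k) := by
  rw [laurentCoeff, laurentCoeff, map_smul, ← L.circleIntegral_comp_comm
    ((continuousOn_sphere_zpow_smul ht hG _).circleIntegrable ht.le)]
  simp only [map_smul]

/-- Continuous functionals separate points and commute with the coefficients, which reduces the
identification of the sum to the scalar case. -/
theorem hasSum_laurentCoeff_one [CompleteSpace B] {G : ℂ → B}
    (hG : ContinuousOn G (Metric.sphere 0 1))
    (hs : Summable (laurentCoeff G 1)) : HasSum (laurentCoeff G 1) (G 1) := by
  obtain ⟨v, hv⟩ := hs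
  suffices v = G 1 by rwa [← this]
  refine (SeparatingDual.eq_iff_forall_dual_eq (R := ℂ)).2 fun L => ?_
  have h₁ := hv.mapL L
  have h₂ : HasSum (laurentCoeff (fun q => L (G q)) 1) (L v) := by
    rw [show laurentCoeff (fun q => L (G q)) 1 = fun k => L (laurentCoeff G 1 k) from
      funext fun k => L.laurentCoeff_comp one_pos hG k]
    exact h₁
  exact h₂.unique (hasSum_laurentCoeff_complex (L.continuous.comp_continuousOn hG) h₂.summable)

/-- The radius `t₂ > 1` gives geometric decay as `k → ∞`, the radius `t₁ < 1` as `k → -∞`. -/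
theorem summable_zpow_pair {t₁ t₂ : ℝ} (h₁ : 0 < t₁) (h₁' : t₁ < 1) (h₂ : 1 < t₂) (M : ℝ) :
    Summable fun k : ℤ => M * min (t₁ ^ (-k)) (t₂ ^ (-k)) := by
  refine Summable.mul_left M ?_
  have h₂0 : 0 < t₂ := one_pos.trans h₂
  refine Summable.of_nat_of_neg ?_ ?_
  · refine Summable.of_nonneg_of_le (fun n => le_min (zpow_nonneg h₁.le _) (zpow_nonneg h₂0.le _))
      (fun n => min_le_right _ _) ?_
    have := summable_geometric_of_lt_one (inv_nonneg.2 h₂0.le) (inv_lt_one_of_one_lt₀ h₂)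
    simpa using this
  · refine Summable.of_nonneg_of_le (fun n => le_min (zpow_nonneg h₁.le _) (zpow_nonneg h₂0.le _))
      (fun n => min_le_left _ _) ?_
    have := summable_geometric_of_lt_one h₁.le h₁'
    simpa using this

theorem laurentCoeff_eq_of_le {G : ℂ → B} {t₁ t₂ : ℝ} (h₁ : 0 < t₁) (h₁₂ : t₁ ≤ t₂)
    (hG : ∀ q : ℂ, t₁ ≤ ‖q‖ → ‖q‖ ≤ t₂ → DifferentiableAt ℂ G q) :
    laurentCoeff G t₂ = laurentCoeff G t₁ := by
  ext k
  rw [laurentCoeff, circleIntegral_zpow_smul_eq h₁ h₁₂ hG]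
  rfl

theorem continuousOn_sphere_of_annulus {G : ℂ → B} {t₁ t₂ t : ℝ}
    (hG : ∀ q : ℂ, t₁ ≤ ‖q‖ → ‖q‖ ≤ t₂ → DifferentiableAt ℂ G q) (ht : t₁ ≤ t) (ht' : t ≤ t₂) :
    ContinuousOn G (Metric.sphere 0 t) := by
  intro q hq
  have hq' : ‖q‖ = t := by simpa using hq
  exact (hG q (hq' ▸ ht) (hq' ▸ ht')).continuousAt.continuousWithinAt

/-- The Laurent expansion at `1` of a function on the annulus `t₁ ≤ |q| ≤ t₂`, `t₁ < 1 < t₂`. -/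
theorem exists_laurent_expansion [CompleteSpace B] {G : ℂ → B} {t₁ t₂ : ℝ} (h₁ : 0 < t₁)
    (h₁' : t₁ < 1) (h₂ : 1 < t₂)
    (hG : ∀ q : ℂ, t₁ ≤ ‖q‖ → ‖q‖ ≤ t₂ → DifferentiableAt ℂ G q) :
    ∃ C : ℤ → ℝ, Summable C ∧ (∀ k, ‖laurentCoeff G t₁ k‖ ≤ C k) ∧
      HasSum (laurentCoeff G t₁) (G 1) := by
  have h₂0 : 0 < t₂ := one_pos.trans h₂
  have heq : ∀ t, t₁ ≤ t → t ≤ t₂ → laurentCoeff G t = laurentCoeff G t₁ := by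
    intro t ht ht'
    exact laurentCoeff_eq_of_le h₁ ht fun q hq hq' => hG q hq (hq'.trans ht')
  have hc : ∀ t, t₁ ≤ t → t ≤ t₂ → ContinuousOn G (Metric.sphere 0 t) :=
    fun t ht ht' => continuousOn_sphere_of_annulus hG ht ht'
  have hb : ∀ t, t₁ ≤ t → t ≤ t₂ → ∃ M, ∀ q : ℂ, ‖q‖ = t → ‖G q‖ ≤ M := by
    intro t ht ht'
    obtain ⟨M, hM⟩ := (isCompact_sphere (0 : ℂ) t).exists_bound_of_continuousOn (hc t ht ht')
    exact ⟨M, fun q hq => hM q (by simpa using hq)⟩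
  have h₁₂ : t₁ ≤ t₂ := (h₁'.trans h₂).le
  obtain ⟨M₁, hM₁⟩ := hb t₁ le_rfl h₁₂
  obtain ⟨M₂, hM₂⟩ := hb t₂ h₁₂ le_rfl
  -- The coefficients do not depend on the circle, so the Cauchy estimates on both boundary circles
  -- hold at once.
  have hbound : ∀ k, ‖laurentCoeff G t₁ k‖ ≤ max M₁ M₂ * min (t₁ ^ (-k)) (t₂ ^ (-k)) := by
    intro k
    have e₁ := norm_laurentCoeff_le h₁ (fun q hq => (hM₁ q hq).trans (le_max_left _ M₂)) k
    have e₂ := norm_laurentCoeff_le h₂0 (fun q hq => (hM₂ q hq).trans (le_max_right M₁ _)) k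
    rw [heq t₂ h₁₂ le_rfl] at e₂
    rcases min_choice (t₁ ^ (-k)) (t₂ ^ (-k)) with h | h <;> rw [h] <;> assumption
  have hsum := summable_zpow_pair h₁ h₁' h₂ (max M₁ M₂)
  refine ⟨_, hsum, hbound, ?_⟩
  rw [← heq 1 h₁'.le h₂.le]
  refine hasSum_laurentCoeff_one (hc 1 h₁'.le h₂.le) ?_
  rw [heq 1 h₁'.le h₂.le]
  exact Summable.of_norm_bounded hsum hbound

/-- Rotation and scaling of a contour integral. -/
theorem circleIntegral_comp_mul (f : ℂ → B) (q : ℂ) (t : ℝ) :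
    q • (∮ p in C(0, t), f (q * p)) = ∮ p in C(0, ‖q‖ * t), f p := by
  have hmap : ∀ θ, circleMap 0 (‖q‖ * t) (θ + Complex.arg q) = q * circleMap 0 t θ := by
    intro θ
    simp only [circleMap, zero_add]
    conv_rhs => rw [← Complex.norm_mul_exp_arg_mul_I q]
    push_cast
    rw [add_mul, Complex.exp_add]
    ring
  -- Multiplication by `q` shifts the angle by `arg q`; the integral over a full period of `h` does
  -- not notice the shift.
  let h : ℝ → B := fun θ => deriv (circleMap 0 (‖q‖ * t)) θ • f (circleMap 0 (‖q‖ * t) θ)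
  have hper : Function.Periodic h (2 * Real.pi) := by
    intro θ
    simp only [h, deriv_circleMap]
    rw [periodic_circleMap]
  have h1 : ∫ θ in (0 : ℝ)..2 * Real.pi, h (θ + Complex.arg q) =
      ∫ θ in (0 : ℝ)..2 * Real.pi, h θ := by
    rw [intervalIntegral.integral_comp_add_right, zero_add, add_comm (2 * Real.pi)]
    simpa using hper.intervalIntegral_add_eq (Complex.arg q) 0
  rw [circleIntegral, circleIntegral, ← h1, ← intervalIntegral.integral_smul]
  refine intervalIntegral.integral_congr fun θ _ => ?_
  simp only [h, deriv_circleMap, hmap, smul_smul]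
  ring_nf

/-- With multiplicativity of `ρ`, this identity is what makes the Laurent coefficients of `ρ(q)x`
weight vectors. -/
theorem laurentCoeff_comp_mul (G : ℂ → B) {q : ℂ} (hq : q ≠ 0) (t : ℝ) (k : ℤ) :
    laurentCoeff (fun p => G (q * p)) t k = q ^ k • laurentCoeff G (‖q‖ * t) k := by
  have := circleIntegral_comp_mul (fun p => p ^ (-k - 1) • G p) q t
  rw [laurentCoeff, laurentCoeff, ← this]
  simp only [mul_zpow, mul_smul, circleIntegral.integral_smul]
  rw [smul_comm (q ^ k), ← smul_assoc q, ← smul_assoc (q ^ k), smul_eq_mul, smul_eq_mul,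
    ← zpow_one_add₀ hq, ← zpow_add₀ hq]
  simp

theorem laurentCoeff_zpow_smul [CompleteSpace B] (v : B) {t : ℝ} (ht : 0 < t) (j k : ℤ) :
    laurentCoeff (fun q => q ^ j • v) t k = if k = j then v else 0 := by
  have h : (∮ q in C(0, t), q ^ (-k - 1) • q ^ j • v) = (∮ q in C(0, t), (q - 0) ^ (-k - 1 + j)) • v := by
    rw [← circleIntegral.integral_smul_const]
    refine circleIntegral.integral_congr ht.le fun q hq => ?_
    have hq0 : q ≠ 0 := by
      rintro rfl
      simp [ht.ne] at hq
    simp only [sub_zero, zpow_add₀ hq0, mul_smul]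
  rw [laurentCoeff, h]
  split_ifs with hkj
  · subst hkj
    have : (∮ q in C(0, t), (q - 0) ^ (-k - 1 + k)) = 2 * Real.pi * Complex.I := by
      rw [← circleIntegral.integral_sub_center_inv 0 ht.ne', show -k - 1 + k = -1 by ring]
      simp only [zpow_neg_one]
    rw [this, smul_smul, inv_mul_cancel₀ Complex.two_pi_I_ne_zero, one_smul]
  · rw [circleIntegral.integral_sub_zpow_of_ne (by omega), zero_smul, smul_zero]

end Laurent

/-! ## Affine maps and open sets -/

theorem affImage_mul (g h : AffGroup) (U : Opens ℂ) :
    affImage (g * h) U = affImage g (affImage h U) :=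
  Opens.ext (Set.image_comp g h U)

theorem affImage_one (U : Opens ℂ) : affImage 1 U = U := by
  ext z
  simp [affImage]

theorem affImage_bot (g : AffGroup) : affImage g ⊥ = ⊥ := by
  ext z
  simp [affImage]

theorem affImage_mono (g : AffGroup) {U V : Opens ℂ} (h : U ≤ V) : affImage g U ≤ affImage g V :=
  Set.image_mono h

theorem affImage_sup (g : AffGroup) (U V : Opens ℂ) :
    affImage g (U ⊔ V) = affImage g U ⊔ affImage g V :=
  Opens.ext (Set.image_union g U V)

theorem affOf_mul {a c : ℂ} (ha : a ≠ 0) (hc : c ≠ 0) (b d : ℂ) :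
    affOf a ha b * affOf c hc d = affOf (a * c) (mul_ne_zero ha hc) (a * d + b) := by
  ext z
  simp only [AffineEquiv.coe_mul, Function.comp_apply, affOf_apply]
  ring

theorem affOf_one_zero : affOf 1 one_ne_zero 0 = 1 := by
  ext z
  simp [affOf_apply]

theorem affImage_affOf_disc_le {a b c c' : ℂ} (ha : a ≠ 0) {r s : ℝ}
    (h : ‖a * c + b - c'‖ + ‖a‖ * r ≤ s) : affImage (affOf a ha b) (disc c r) ≤ disc c' s := by
  rintro _ ⟨z, hz, rfl⟩
  have hz' : ‖z - c‖ < r := by simpa [disc, dist_eq_norm] using hz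
  have hpos : 0 < ‖a‖ := norm_pos_iff.2 ha
  change dist _ _ < s
  rw [affOf_apply, dist_eq_norm]
  calc ‖a * z + b - c'‖ = ‖(a * c + b - c') + a * (z - c)‖ := by ring_nf
    _ ≤ ‖a * c + b - c'‖ + ‖a‖ * ‖z - c‖ := (norm_add_le _ _).trans_eq (by rw [norm_mul])
    _ < ‖a * c + b - c'‖ + ‖a‖ * r := by gcongr
    _ ≤ s := h

theorem affImage_scale_disc_le {q : ℂ} (hq : q ≠ 0) {r s : ℝ} (h : ‖q‖ * r ≤ s) :
    affImage (affOf q hq 0) (disc 0 r) ≤ disc 0 s :=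
  affImage_affOf_disc_le hq (by simpa using h)

theorem affImage_translate_disc_le {b c : ℂ} {r s : ℝ} (h : ‖b - c‖ + r ≤ s) :
    affImage (affOf 1 one_ne_zero b) (disc 0 r) ≤ disc c s :=
  affImage_affOf_disc_le one_ne_zero (by simpa using h)

theorem disc_le_disc {c c' : ℂ} {r s : ℝ} (h : ‖c - c'‖ + r ≤ s) : disc c r ≤ disc c' s := by
  refine Metric.ball_subset_ball' ?_
  rw [dist_eq_norm]
  linarith

theorem disjoint_disc {c c' : ℂ} {r s : ℝ} (h : r + s ≤ ‖c - c'‖) :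
    Disjoint (disc c r) (disc c' s) := by
  rw [← dist_eq_norm] at h
  exact Opens.coe_disjoint.1 (Metric.ball_disjoint_ball h)

namespace PrefactorizationAlgebra

variable (F : PrefactorizationAlgebra.{u})

/-! ## Consequences of associativity, unitality and commutativity -/

theorem ext_self {U : Opens ℂ} (h : U ≤ U) (x : F.obj U) : F.ext h x = x :=
  F.mul_one U x

/-- Associativity for `x`, `1`, `1`, where the product of the two units over the empty set is again
the unit. -/
theorem ext_ext {U V W : Opens ℂ} (hUV : U ≤ V) (hVW : V ≤ W) (hUW : U ≤ W) (x : F.obj U) :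
    F.ext hVW (F.ext hUV x) = F.ext hUW x := by
  have := F.mul_assoc (U₁ := U) (U₂ := ⊥) (U₃ := ⊥) (V₁ := V) (V₂ := ⊥) (W := W)
    disjoint_bot_right disjoint_bot_right disjoint_bot_right hVW bot_le hUV bot_le le_rfl le_rfl
    disjoint_bot_right disjoint_bot_right x F.one F.one
  rw [F.mul_one] at this
  exact this

/-- Associativity with the unit as third factor. -/
theorem ext_mul {U V W W' : Opens ℂ} (hd : Disjoint U V) (hU : U ≤ W) (hV : V ≤ W) (hW : W ≤ W')
    (hU' : U ≤ W') (hV' : V ≤ W') (x : F.obj U) (y : F.obj V) :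
    F.ext hW (F.mul hd hU hV x y) = F.mul hd hU' hV' x y := by
  have := F.mul_assoc (U₁ := U) (U₂ := V) (U₃ := ⊥) (V₁ := W) (V₂ := V) (W := W')
    hd disjoint_bot_right disjoint_bot_right hW hV' hU hV le_rfl bot_le
    disjoint_bot_right hd x y F.one
  rw [F.mul_one] at this
  exact this

/-- The axiom concerns only the target `U ⊔ V`; larger targets follow by extension. -/
theorem mul_comm' {U V W : Opens ℂ} (hd : Disjoint U V) (hd' : Disjoint V U) (hU : U ≤ W)
    (hV : V ≤ W) (x : F.obj U) (y : F.obj V) :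
    F.mul hd' hV hU y x = F.mul hd hU hV x y := by
  rw [← F.ext_mul hd le_sup_left le_sup_right (sup_le hU hV) hU hV,
    ← F.ext_mul hd' le_sup_right le_sup_left (sup_le hU hV) hV hU, F.mul_comm hd]

theorem one_mul' {U W : Opens ℂ} (hd : Disjoint ⊥ U) (hU : U ≤ W) (y : F.obj U) :
    F.mul hd bot_le hU F.one y = F.ext hU y :=
  F.mul_comm' disjoint_bot_right hd hU bot_le y F.one

/-- Associativity with the unit as middle factor. -/
theorem mul_ext_left {U U' V W : Opens ℂ} (hU : U ≤ U') (hd : Disjoint U V) (hd' : Disjoint U' V)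
    (hUW : U ≤ W) (hU'W : U' ≤ W) (hVW : V ≤ W) (x : F.obj U) (y : F.obj V) :
    F.mul hd' hU'W hVW (F.ext hU x) y = F.mul hd hUW hVW x y := by
  have := F.mul_assoc (U₁ := U) (U₂ := ⊥) (U₃ := V) (V₁ := U') (V₂ := V) (W := W)
    disjoint_bot_right disjoint_bot_left hd hU'W hVW hU bot_le bot_le le_rfl hd' hd x F.one y
  rw [F.one_mul', F.ext_self] at this
  exact this

theorem mul_ext_right {U V V' W : Opens ℂ} (hV : V ≤ V') (hd : Disjoint U V) (hd' : Disjoint U V')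
    (hUW : U ≤ W) (hVW : V ≤ W) (hV'W : V' ≤ W) (x : F.obj U) (y : F.obj V) :
    F.mul hd' hUW hV'W x (F.ext hV y) = F.mul hd hUW hVW x y := by
  rw [← F.mul_comm' hd' hd'.symm, F.mul_ext_left hV hd.symm hd'.symm hVW hV'W hUW,
    F.mul_comm' hd hd.symm]

/-- Both sides equal the product of `z` with the product of `x` and `y` on `U₁ ⊔ U₂`, where those
two commute. -/
theorem mul_left_comm' {U₁ U₂ U₃ V₁ V₂ W : Opens ℂ} (h₁₂ : Disjoint U₁ U₂) (h₂₃ : Disjoint U₂ U₃)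
    (h₁₃ : Disjoint U₁ U₃) (hU₁ : U₁ ≤ W) (hU₂ : U₂ ≤ W) (hV₁ : V₁ ≤ W) (hV₂ : V₂ ≤ W)
    (h1 : U₁ ≤ V₁) (h2 : U₃ ≤ V₁) (h3 : U₂ ≤ V₂) (h4 : U₃ ≤ V₂)
    (hd₁ : Disjoint U₁ V₂) (hd₂ : Disjoint U₂ V₁)
    (x : F.obj U₁) (y : F.obj U₂) (z : F.obj U₃) :
    F.mul hd₁ hU₁ hV₂ x (F.mul h₂₃ h3 h4 y z) = F.mul hd₂ hU₂ hV₁ y (F.mul h₁₃ h1 h2 x z) := by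
  have hd : Disjoint (U₁ ⊔ U₂) U₃ := disjoint_sup_left.2 ⟨h₁₃, h₂₃⟩
  have hU : U₁ ⊔ U₂ ≤ W := sup_le hU₁ hU₂
  rw [← F.mul_assoc h₁₂ h₂₃ h₁₃ hU hV₂ le_sup_left le_sup_right h3 h4 hd hd₁,
    ← F.mul_assoc h₁₂.symm h₁₃ h₂₃ hU hV₁ le_sup_right le_sup_left h1 h2 hd hd₂,
    F.mul_comm' h₁₂ h₁₂.symm]

/-! ## Products of lists -/

/-- An open set together with an element of `F` on it. -/
abbrev Elt : Type u := Σ U : Opens ℂ, F.obj U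

variable {F}

/-- The union of the open sets occurring in a list. -/
noncomputable def supp : List F.Elt → Opens ℂ
  | [] => ⊥
  | p :: l => p.1 ⊔ supp l

/-- The open sets occurring in `l` are pairwise disjoint and contained in `W`. -/
structure Compat (l : List F.Elt) (W : Opens ℂ) : Prop where
  pairwise : l.Pairwise fun p q => Disjoint p.1 q.1
  le : ∀ p ∈ l, p.1 ≤ W

theorem supp_le {l : List F.Elt} {W : Opens ℂ} (h : ∀ p ∈ l, p.1 ≤ W) : supp l ≤ W := by
  induction l with
  | nil => exact bot_le
  | cons p l ih => exact sup_le (h p (by simp)) (ih fun q hq => h q (by simp [hq]))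

theorem le_supp {l : List F.Elt} {p : F.Elt} (h : p ∈ l) : p.1 ≤ supp l := by
  induction l with
  | nil => simp at h
  | cons q l ih =>
    rcases List.mem_cons.1 h with rfl | h
    · exact le_sup_left
    · exact (ih h).trans le_sup_right

theorem disjoint_supp {l : List F.Elt} {U : Opens ℂ} (h : ∀ p ∈ l, Disjoint U p.1) :
    Disjoint U (supp l) := by
  induction l with
  | nil => exact disjoint_bot_right
  | cons p l ih =>
    exact disjoint_sup_right.2 ⟨h p (by simp), ih fun q hq => h q (by simp [hq])⟩

theorem Compat.supp_le {l : List F.Elt} {W : Opens ℂ} (h : Compat l W) : supp l ≤ W :=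
  PrefactorizationAlgebra.supp_le h.le

theorem Compat.disjoint {p : F.Elt} {l : List F.Elt} {W : Opens ℂ} (h : Compat (p :: l) W) :
    Disjoint p.1 (supp l) :=
  disjoint_supp (List.pairwise_cons.1 h.pairwise).1

theorem Compat.tail {p : F.Elt} {l : List F.Elt} {W : Opens ℂ} (h : Compat (p :: l) W) :
    Compat l W :=
  ⟨(List.pairwise_cons.1 h.pairwise).2, fun q hq => h.le q (by simp [hq])⟩

theorem Compat.head {p : F.Elt} {l : List F.Elt} {W : Opens ℂ} (h : Compat (p :: l) W) :
    p.1 ≤ W := h.le p (by simp)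

theorem Compat.supp {l : List F.Elt} {W : Opens ℂ} (h : Compat l W) : Compat l (supp l) :=
  ⟨h.pairwise, fun _ => le_supp⟩

theorem Compat.perm {l l' : List F.Elt} {W : Opens ℂ} (h : Compat l W) (hl : l.Perm l') :
    Compat l' W :=
  ⟨hl.pairwise h.pairwise fun h => h.symm, fun p hp => h.le p (hl.mem_iff.2 hp)⟩

variable (F)

/-- The product of a list of elements on pairwise disjoint open sets. -/
noncomputable def lprod : ∀ (l : List F.Elt) (W : Opens ℂ) (_ : Compat l W), F.obj W
  | [], _, _ => F.ext bot_le F.one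
  | p :: l, _, h => F.mul h.disjoint h.head h.tail.supp_le p.2 (lprod l (supp l) h.tail.supp)

variable {F}

theorem lprod_congr {l l' : List F.Elt} (hl : l = l') {W : Opens ℂ} (h : Compat l W)
    (h' : Compat l' W) : F.lprod l W h = F.lprod l' W h' := by
  subst hl
  rfl

theorem lprod_singleton {p : F.Elt} {W : Opens ℂ} (h : Compat [p] W) :
    F.lprod [p] W h = F.ext h.head p.2 :=
  F.mul_ext_right bot_le disjoint_bot_right disjoint_bot_right h.head bot_le bot_le p.2 F.one

theorem ext_lprod {l : List F.Elt} {W W' : Opens ℂ} (h : Compat l W) (hW : W ≤ W')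
    (h' : Compat l W') : F.ext hW (F.lprod l W h) = F.lprod l W' h' := by
  cases l with
  | nil => exact F.ext_ext _ _ _ _
  | cons p l => exact F.ext_mul _ _ _ _ _ _ _ _

/-- `lprod` multiplies the tail inside its exact support. Any larger `V` still disjoint from the
head gives the same result. -/
theorem mul_lprod {p : F.Elt} {l : List F.Elt} {V W : Opens ℂ} (h : Compat (p :: l) W)
    (hV : Compat l V) (hd : Disjoint p.1 V) (hVW : V ≤ W) :
    F.mul hd h.head hVW p.2 (F.lprod l V hV) = F.lprod (p :: l) W h := by
  rw [← ext_lprod hV.supp hV.supp_le hV, F.mul_ext_right hV.supp_le h.disjoint hd]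
  rfl

/-- Permutations are generated by adjacent swaps, and a swap at the head is `mul_left_comm'`. -/
theorem lprod_perm {l l' : List F.Elt} (hl : l.Perm l') {W : Opens ℂ} (h : Compat l W)
    (h' : Compat l' W) : F.lprod l W h = F.lprod l' W h' := by
  induction hl generalizing W with
  | nil => rfl
  | @cons p l l' hl ih =>
    have hs : Compat l' (supp l) := h.tail.supp.perm hl
    rw [← mul_lprod h' hs h.disjoint h.tail.supp_le, ← ih h.tail.supp hs]
    rfl
  | swap p q l =>
    exact F.mul_left_comm' ((List.pairwise_cons.1 h.pairwise).1 p (by simp)) h.tail.disjoint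
      h'.tail.disjoint h.head h'.head _ _ le_sup_left le_sup_right le_sup_left le_sup_right _ _
      _ _ _
  | trans hl₁ hl₂ ih₁ ih₂ => exact (ih₁ h (h.perm hl₁)).trans (ih₂ _ h')

/-- Associativity peels off the head of the first list; the empty list contributes the unit. -/
theorem mul_lprod_lprod {l₁ l₂ : List F.Elt} {V₁ V₂ W : Opens ℂ} (h₁ : Compat l₁ V₁)
    (h₂ : Compat l₂ V₂) (hd : Disjoint V₁ V₂) (hV₁ : V₁ ≤ W) (hV₂ : V₂ ≤ W)
    (h : Compat (l₁ ++ l₂) W) :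
    F.mul hd hV₁ hV₂ (F.lprod l₁ V₁ h₁) (F.lprod l₂ V₂ h₂) = F.lprod (l₁ ++ l₂) W h := by
  induction l₁ generalizing V₁ W with
  | nil =>
    exact (F.mul_ext_left bot_le disjoint_bot_left hd bot_le hV₁ hV₂ F.one _).trans
      ((F.one_mul' _ _ _).trans (ext_lprod _ _ _))
  | cons p l ih =>
    have hd₁ : Disjoint p.1 V₂ := hd.mono_left h₁.head
    have hd₂ : Disjoint (supp l) V₂ := hd.mono_left h₁.tail.supp_le
    have hV : supp l ⊔ V₂ ≤ W := sup_le (h₁.tail.supp_le.trans hV₁) hV₂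
    have hc : Compat (l ++ l₂) (supp l ⊔ V₂) := ⟨h.tail.pairwise, fun q hq => by
      rcases List.mem_append.1 hq with hq | hq
      · exact (le_supp hq).trans le_sup_left
      · exact (h₂.le q hq).trans le_sup_right⟩
    have hd₃ : Disjoint p.1 (supp l ⊔ V₂) := disjoint_sup_right.2 ⟨h₁.disjoint, hd₁⟩
    refine (F.mul_assoc h₁.disjoint hd₂ hd₁ hV₁ hV h₁.head h₁.tail.supp_le le_sup_left le_sup_right
      hd hd₃ p.2 _ _).trans ?_
    rw [ih h₁.tail.supp hd₂ le_sup_left le_sup_right hc]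
    exact mul_lprod (p := p) (l := l ++ l₂) h hc hd₃ hV

/-- A product may be computed by first multiplying some of its factors. -/
theorem lprod_nested {l₁ l₂ : List F.Elt} {V W : Opens ℂ} (h₁ : Compat l₁ V)
    (h' : Compat (⟨V, F.lprod l₁ V h₁⟩ :: l₂) W) (h : Compat (l₁ ++ l₂) W) :
    F.lprod (⟨V, F.lprod l₁ V h₁⟩ :: l₂) W h' = F.lprod (l₁ ++ l₂) W h :=
  mul_lprod_lprod h₁ h'.tail.supp h'.disjoint h'.head h'.tail.supp_le h

/-! ### Comparison of `m`-ary multiplication with products of lists -/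

theorem compat_ofFn {m : ℕ} {U : Fin m → Opens ℂ} {W : Opens ℂ}
    (hd : Pairwise fun i j => Disjoint (U i) (U j)) (hW : ∀ i, U i ≤ W) (x : ∀ i, F.obj (U i)) :
    Compat (F := F) (List.ofFn fun i => ⟨U i, x i⟩) W := by
  refine ⟨?_, ?_⟩
  · rw [List.pairwise_ofFn]
    exact fun i j hij => hd hij.ne
  · intro p hp
    obtain ⟨i, rfl⟩ := (List.mem_ofFn' _ _).1 hp
    exact hW i

theorem mulN_succ (F : PrefactorizationAlgebra.{u}) {m : ℕ} {U : Fin (m + 1) → Opens ℂ}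
    {W : Opens ℂ} (hd : Pairwise fun i j => Disjoint (U i) (U j)) (hW : ∀ i, U i ≤ W)
    (hd₀ : Disjoint (U 0) (⨆ i, U (Fin.succ i))) (hW' : (⨆ i, U (Fin.succ i)) ≤ W)
    (hd' : Pairwise fun i j : Fin m => Disjoint (U i.succ) (U j.succ)) (x : ∀ i, F.obj (U i)) :
    F.mulN U W hd hW x = F.mul hd₀ (hW 0) hW' (x 0)
      (F.mulN (fun i => U i.succ) (⨆ i, U (Fin.succ i)) hd'
        (fun i => le_iSup (fun i => U (Fin.succ i)) i) fun i => x i.succ) :=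
  rfl

theorem disjoint_iSup_succ {m : ℕ} {U : Fin (m + 1) → Opens ℂ}
    (hd : Pairwise fun i j => Disjoint (U i) (U j)) : Disjoint (U 0) (⨆ i, U (Fin.succ i)) :=
  disjoint_iSup_iff.2 fun i => hd (Fin.succ_ne_zero i).symm

theorem pairwise_disjoint_succ {m : ℕ} {U : Fin (m + 1) → Opens ℂ}
    (hd : Pairwise fun i j => Disjoint (U i) (U j)) :
    Pairwise fun i j : Fin m => Disjoint (U i.succ) (U j.succ) :=
  fun _ _ hij => hd fun h => hij (Fin.succ_injective _ h)

/-- The two recursions differ only in the intermediate open set, an indexed supremum against the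
support of a list, which `mul_lprod` allows to be changed. Lists make permutation and concatenation
of factors available. -/
theorem mulN_eq_lprod {m : ℕ} {U : Fin m → Opens ℂ} {W : Opens ℂ}
    (hd : Pairwise fun i j => Disjoint (U i) (U j)) (hW : ∀ i, U i ≤ W) (x : ∀ i, F.obj (U i)) :
    F.mulN U W hd hW x =
      F.lprod (List.ofFn fun i => (⟨U i, x i⟩ : F.Elt)) W (compat_ofFn hd hW x) := by
  induction m generalizing W with
  | zero => simp [mulN, lprod]
  | succ m ih =>
    have hl := List.ofFn_succ (f := fun i => (⟨U i, x i⟩ : F.Elt))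
    rw [lprod_congr hl _ (hl ▸ compat_ofFn hd hW x),
      F.mulN_succ hd hW (disjoint_iSup_succ hd) (iSup_le fun i => hW i.succ)
        (pairwise_disjoint_succ hd), ih]
    exact mul_lprod (p := ⟨U 0, x 0⟩) _ _ _ _

variable (F)

/-! ## Multilinearity, boundedness and holomorphy of `m`-ary products -/

theorem exists_multilinearMap_mulN {m : ℕ} (U : Fin m → Opens ℂ) (W : Opens ℂ)
    (hd : Pairwise fun i j => Disjoint (U i) (U j)) (hW : ∀ i, U i ≤ W) :
    ∃ T : MultilinearMap ℂ (fun i => F.obj (U i)) (F.obj W), ⇑T = F.mulN U W hd hW := by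
  induction m generalizing W with
  | zero => exact ⟨MultilinearMap.constOfIsEmpty ℂ _ (F.ext bot_le F.one), by ext x; rfl⟩
  | succ m ih =>
    obtain ⟨T, hT⟩ := ih (fun i => U i.succ) (⨆ i, U (Fin.succ i))
      (pairwise_disjoint_succ hd)
      (fun i => le_iSup (fun i => U (Fin.succ i)) i)
    let B := F.mul (U := U 0) (V := ⨆ i, U (Fin.succ i)) (W := W)
      (disjoint_iSup_succ hd) (hW 0)
      (iSup_le fun i => hW i.succ)
    let S : F.obj (U 0) →ₗ[ℂ] MultilinearMap ℂ (fun i : Fin m => F.obj (U i.succ)) (F.obj W) :=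
      { toFun := fun x => (B x).compMultilinearMap T
        map_add' := fun x y => by ext; simp
        map_smul' := fun c x => by ext; simp }
    refine ⟨S.uncurryLeft, ?_⟩
    ext x
    rw [LinearMap.uncurryLeft_apply, mulN, ← hT]
    rfl

theorem isBounded_mulN {m : ℕ} (U : Fin m → Opens ℂ) (W : Opens ℂ)
    (hd : Pairwise fun i j => Disjoint (U i) (U j)) (hW : ∀ i, U i ≤ W)
    (B : ∀ i, Set (F.obj (U i))) (hB : ∀ i, Bornology.IsBounded (B i)) :
    Bornology.IsBounded (F.mulN U W hd hW '' Set.univ.pi B) := by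
  induction m generalizing W with
  | zero =>
    refine (Bornology.isBounded_singleton (x := F.ext bot_le F.one)).subset ?_
    rintro _ ⟨x, _, rfl⟩
    rfl
  | succ m ih =>
    have hr := ih (fun i => U i.succ) (⨆ i, U (Fin.succ i)) (pairwise_disjoint_succ hd)
      (fun i => le_iSup (fun i => U (Fin.succ i)) i) (fun i => B i.succ) fun i => hB i.succ
    have hW' : (⨆ i, U (Fin.succ i)) ≤ W := iSup_le fun i => hW i.succ
    refine (F.mul_bounded (disjoint_iSup_succ hd) (hW 0) hW' _ _ (hB 0) hr).subset ?_
    rintro _ ⟨x, hx, rfl⟩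
    exact ⟨x 0, hx 0 trivial, _, ⟨fun i => x i.succ, fun i _ => hx i.succ trivial, rfl⟩, rfl⟩

theorem bornHolomorphicOn_mulN {E : Type*} [NormedAddCommGroup E] [NormedSpace ℂ E] {S : Set E}
    (hS : IsOpen S) {m : ℕ} (U : Fin m → Opens ℂ) (W : Opens ℂ)
    (hd : Pairwise fun i j => Disjoint (U i) (U j)) (hW : ∀ i, U i ≤ W)
    (f : ∀ i, E → F.obj (U i)) (hf : ∀ i, BornHolomorphicOn (f i) S) :
    BornHolomorphicOn (fun p => F.mulN U W hd hW fun i => f i p) S := by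
  induction m generalizing W with
  | zero =>
    have h := bornHolomorphicOn_const (F.obj W).complete (F.ext bot_le F.one) hS
    exact h.congr fun _ _ => rfl
  | succ m ih =>
    have h₀ := disjoint_iSup_succ hd
    have hW' : (⨆ i, U (Fin.succ i)) ≤ W := iSup_le fun i => hW i.succ
    have hr := ih (fun i => U i.succ) (⨆ i, U (Fin.succ i)) (pairwise_disjoint_succ hd)
      (fun i => le_iSup (fun i => U (Fin.succ i)) i) (fun i => f i.succ) fun i => hf i.succ
    have := (hf 0).bilinear (F.obj W).complete (F.mul_bounded h₀ (hW 0) hW') hr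
    exact this

end PrefactorizationAlgebra

namespace AffInvPrefactorizationAlgebra

variable (F : AffInvPrefactorizationAlgebra.{u})

/-! ## Transport along affine maps -/

/-- The map `M^{gU}_V ∘ σ_g : F(U) → F(V)`. -/
noncomputable def tr (g : AffGroup) {U V : Opens ℂ} (h : affImage g U ≤ V) :
    F.obj U →ₗ[ℂ] F.obj V :=
  (F.ext h).comp (F.act g rfl)

theorem rho_eq_tr {U V : Opens ℂ} {a b : ℂ} (ha : a ≠ 0) (h : affImage (affOf a ha b) U ≤ V) :
    (F.rho U V (a, b)).1 = F.tr (affOf a ha b) h := by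
  have hp : (a, b) ∈ transporter U V := ⟨ha, h⟩
  rw [rho, dif_pos hp]
  rfl

theorem tr_congr {g g' : AffGroup} (hg : g = g') {U V : Opens ℂ} (h : affImage g U ≤ V)
    (h' : affImage g' U ≤ V) (x : F.obj U) : F.tr g h x = F.tr g' h' x := by
  subst hg
  rfl

theorem act_eq_tr (g : AffGroup) {U V : Opens ℂ} (h : affImage g U = V) (x : F.obj U) :
    F.act g h x = F.tr g h.le x := by
  subst h
  exact (F.ext_self _ _).symm

theorem act_mul' (g : AffGroup) {U V W : Opens ℂ} (hd : Disjoint U V) (hU : U ≤ W) (hV : V ≤ W)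
    (hd' : Disjoint (affImage g U) (affImage g V)) (x : F.obj U) (y : F.obj V) :
    F.act g rfl (F.mul hd hU hV x y) = F.mul (W := affImage g W) hd' (affImage_mono g hU)
      (affImage_mono g hV) (F.act g rfl x) (F.act g rfl y) :=
  F.act_mul g rfl rfl rfl hd hU hV hd' _ _ x y

theorem tr_mul (g : AffGroup) {U V W U' V' W' : Opens ℂ} (hU : affImage g U ≤ U')
    (hV : affImage g V ≤ V') (hW : affImage g W ≤ W') (hd : Disjoint U V) (hUW : U ≤ W)
    (hVW : V ≤ W) (hd' : Disjoint U' V') (hUW' : U' ≤ W') (hVW' : V' ≤ W') (x : F.obj U)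
    (y : F.obj V) :
    F.tr g hW (F.mul hd hUW hVW x y) = F.mul hd' hUW' hVW' (F.tr g hU x) (F.tr g hV y) := by
  have hd₁ : Disjoint (affImage g U) (affImage g V) := (hd'.mono_left hU).mono_right hV
  simp only [tr, LinearMap.comp_apply]
  rw [F.act_mul' g hd hUW hVW hd₁, F.ext_mul hd₁ _ _ hW (hU.trans hUW') (hV.trans hVW'),
    F.mul_ext_left hU (hd'.mono_left hU) hd' (hU.trans hUW'),
    F.mul_ext_right hV hd₁ _ _ (hV.trans hVW')]

theorem act_ext (g : AffGroup) {U V : Opens ℂ} (h : U ≤ V) (x : F.obj U) :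
    F.act g rfl (F.ext h x) = F.ext (affImage_mono g h) (F.act g rfl x) := by
  have := F.act_mul g (U := U) (V := ⊥) (W := V) rfl (affImage_bot g) rfl disjoint_bot_right h
    bot_le disjoint_bot_right (affImage_mono g h) bot_le x F.one
  rw [F.act_unit] at this
  exact this

theorem tr_tr (g g' : AffGroup) {U V W : Opens ℂ} (h : affImage g U ≤ V) (h' : affImage g' V ≤ W)
    (h'' : affImage (g' * g) U ≤ W) (x : F.obj U) :
    F.tr g' h' (F.tr g h x) = F.tr (g' * g) h'' x := by
  simp only [tr, LinearMap.comp_apply]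
  rw [F.act_ext, F.ext_ext _ _ ((affImage_mono g' h).trans h')]
  rw [F.act_act g' g rfl rfl (affImage_mul g' g U), act_eq_tr F (g' * g)]
  exact F.ext_ext _ _ _ _

theorem tr_one {U V : Opens ℂ} (h : affImage 1 U ≤ V) (h' : U ≤ V) (x : F.obj U) :
    F.tr 1 h x = F.ext h' x := by
  -- `affImage 1 U` equals `U` only propositionally; with a variable target the equation can be
  -- substituted.
  have key : ∀ (U' : Opens ℂ) (e : affImage 1 U = U') (h : U' ≤ V),
      F.ext h (F.act 1 e x) = F.ext h' x := by
    intro U' e h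
    obtain rfl : U = U' := (affImage_one U).symm.trans e
    rw [F.act_one]
  exact key _ rfl h

theorem affImage_supp_le (g : AffGroup) {l l' : List F.Elt}
    (hl : List.Forall₂ (fun p q => ∃ h : affImage g p.1 ≤ q.1, q.2 = F.tr g h p.2) l l') :
    affImage g (PrefactorizationAlgebra.supp l) ≤ PrefactorizationAlgebra.supp l' := by
  induction hl with
  | nil => exact (affImage_bot g).le
  | cons h _ ih =>
    obtain ⟨h, -⟩ := h
    exact (affImage_sup g _ _).le.trans (sup_le_sup h ih)

/-- Only inclusions `gU ≤ U'` are required of the factors. The statement therefore covers scaling,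
translation and, for `g = 1`, the enlargement of the open sets on which the factors live. -/
theorem tr_lprod (g : AffGroup) {l l' : List F.Elt}
    (hl : List.Forall₂ (fun p q => ∃ h : affImage g p.1 ≤ q.1, q.2 = F.tr g h p.2) l l')
    {W W' : Opens ℂ} (hW : affImage g W ≤ W') (h : PrefactorizationAlgebra.Compat l W)
    (h' : PrefactorizationAlgebra.Compat l' W') :
    F.tr g hW (F.lprod l W h) = F.lprod l' W' h' := by
  induction hl generalizing W W' with
  | nil =>
    change F.ext hW (F.act g rfl (F.ext _ F.one)) = F.ext _ F.one
    rw [F.act_ext, F.ext_ext _ _ ((affImage_bot g).le.trans bot_le)]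
    have key : ∀ (U : Opens ℂ) (e : affImage g ⊥ = U) (h : U ≤ W'),
        F.ext h (F.act g e F.one) = F.ext bot_le F.one := by
      intro U e h
      obtain rfl : ⊥ = U := (affImage_bot g).symm.trans e
      rw [F.act_unit]
    exact key _ rfl _
  | @cons p q l l' hpq hl ih =>
    obtain ⟨hg, hq⟩ := hpq
    have hs := F.affImage_supp_le g hl
    change F.tr g hW (F.mul h.disjoint h.head h.tail.supp_le p.2 _) =
      F.mul h'.disjoint h'.head h'.tail.supp_le q.2 _
    rw [F.tr_mul g hg hs hW h.disjoint h.head h.tail.supp_le h'.disjoint h'.head h'.tail.supp_le,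
      hq, ih hs h.tail.supp h'.tail.supp]

theorem tr_lprod_ofFn (g : AffGroup) {m : ℕ} {p q : Fin m → F.Elt}
    (hpq : ∀ i, ∃ h : affImage g (p i).1 ≤ (q i).1, (q i).2 = F.tr g h (p i).2)
    {W W' : Opens ℂ} (hW : affImage g W ≤ W')
    (h : PrefactorizationAlgebra.Compat (List.ofFn p) W)
    (h' : PrefactorizationAlgebra.Compat (List.ofFn q) W') :
    F.tr g hW (F.lprod (List.ofFn p) W h) = F.lprod (List.ofFn q) W' h' := by
  refine F.tr_lprod g ?_ hW h h'
  rw [List.forall₂_iff_get]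
  refine ⟨by simp, fun i hi hi' => ?_⟩
  have hi₀ : i < m := by simpa using hi
  have e₁ : (List.ofFn p).get ⟨i, hi⟩ = p ⟨i, hi₀⟩ := by simp
  have e₂ : (List.ofFn q).get ⟨i, hi'⟩ = q ⟨i, hi₀⟩ := by simp
  rw [e₁, e₂]
  exact hpq _

end AffInvPrefactorizationAlgebra

/-- The strict inequality is an open condition on `(a, b)`, so it describes a neighbourhood inside
the transporter. This is where room between the discs turns into holomorphy. -/
theorem mem_interior_transporter_disc {a b c : ℂ} {r s : ℝ} (ha : a ≠ 0)
    (h : ‖b - c‖ + ‖a‖ * r < s) : (a, b) ∈ interior (transporter (disc 0 r) (disc c s)) := by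
  refine mem_interior.2 ⟨{p : ℂ × ℂ | p.1 ≠ 0 ∧ ‖p.2 - c‖ + ‖p.1‖ * r < s}, ?_, ?_, ⟨ha, h⟩⟩
  · rintro ⟨a, b⟩ ⟨ha, h⟩
    exact ⟨ha, affImage_affOf_disc_le ha (by simpa using h.le)⟩
  · refine IsOpen.and ?_ ?_
    · exact isOpen_ne_fun continuous_fst continuous_const
    · exact isOpen_lt (by fun_prop) continuous_const

namespace AffInvPrefactorizationAlgebra

variable (F : AffInvPrefactorizationAlgebra.{u})

/-! ## Scaling maps between concentric discs -/

/-- The map `ρ(q) : F(B_R(0)) → F(B_s(0))`. -/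
noncomputable def scal (R s : ℝ) (q : ℂ) : F.obj (disc 0 R) →ₗ[ℂ] F.obj (disc 0 s) :=
  (F.rho (disc 0 R) (disc 0 s) (q, 0)).1

theorem scal_mem_boundedMaps (R s : ℝ) (q : ℂ) :
    F.scal R s q ∈ boundedMaps (F.obj (disc 0 R)) (F.obj (disc 0 s)) :=
  (F.rho (disc 0 R) (disc 0 s) (q, 0)).2

theorem scal_eq_tr {R s : ℝ} {q : ℂ} (hq : q ≠ 0) (h : ‖q‖ * R ≤ s) :
    F.scal R s q = F.tr (affOf q hq 0) (affImage_scale_disc_le hq h) :=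
  F.rho_eq_tr hq _

theorem scal_one {R s : ℝ} (h : R ≤ s) (x : F.obj (disc 0 R)) :
    F.scal R s 1 x = F.ext (disc_mono 0 h) x := by
  rw [F.scal_eq_tr one_ne_zero (by simpa using h), F.tr_congr affOf_one_zero, F.tr_one]
  rw [affImage_one]
  exact disc_mono 0 h

theorem scal_scal {R s t : ℝ} {p q : ℂ} (hq : q ≠ 0) (hp : p ≠ 0) (h : ‖q‖ * R ≤ s)
    (h' : ‖p‖ * s ≤ t) (x : F.obj (disc 0 R)) :
    F.scal s t p (F.scal R s q x) = F.scal R t (p * q) x := by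
  have h'' : ‖p * q‖ * R ≤ t := by
    rw [norm_mul, mul_assoc]
    exact (mul_le_mul_of_nonneg_left h (norm_nonneg _)).trans h'
  have e : affOf p hp 0 * affOf q hq 0 = affOf (p * q) (mul_ne_zero hp hq) 0 := by
    rw [affOf_mul hp hq, mul_zero, add_zero]
  rw [F.scal_eq_tr hq h, F.scal_eq_tr hp h', F.scal_eq_tr (mul_ne_zero hp hq) h'',
    F.tr_tr _ _ _ _ (e ▸ affImage_scale_disc_le (mul_ne_zero hp hq) h''), F.tr_congr e]

variable {F}

theorem IsHolomorphic.scal (hol : F.IsHolomorphic) (R s : ℝ) :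
    BornHolomorphicOn (fun q : ℂ => F.rho (disc 0 R) (disc 0 s) (q, 0))
      {q | q ≠ 0 ∧ ‖q‖ * R < s} := by
  refine (hol (disc 0 R) (disc 0 s)).comp_differentiableOn ?_ (h := fun q : ℂ => (q, (0 : ℂ)))
    (by fun_prop) ?_
  · exact (isOpen_ne_fun continuous_id continuous_const).and
      (isOpen_lt (by fun_prop) continuous_const)
  · rintro q ⟨hq, hq'⟩
    exact mem_interior_transporter_disc hq (by simpa using hq')

theorem IsHolomorphic.translate (hol : F.IsHolomorphic) (c : ℂ) (r s : ℝ) :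
    BornHolomorphicOn (fun b : ℂ => F.rho (disc 0 r) (disc c s) (1, b))
      {b | ‖b - c‖ + r < s} := by
  refine (hol (disc 0 r) (disc c s)).comp_differentiableOn ?_ (h := fun b : ℂ => ((1 : ℂ), b))
    (by fun_prop) ?_
  · exact isOpen_lt (by fun_prop) continuous_const
  · intro b hb
    exact mem_interior_transporter_disc one_ne_zero (by simpa using hb)

/-- A closed annulus is compact, so one Banach space serves all its points. For `R < s` the annulus
may reach beyond the unit circle, which is what the expansion into weight vectors needs. -/
theorem IsHolomorphic.exists_scal_lift (hol : F.IsHolomorphic) {R s : ℝ} {A : Type*}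
    [NormedAddCommGroup A] [NormedSpace ℂ A] (j : A →ₗ[ℂ] F.obj (disc 0 R))
    (hj : Bornology.IsBounded (j '' Metric.closedBall 0 1)) {t₁ t₂ : ℝ} (h₁ : 0 < t₁)
    (hR : 0 ≤ R) (h₂ : t₂ * R < s) :
    ∃ (W : BanachSubobject (F.obj (disc 0 s))) (G : ℂ → (A →L[ℂ] W.E)),
      (∀ q, t₁ ≤ ‖q‖ → ‖q‖ ≤ t₂ → DifferentiableAt ℂ G q) ∧
      ∀ q, t₁ ≤ ‖q‖ → ‖q‖ ≤ t₂ → ∀ a, W.incl (G q a) = F.scal R s q (j a) := by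
  have hK : IsCompact (Metric.closedBall (0 : ℂ) t₂ ∩ {q : ℂ | t₁ ≤ ‖q‖}) :=
    (isCompact_closedBall _ _).inter_right (isClosed_le continuous_const continuous_norm)
  obtain ⟨W, G, h⟩ := (hol.scal R s).exists_operator_lift (F.obj (disc 0 s)).complete j hj hK (by
    rintro q ⟨hq, hq'⟩
    refine ⟨norm_pos_iff.1 (h₁.trans_le hq'), lt_of_le_of_lt ?_ h₂⟩
    exact mul_le_mul_of_nonneg_right (by simpa using hq) hR)
  exact ⟨W, G, fun q hq hq' => (h q ⟨by simpa using hq', hq⟩).1,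
    fun q hq hq' => (h q ⟨by simpa using hq', hq⟩).2⟩

end AffInvPrefactorizationAlgebra

theorem hasContourIntegral_of_lift {X : Type u} [AddCommGroup X] [Module ℂ X] [Bornology X]
    {W : BanachSubobject X} {G : ℂ → W.E} {f : ℂ → X} {t : ℝ} (ht : 0 < t)
    (hG : ContinuousOn G (Metric.sphere 0 t)) (h : ∀ q : ℂ, ‖q‖ = t → W.incl (G q) = f q) (k : ℤ) :
    HasContourIntegral (fun q => q ^ (-k - 1) • f q) t
      ((2 * Real.pi * Complex.I : ℂ) • W.incl (laurentCoeff G t k)) := by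
  refine ⟨W, fun q => q ^ (-k - 1) • G q, continuousOn_sphere_zpow_smul ht hG _,
    fun q hq => by rw [map_smul, h q (by simpa using hq)], ?_⟩
  rw [laurentCoeff, map_smul, smul_inv_smul₀ Complex.two_pi_I_ne_zero]

namespace AffInvPrefactorizationAlgebra

variable {F : AffInvPrefactorizationAlgebra.{u}}

/-! ## Projections to the weight spaces -/

/-- The contour may be deformed within `F(B_R(0))`, and the extension to `F(B_s(0))` is bounded, so
it commutes with the integral. Thus one operator-valued Laurent coefficient computes the projection
for all `a`, on any circle of radius below `1` and in any larger disc. -/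
theorem IsHolomorphic.weightProj_of_lift (hol : F.IsHolomorphic) {R : ℝ} (hR : 0 < R) (k : ℤ)
    {A : Type*} [NormedAddCommGroup A] [NormedSpace ℂ A] (j : A →ₗ[ℂ] F.obj (disc 0 R))
    {s : ℝ} (hs : R ≤ s) {W : BanachSubobject (F.obj (disc 0 s))} {G : ℂ → (A →L[ℂ] W.E)}
    (hj : Bornology.IsBounded (j '' Metric.closedBall 0 1))
    {t : ℝ} (ht : 0 < t) (ht' : t < 1)
    (hG : ∀ q : ℂ, ‖q‖ = t → DifferentiableAt ℂ G q)
    (hGj : ∀ q : ℂ, ‖q‖ = t → ∀ a, W.incl (G q a) = F.scal R s q (j a)) (a : A) :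
    W.incl (laurentCoeff G t k a) = F.ext (disc_mono 0 hs) (F.weightProj R k (j a)) := by
  -- The annulus contains both the circle of radius `t` and the circle of radius `1 / 2` from the
  -- definition of `weightProj`.
  set t₁ := min t (1 / 2) with ht₁
  set t₂ := max t (1 / 2) with ht₂
  have h₁ : 0 < t₁ := lt_min ht (by norm_num)
  have h₂ : t₂ < 1 := max_lt ht' (by norm_num)
  have h₂R : t₂ * R < R := by nlinarith
  obtain ⟨W', G', hG', hGj'⟩ := hol.exists_scal_lift j hj h₁ hR.le h₂R
  have hd : ∀ q : ℂ, t₁ ≤ ‖q‖ → ‖q‖ ≤ t₂ → DifferentiableAt ℂ (fun q => G' q a) q :=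
    fun q hq hq' => (hG' q hq hq').clm_apply (differentiableAt_const a)
  have hI : ∀ t', t₁ ≤ t' → t' ≤ t₂ → HasContourIntegral
      (fun q => q ^ (-k - 1) • F.scal R R q (j a)) t'
      ((2 * Real.pi * Complex.I : ℂ) • W'.incl (laurentCoeff (fun q => G' q a) t₁ k)) := by
    intro t' h h'
    rw [← laurentCoeff_eq_of_le h₁ h fun q hq hq' => hd q hq (hq'.trans h')]
    exact hasContourIntegral_of_lift (h₁.trans_le h) (continuousOn_sphere_of_annulus hd h h')
      (fun q hq => hGj' q (hq ▸ h) (hq ▸ h') a) k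
  have hproj : F.weightProj R k (j a) = W'.incl (laurentCoeff (fun q => G' q a) t₁ k) := by
    have := (hI (1 / 2) (min_le_right _ _) (le_max_right _ _)).contourIntegral_eq
      (F.obj (disc 0 R)).complete (by norm_num)
    change (2 * Real.pi * Complex.I : ℂ)⁻¹ •
      contourIntegral (fun q => q ^ (-k - 1) • F.scal R R q (j a)) (1 / 2) = _
    rw [this, inv_smul_smul₀ Complex.two_pi_I_ne_zero]
  have hc : ContinuousOn G (Metric.sphere 0 t) := fun q hq =>
    (hG q (by simpa using hq)).continuousAt.continuousWithinAt
  have hI₁ := hasContourIntegral_of_lift (f := fun q => F.scal R s q (j a)) (W := W)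
    (G := fun q => G q a) ht (hc.clm_apply continuousOn_const) (fun q hq => hGj q hq a) k
  -- The extension map is written as scaling by `1`, so that it composes with `ρ(q)` by `scal_scal`.
  have hI₂ := (hI t (min_le_left _ _) (le_max_left _ _)).map (F.obj (disc 0 s)).complete
    (F.scal_mem_boundedMaps R s 1) ht.le
  have hI₃ := hI₂.congr (g := fun q => q ^ (-k - 1) • F.scal R s q (j a)) (by
    intro q hq
    have hq' : ‖q‖ = t := by simpa using hq
    have hq0 : q ≠ 0 := norm_pos_iff.1 (hq' ▸ ht)
    rw [map_smul, F.scal_scal hq0 one_ne_zero (by rw [hq']; nlinarith) (by simpa using hs), one_mul])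
  have := hI₁.unique (F.obj (disc 0 s)).complete ht.le hI₃
  rw [map_smul] at this
  have := smul_right_injective _ Complex.two_pi_I_ne_zero this
  rw [← hproj, F.scal_one hs] at this
  rw [← this]
  congr 1
  exact ((ContinuousLinearMap.apply ℂ W.E a).laurentCoeff_comp ht hc k).symm

theorem IsHolomorphic.exists_weightProj_lift (hol : F.IsHolomorphic) {R : ℝ} (hR : 0 < R) (k : ℤ)
    {A : Type*} [NormedAddCommGroup A] [NormedSpace ℂ A] (j : A →ₗ[ℂ] F.obj (disc 0 R))
    (hj : Bornology.IsBounded (j '' Metric.closedBall 0 1)) :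
    ∃ (W : BanachSubobject (F.obj (disc 0 R))) (T : A →L[ℂ] W.E),
      ∀ a, W.incl (T a) = F.weightProj R k (j a) := by
  obtain ⟨W, G, hG, hGj⟩ := hol.exists_scal_lift (s := R) (t₁ := 1 / 2) (t₂ := 1 / 2) j hj
    (by norm_num) hR.le (by linarith)
  refine ⟨W, laurentCoeff G (1 / 2) k, fun a => ?_⟩
  rw [hol.weightProj_of_lift hR k j le_rfl hj (by norm_num) (by norm_num)
    (fun q hq => hG q hq.ge hq.le) (fun q hq => hGj q hq.ge hq.le), F.ext_self]

theorem IsHolomorphic.hasContourIntegral_weightProj (hol : F.IsHolomorphic) {R : ℝ} (hR : 0 < R)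
    (k : ℤ) (x : F.obj (disc 0 R)) {t : ℝ} (ht : 0 < t) (ht' : t < 1) :
    HasContourIntegral (fun q => q ^ (-k - 1) • F.scal R R q x) t
      ((2 * Real.pi * Complex.I : ℂ) • F.weightProj R k x) := by
  obtain ⟨W₀, e, rfl⟩ := (F.obj (disc 0 R)).complete.exists_mem x
  obtain ⟨W, G, hG, hGj⟩ := hol.exists_scal_lift (s := R) (t₁ := t) (t₂ := t) W₀.incl
    (W₀.bounded _ Metric.isBounded_closedBall) ht hR.le (by nlinarith)
  have hc : ContinuousOn G (Metric.sphere 0 t) := continuousOn_sphere_of_annulus hG le_rfl le_rfl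
  have := hasContourIntegral_of_lift (f := fun q => F.scal R R q (W₀.incl e)) ht
    (hc.clm_apply continuousOn_const) (fun q hq => hGj q hq.ge hq.le e) k
  have h2 := hol.weightProj_of_lift hR k W₀.incl le_rfl (W₀.bounded _ Metric.isBounded_closedBall)
    ht ht' (fun q hq => hG q hq.ge hq.le) (fun q hq => hGj q hq.ge hq.le) e
  rw [F.ext_self] at h2
  rw [← h2]
  convert this using 3
  exact ((ContinuousLinearMap.apply ℂ W.E e).laurentCoeff_comp ht hc k).symm

theorem IsHolomorphic.weightProj_eq (hol : F.IsHolomorphic) {R : ℝ} (hR : 0 < R)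
    (k : ℤ) {x v : F.obj (disc 0 R)} {t : ℝ} (ht : 0 < t) (ht' : t < 1)
    (h : HasContourIntegral (fun q => q ^ (-k - 1) • F.scal R R q x) t
      ((2 * Real.pi * Complex.I : ℂ) • v)) : F.weightProj R k x = v :=
  smul_right_injective _ Complex.two_pi_I_ne_zero
    ((hol.hasContourIntegral_weightProj hR k x ht ht').unique (F.obj (disc 0 R)).complete ht.le h)

/-- Scaling maps commute with one another, and as bounded maps also with contour integrals. -/
theorem IsHolomorphic.weightProj_scal (hol : F.IsHolomorphic) {R s : ℝ} (hR : 0 < R) (hs : 0 < s)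
    (k : ℤ) {p : ℂ} (hp : p ≠ 0) (h : ‖p‖ * R ≤ s) (x : F.obj (disc 0 R)) :
    F.weightProj s k (F.scal R s p x) = F.scal R s p (F.weightProj R k x) := by
  refine hol.weightProj_eq hs k one_half_pos one_half_lt_one ?_
  have := (hol.hasContourIntegral_weightProj hR k x one_half_pos one_half_lt_one).map
    (F.obj (disc 0 s)).complete (F.scal_mem_boundedMaps R s p) one_half_pos.le
  rw [map_smul] at this
  refine this.congr fun q hq => ?_
  have hq' : ‖q‖ = 1 / 2 := by simpa using hq
  have hq0 : q ≠ 0 := norm_pos_iff.1 (hq' ▸ one_half_pos)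
  rw [map_smul, F.scal_scal hp hq0 h (by rw [hq']; linarith),
    F.scal_scal hq0 hp (by rw [hq']; linarith) h, mul_comm]

theorem IsHolomorphic.weightProj_add (hol : F.IsHolomorphic) {R : ℝ} (hR : 0 < R) (k : ℤ)
    (x y : F.obj (disc 0 R)) :
    F.weightProj R k (x + y) = F.weightProj R k x + F.weightProj R k y := by
  refine hol.weightProj_eq hR k one_half_pos one_half_lt_one ?_
  have := (hol.hasContourIntegral_weightProj hR k x one_half_pos one_half_lt_one).add
    (F.obj (disc 0 R)).complete one_half_pos.le
    (hol.hasContourIntegral_weightProj hR k y one_half_pos one_half_lt_one)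
  rw [← smul_add] at this
  simpa only [map_add, smul_add] using this

theorem IsHolomorphic.weightProj_smul (hol : F.IsHolomorphic) {R : ℝ} (hR : 0 < R) (k : ℤ) (c : ℂ)
    (x : F.obj (disc 0 R)) : F.weightProj R k (c • x) = c • F.weightProj R k x := by
  refine hol.weightProj_eq hR k one_half_pos one_half_lt_one ?_
  have := (hol.hasContourIntegral_weightProj hR k x one_half_pos one_half_lt_one).const_smul c
  simpa only [map_smul, smul_comm c] using this

/-- The image of `weightProj` consists of weight vectors. -/
theorem IsHolomorphic.scal_weightProj (hol : F.IsHolomorphic) {R : ℝ} (hR : 0 < R) (k : ℤ)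
    (x : F.obj (disc 0 R)) {q : ℂ} (hq : q ≠ 0) (hq1 : ‖q‖ < 1) :
    F.scal R R q (F.weightProj R k x) = q ^ k • F.weightProj R k x := by
  rw [← hol.weightProj_scal hR hR k hq (by nlinarith)]
  refine hol.weightProj_eq hR k one_half_pos one_half_lt_one ?_
  have hq0 : 0 < ‖q‖ := norm_pos_iff.2 hq
  obtain ⟨W₀, e, rfl⟩ := (F.obj (disc 0 R)).complete.exists_mem x
  have hb := W₀.bounded _ (Metric.isBounded_closedBall (x := 0) (r := 1))
  -- As `ρ(p)ρ(q) = ρ(qp)`, the substitution moves the circle of radius `1 / 2` to that of radius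
  -- `‖q‖ / 2` at the cost of a factor `q ^ k`. The annulus between the two circles allows moving
  -- back.
  obtain ⟨W, G, hG, hGj⟩ := hol.exists_scal_lift (s := R) (t₁ := ‖q‖ * (1 / 2)) (t₂ := 1 / 2)
    W₀.incl hb (by positivity) hR.le (by linarith)
  have hd : ∀ p : ℂ, ‖q‖ * (1 / 2) ≤ ‖p‖ → ‖p‖ ≤ 1 / 2 → DifferentiableAt ℂ (fun q => G q e) p :=
    fun p h h' => (hG p h h').clm_apply (differentiableAt_const e)
  have hle : ‖q‖ * (1 / 2) ≤ 1 / 2 := by linarith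
  have h2 := hol.weightProj_of_lift hR k W₀.incl le_rfl hb one_half_pos one_half_lt_one
    (fun q hq => hG q (hq ▸ hle) hq.le) (fun q hq => hGj q (hq ▸ hle) hq.le) e
  have hcoe : laurentCoeff G (1 / 2) k e = laurentCoeff (fun q => G q e) (1 / 2) k :=
    ((ContinuousLinearMap.apply ℂ W.E e).laurentCoeff_comp one_half_pos
      (continuousOn_sphere_of_annulus hG hle le_rfl) k).symm
  rw [F.ext_self, hcoe, laurentCoeff_eq_of_le (by positivity) hle hd] at h2
  have hmap : Set.MapsTo (fun p => q * p) (Metric.sphere (0 : ℂ) (1 / 2))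
      (Metric.sphere (0 : ℂ) (‖q‖ * (1 / 2))) := by
    intro p hp
    have hp' : ‖p‖ = 1 / 2 := by simpa using hp
    simp [hp']
  have hc := (continuousOn_sphere_of_annulus hd le_rfl hle).comp (by fun_prop) hmap
  have := hasContourIntegral_of_lift (W := W) (G := fun p => G (q * p) e)
    (f := fun p => F.scal R R (q * p) (W₀.incl e)) one_half_pos hc (fun p hp => by
      have : ‖q * p‖ = ‖q‖ * (1 / 2) := by rw [norm_mul, hp]
      exact hGj _ this.ge (this.trans_le hle) e) k
  rw [laurentCoeff_comp_mul (fun p => G p e) hq, map_smul, h2] at this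
  refine this.congr fun p hp => ?_
  have hp' : ‖p‖ = 1 / 2 := by simpa using hp
  have hp0 : p ≠ 0 := norm_pos_iff.1 (hp' ▸ one_half_pos)
  rw [F.scal_scal hq hp0 (by nlinarith) (by rw [hp']; linarith), mul_comm]

/-- A weight vector is mapped to a multiple of itself. -/
theorem IsHolomorphic.weightProj_of_weight (hol : F.IsHolomorphic) {R : ℝ} (hR : 0 < R) (j k : ℤ)
    {x : F.obj (disc 0 R)} (hx : ∀ q : ℂ, q ≠ 0 → ‖q‖ < 1 → F.scal R R q x = q ^ j • x) :
    F.weightProj R k x = if k = j then x else 0 := by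
  refine hol.weightProj_eq hR k one_half_pos one_half_lt_one ?_
  obtain ⟨W, e, rfl⟩ := (F.obj (disc 0 R)).complete.exists_mem x
  have hc : ContinuousOn (fun q : ℂ => q ^ j • e) (Metric.sphere 0 (1 / 2)) :=
    continuousOn_sphere_zpow_smul one_half_pos continuousOn_const j
  have := hasContourIntegral_of_lift (W := W) (f := fun q => F.scal R R q (W.incl e))
    one_half_pos hc (fun q hq => by
      rw [hx q (norm_pos_iff.1 (hq ▸ one_half_pos)) (hq ▸ one_half_lt_one), map_smul]) k
  rwa [laurentCoeff_zpow_smul e one_half_pos, apply_ite W.incl, map_zero] at this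

end AffInvPrefactorizationAlgebra

namespace AffInvPrefactorizationAlgebra

variable (F : AffInvPrefactorizationAlgebra.{u})

/-! ## Weight spaces -/

/-- The weight condition concerns maps from a disc to itself. An element of the costalk also comes
from the disc of radius `min R s`, so `ρ(p)` can be applied there before extending. -/
theorem scal_weightToDisc_of_lt_one {R s : {r : ℝ // 0 < r}} {k : ℤ} (x : F.weightSpace k) {p : ℂ}
    (hp : p ≠ 0) (h : ‖p‖ * R ≤ s) (hp1 : ‖p‖ < 1) :
    F.scal R s p (F.weightToDisc R k x) = p ^ k • F.weightToDisc s k x := by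
  set t : {r : ℝ // 0 < r} := min R s
  have htR : t ≤ R := min_le_left _ _
  have hts : t ≤ s := min_le_right _ _
  have ext_eq : ∀ r : {r : ℝ // 0 < r}, t ≤ r →
      F.scal t r 1 (F.weightToDisc t k x) = F.weightToDisc r k x := by
    intro r hr
    rw [F.scal_one (show t.1 ≤ r.1 from hr)]
    exact x.1.2 t r hr
  have htR' : ‖(1 : ℂ)‖ * t.1 ≤ R := by simpa using htR
  have hts' : ‖(1 : ℂ)‖ * t.1 ≤ s := by simpa using hts
  have htt : ‖p‖ * t.1 ≤ t.1 := by nlinarith [t.2]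
  rw [← ext_eq R htR, F.scal_scal one_ne_zero hp htR' h, mul_one, ← one_mul p,
    ← F.scal_scal hp one_ne_zero htt hts']
  have hw : F.scal t t p (F.weightToDisc t k x) = p ^ k • F.weightToDisc t k x :=
    x.2 p (norm_pos_iff.2 hp) hp1 t
  rw [hw, map_smul, ext_eq s hts, one_mul]

theorem scal_weightToDisc {R s : {r : ℝ // 0 < r}} {k : ℤ} (x : F.weightSpace k) {p : ℂ}
    (hp : p ≠ 0) (h : ‖p‖ * R ≤ s) :
    F.scal R s p (F.weightToDisc R k x) = p ^ k • F.weightToDisc s k x := by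
  have hn : 0 < ‖p‖ := norm_pos_iff.2 hp
  -- This size makes both `‖u‖` and `‖p * u‖` less than `1`. Since `x` is up to the factor `u ^ k`
  -- its own image under `ρ(u)`, the case of small scalars applies to `u` and `p * u`.
  set u : ℂ := (((2 * (1 + ‖p‖))⁻¹ : ℝ) : ℂ) with hu
  have hun : ‖u‖ = (2 * (1 + ‖p‖))⁻¹ := by
    rw [hu, Complex.norm_real, Real.norm_of_nonneg (by positivity)]
  have hu0 : u ≠ 0 := norm_pos_iff.1 (by rw [hun]; positivity)
  have hu1 : ‖u‖ < 1 := by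
    rw [hun]
    exact inv_lt_one_of_one_lt₀ (by linarith)
  have hpu1 : ‖p * u‖ < 1 := by
    rw [norm_mul, hun, ← div_eq_mul_inv, div_lt_one (by positivity)]
    linarith
  have hR := R.2
  have huR : ‖u‖ * R.1 ≤ R := by nlinarith
  have e : F.weightToDisc R k x = (u ^ k)⁻¹ • F.scal R R u (F.weightToDisc R k x) := by
    rw [F.scal_weightToDisc_of_lt_one x hu0 huR hu1, inv_smul_smul₀ (zpow_ne_zero k hu0)]
  have hpus : ‖p * u‖ * R.1 ≤ s := by
    rw [norm_mul]
    nlinarith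
  rw [e, map_smul, F.scal_scal hu0 hp huR h,
    F.scal_weightToDisc_of_lt_one x (mul_ne_zero hp hu0) hpus hpu1, smul_smul, mul_zpow]
  congr 1
  have := zpow_ne_zero k hu0
  field_simp

theorem exists_scale_le (R s : {r : ℝ // 0 < r}) :
    ∃ p : ℂ, p ≠ 0 ∧ ‖p‖ < 1 ∧ ‖p‖ * R ≤ s := by
  have hs := s.2
  have hR := R.2
  refine ⟨((s.1 / (s.1 + R.1) : ℝ) : ℂ), ?_, ?_, ?_⟩
  · exact Complex.ofReal_ne_zero.2 (by positivity)
  · rw [Complex.norm_real, Real.norm_of_nonneg (by positivity), div_lt_one (by positivity)]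
    linarith
  · rw [Complex.norm_real, Real.norm_of_nonneg (by positivity), div_mul_eq_mul_div,
      div_le_iff₀ (by positivity)]
    nlinarith

/-- Scaling from `B_R(0)` into `B_s(0)` recovers the component at `s` up to the nonzero factor `p ^
k`. -/
theorem weightToDisc_injective (R : {r : ℝ // 0 < r}) (k : ℤ) :
    Function.Injective (F.weightToDisc R k) := by
  refine (injective_iff_map_eq_zero _).2 fun x hx => ?_
  have key : ∀ s, F.weightToDisc s k x = 0 := by
    intro s
    obtain ⟨p, hp, -, hps⟩ := exists_scale_le R s
    have := F.scal_weightToDisc x hp hps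
    rw [hx, map_zero] at this
    exact (smul_eq_zero.1 this.symm).resolve_left (zpow_ne_zero k hp)
  exact Subtype.ext (Subtype.ext (funext key))

/-- The component on `B_s(0)` has to be `p ^ (-k) ρ(p) u` for any small `p`; independence of `p`
yields compatibility and the weight condition. -/
theorem exists_weightToDisc_eq {R : {r : ℝ // 0 < r}} {k : ℤ} {u : F.obj (disc 0 R)}
    (hu : ∀ q : ℂ, q ≠ 0 → ‖q‖ < 1 → F.scal R R q u = q ^ k • u) :
    ∃ x, F.weightToDisc R k x = u := by
  have step : ∀ (s : {r : ℝ // 0 < r}) (p p' : ℂ), p ≠ 0 → p' ≠ 0 → ‖p‖ * R ≤ s → ‖p'‖ < ‖p‖ →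
      (p ^ k)⁻¹ • F.scal R s p u = (p' ^ k)⁻¹ • F.scal R s p' u := by
    intro s p p' hp hp' hps hlt
    have hq1 : ‖p' / p‖ < 1 := by
      rw [norm_div, div_lt_one (norm_pos_iff.2 hp)]
      exact hlt
    have hq0 : p' / p ≠ 0 := div_ne_zero hp' hp
    have hR := R.2
    have e : p' = p * (p' / p) := by field_simp
    conv_rhs => rw [e, ← F.scal_scal hq0 hp (s := R) (by nlinarith) hps, hu _ hq0 hq1, map_smul,
      smul_smul, mul_zpow]
    congr 1
    have := zpow_ne_zero k hq0
    field_simp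
  -- The weight condition on `u` covers only ratios of norm below `1`, so `p` and `p'` are each
  -- compared with a strictly smaller scalar.
  have indep : ∀ (s : {r : ℝ // 0 < r}) (p p' : ℂ), p ≠ 0 → p' ≠ 0 → ‖p‖ * R ≤ s → ‖p'‖ * R ≤ s →
      (p ^ k)⁻¹ • F.scal R s p u = (p' ^ k)⁻¹ • F.scal R s p' u := by
    intro s p p' hp hp' hps hps'
    have hn := norm_pos_iff.2 hp
    have hn' := norm_pos_iff.2 hp'
    have hm : 0 < min ‖p‖ ‖p'‖ / 2 := by positivity
    have hnorm : ‖((min ‖p‖ ‖p'‖ / 2 : ℝ) : ℂ)‖ = min ‖p‖ ‖p'‖ / 2 := by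
      rw [Complex.norm_real, Real.norm_of_nonneg hm.le]
    have h0 : ((min ‖p‖ ‖p'‖ / 2 : ℝ) : ℂ) ≠ 0 := Complex.ofReal_ne_zero.2 hm.ne'
    rw [step s p _ hp h0 hps (by rw [hnorm]; linarith [min_le_left ‖p‖ ‖p'‖]),
      step s p' _ hp' h0 hps' (by rw [hnorm]; linarith [min_le_right ‖p‖ ‖p'‖])]
  choose p hp hp1 hps using exists_scale_le R
  let y : ∀ s : {r : ℝ // 0 < r}, F.obj (disc 0 s) := fun s => (p s ^ k)⁻¹ • F.scal R s (p s) u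
  have hy : y ∈ F.costalk := by
    intro s s' h
    change F.ext _ ((p s ^ k)⁻¹ • F.scal R s (p s) u) = (p s' ^ k)⁻¹ • F.scal R s' (p s') u
    have h' : ‖(1 : ℂ)‖ * s.1 ≤ s' := by simpa using h
    rw [map_smul, ← F.scal_one h, F.scal_scal (hp s) one_ne_zero (hps s) h', one_mul]
    exact indep s' _ _ (hp s) (hp s') ((hps s).trans h) (hps s')
  refine ⟨⟨⟨y, hy⟩, ?_⟩, ?_⟩
  · intro q hq0 hq1 s
    have hq : q ≠ 0 := norm_pos_iff.1 hq0
    change F.scal s s q ((p s ^ k)⁻¹ • F.scal R s (p s) u) = q ^ k • (p s ^ k)⁻¹ • F.scal R s (p s) u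
    have hqs : ‖q‖ * s.1 ≤ s := by nlinarith [s.2]
    have hqp : ‖q * p s‖ * R.1 ≤ s := by
      rw [norm_mul, mul_assoc]
      exact (mul_le_mul_of_nonneg_left (hps s) (norm_nonneg q)).trans hqs
    rw [map_smul, F.scal_scal (hp s) hq (hps s) hqs,
      indep s _ _ (hp s) (mul_ne_zero hq (hp s)) (hps s) hqp, smul_smul, mul_zpow]
    congr 1
    have := zpow_ne_zero k hq
    field_simp
  · change (p R ^ k)⁻¹ • F.scal R R (p R) u = u
    rw [hu _ (hp R) (hp1 R), inv_smul_smul₀ (zpow_ne_zero k (hp R))]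

theorem isBounded_weightSpace_iff {k : ℤ} {B : Set (F.weightSpace k)} :
    Bornology.IsBounded B ↔ ∀ r, Bornology.IsBounded (F.weightToDisc r k '' B) := by
  rw [← Bornology.isBounded_image_subtype_val, ← Bornology.isBounded_image_subtype_val,
    ← Bornology.forall_isBounded_image_eval_iff]
  simp only [Set.image_image]
  rfl

/-! ## The map `L` -/

variable {F}

theorem IsHolomorphic.weightToDisc_L (hol : F.IsHolomorphic) (R : {r : ℝ // 0 < r}) (k : ℤ)
    (x : F.obj (disc 0 R)) : F.weightToDisc R k (F.L R x k) = F.weightProj R k x :=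
  Function.invFun_eq (F.exists_weightToDisc_eq fun _ hq hq1 => hol.scal_weightProj R.2 k x hq hq1)

theorem IsHolomorphic.L_scal (hol : F.IsHolomorphic) {R s : {r : ℝ // 0 < r}} (k : ℤ)
    {p : ℂ} (hp : p ≠ 0) (h : ‖p‖ * R ≤ s) (x : F.obj (disc 0 R)) :
    F.L s (F.scal R s p x) k = p ^ k • F.L R x k := by
  apply F.weightToDisc_injective s k
  rw [hol.weightToDisc_L, hol.weightProj_scal R.2 s.2 k hp h, ← hol.weightToDisc_L,
    F.scal_weightToDisc _ hp h, map_smul]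

theorem IsHolomorphic.L_ext (hol : F.IsHolomorphic) {R s : {r : ℝ // 0 < r}} (k : ℤ)
    (h : R.1 ≤ s.1) (x : F.obj (disc 0 R)) :
    F.L s (F.ext (disc_mono 0 h) x) k = F.L R x k := by
  rw [← F.scal_one h, hol.L_scal k one_ne_zero (by simpa using h), one_zpow, one_smul]

/-- The components of `L` as linear maps. -/
noncomputable def IsHolomorphic.linearL (hol : F.IsHolomorphic) (R : {r : ℝ // 0 < r}) (k : ℤ) :
    F.obj (disc 0 R) →ₗ[ℂ] F.weightSpace k where
  toFun x := F.L R x k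
  map_add' x y := F.weightToDisc_injective R k (by
    simp only [map_add, hol.weightToDisc_L, hol.weightProj_add R.2])
  map_smul' c x := F.weightToDisc_injective R k (by
    simp only [map_smul, hol.weightToDisc_L, hol.weightProj_smul R.2, RingHom.id_apply])

theorem IsHolomorphic.linearL_apply (hol : F.IsHolomorphic) (R : {r : ℝ // 0 < r}) (k : ℤ)
    (x : F.obj (disc 0 R)) : hol.linearL R k x = F.L R x k := rfl

/-- Boundedness in `F(0)_k` has to be checked on every disc. The component at `s` is a scalar
multiple of a scaling of the one at `R`, so the case of `R`, handled by a Banach lift of the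
projection, suffices. -/
theorem IsHolomorphic.isBounded_L (hol : F.IsHolomorphic) (R : {r : ℝ // 0 < r}) (k : ℤ)
    {B : Set (F.obj (disc 0 R))} (hB : Bornology.IsBounded B) :
    Bornology.IsBounded (hol.linearL R k '' B) := by
  have h₁ : Bornology.IsBounded (F.weightProj R k '' B) := by
    obtain ⟨Z, C, hC, rfl⟩ := (F.obj (disc 0 R)).complete B hB
    obtain ⟨W, T, hT⟩ := hol.exists_weightProj_lift R.2 k Z.incl
      (Z.bounded _ Metric.isBounded_closedBall)
    refine (W.bounded _ (T.lipschitz.isBounded_image hC)).subset ?_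
    rintro _ ⟨_, ⟨c, hc, rfl⟩, rfl⟩
    exact ⟨T c, ⟨c, hc, rfl⟩, hT c⟩
  rw [isBounded_weightSpace_iff]
  intro s
  obtain ⟨p, hp, -, hps⟩ := exists_scale_le R s
  refine (isBounded_smul_of_bornological (p ^ k)⁻¹ (F.scal_mem_boundedMaps R s p _ h₁)).subset ?_
  rintro _ ⟨_, ⟨x, hx, rfl⟩, rfl⟩
  refine ⟨_, ⟨_, ⟨x, hx, rfl⟩, rfl⟩, ?_⟩
  change (p ^ k)⁻¹ • F.scal R s p (F.weightProj R k x) = F.weightToDisc s k (F.L R x k)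
  rw [← hol.weightToDisc_L, F.scal_weightToDisc _ hp hps, inv_smul_smul₀ (zpow_ne_zero k hp)]

theorem P_of (R : {r : ℝ // 0 < r}) (k : ℤ) (x : F.weightSpace k) :
    F.P R (DirectSum.of (fun k => F.weightSpace k) k x) = F.weightToDisc R k x := by
  rw [P, ← DirectSum.lof_eq_of ℂ, DirectSum.toModule_lof]

theorem IsHolomorphic.L_P (hol : F.IsHolomorphic) (R : {r : ℝ // 0 < r})
    (a : ⨁ k, F.weightSpace k) (k : ℤ) : F.L R (F.P R a) k = a k := by
  have key : (hol.linearL R k).comp (F.P R) = DirectSum.component ℂ ℤ (fun k => F.weightSpace k) k := by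
    refine DirectSum.linearMap_ext ℂ fun j => LinearMap.ext fun x => ?_
    apply F.weightToDisc_injective R k
    rw [LinearMap.comp_apply, LinearMap.comp_apply, LinearMap.comp_apply, hol.linearL_apply,
      hol.weightToDisc_L, DirectSum.lof_eq_of, P_of,
      hol.weightProj_of_weight R.2 j k fun q hq hq1 => F.scal_weightToDisc x hq
        (by nlinarith [R.2]), ← DirectSum.lof_eq_of ℂ]
    split_ifs with h
    · subst h
      rw [DirectSum.component.lof_self]
    · rw [DirectSum.component.of, dif_neg (fun e => h e.symm), map_zero]
  exact LinearMap.congr_fun key a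

theorem scal_P {R s : {r : ℝ // 0 < r}} (q : ℂˣ) (h : ‖(q : ℂ)‖ * R ≤ s)
    (a : ⨁ k, F.weightSpace k) :
    F.scal R s q (F.P R a) = F.P s (gradedScale (fun k => F.weightSpace k) q a) := by
  have key : (F.scal R s q).comp (F.P R) =
      (F.P s).comp (gradedScale (fun k => F.weightSpace k) q) := by
    refine DirectSum.linearMap_ext ℂ fun j => LinearMap.ext fun x => ?_
    simp only [LinearMap.comp_apply, gradedScale, DirectSum.lmap_lof]
    rw [DirectSum.lof_eq_of, DirectSum.lof_eq_of, P_of, P_of, F.scal_weightToDisc x q.ne_zero h]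
    simp
  exact LinearMap.congr_fun key a

theorem ext_P {R s : {r : ℝ // 0 < r}} (h : R.1 ≤ s.1) (a : ⨁ k, F.weightSpace k) :
    F.ext (disc_mono 0 h) (F.P R a) = F.P s a := by
  rw [← F.scal_one h]
  have := scal_P (F := F) (R := R) (s := s) 1 (by simpa using h) a
  rw [Units.val_one] at this
  rw [this]
  congr 1
  have : gradedScale (fun k => F.weightSpace k) 1 = LinearMap.id := by
    refine DirectSum.linearMap_ext ℂ fun j => LinearMap.ext fun x => ?_
    simp [gradedScale]
  rw [this, LinearMap.id_apply]

end AffInvPrefactorizationAlgebra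

/-! ### Operations on configurations of discs -/

namespace DiscConfig

variable {m : ℕ} {z : Fin m → ℂ} {r : Fin m → {r : ℝ // 0 < r}} {R : {r : ℝ // 0 < r}}

theorem shrink (h : DiscConfig z r R) {r' : Fin m → {r : ℝ // 0 < r}} (hr : ∀ i, r' i ≤ r i) :
    DiscConfig z r' R :=
  ⟨fun i j hij => (h.disjoint hij).mono (disc_mono _ (hr i)) (disc_mono _ (hr j)),
    fun i => (disc_mono _ (hr i)).trans (h.le i)⟩

theorem enlarge (h : DiscConfig z r R) {R' : {r : ℝ // 0 < r}} (hR : R ≤ R') :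
    DiscConfig z r R' :=
  ⟨h.disjoint, fun i => (h.le i).trans (disc_mono 0 hR)⟩

theorem perm (h : DiscConfig z r R) (s : Equiv.Perm (Fin m)) :
    DiscConfig (fun i => z (s i)) (fun i => r (s i)) R :=
  ⟨fun _ _ hij => h.disjoint (s.injective.ne hij), fun i => h.le (s i)⟩

end DiscConfig

theorem affImage_scale_disc_eq {q : ℂ} (hq : q ≠ 0) (z : ℂ) (r : ℝ) :
    affImage (affOf q hq 0) (disc z r) = disc (q * z) (‖q‖ * r) := by
  refine le_antisymm (affImage_affOf_disc_le hq (by simp)) fun w hw => ?_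
  have hw' : ‖w - q * z‖ < ‖q‖ * r := by simpa [disc, dist_eq_norm] using hw
  refine ⟨q⁻¹ * w, ?_, by rw [affOf_apply, add_zero, mul_inv_cancel_left₀ hq]⟩
  have hn : 0 < ‖q‖ := norm_pos_iff.2 hq
  change dist _ _ < r
  rwa [dist_eq_norm, ← mul_lt_mul_iff_right₀ hn, ← norm_mul, mul_sub, mul_inv_cancel_left₀ hq]

theorem DiscConfig.scale {m : ℕ} {z : Fin m → ℂ} {r : Fin m → {r : ℝ // 0 < r}}
    {R : {r : ℝ // 0 < r}} (h : DiscConfig z r R) {q : ℂ} (hq : q ≠ 0) :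
    DiscConfig (fun i => q * z i) (fun i => ⟨‖q‖ * r i, mul_pos (norm_pos_iff.2 hq) (r i).2⟩)
      ⟨‖q‖ * R, mul_pos (norm_pos_iff.2 hq) R.2⟩ := by
  refine ⟨fun i j hij => ?_, fun i => ?_⟩
  · change Disjoint (disc (q * z i) (‖q‖ * r i)) (disc (q * z j) (‖q‖ * r j))
    rw [← affImage_scale_disc_eq hq, ← affImage_scale_disc_eq hq, ← Opens.coe_disjoint]
    exact (Set.disjoint_image_iff (affOf q hq 0).injective).2 (Opens.coe_disjoint.2 (h.disjoint hij))
  · change disc (q * z i) (‖q‖ * r i) ≤ disc 0 (‖q‖ * R)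
    rw [← affImage_scale_disc_eq hq]
    refine (affImage_mono _ (h.le i)).trans ?_
    rw [affImage_scale_disc_eq hq, mul_zero]

namespace AffInvPrefactorizationAlgebra

open PrefactorizationAlgebra

variable (F : AffInvPrefactorizationAlgebra.{u})

/-! ## Products of insertions -/

/-- The element `σ_{+z}(x)` of `F(B_s(c))`, where `B_r(z) ⊆ B_s(c)`. -/
noncomputable def shift (r : ℝ) (c : ℂ) (s : ℝ) (z : ℂ) :
    F.obj (disc 0 r) →ₗ[ℂ] F.obj (disc c s) :=
  (F.rho (disc 0 r) (disc c s) (1, z)).1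

theorem shift_eq_tr {r s : ℝ} {c z : ℂ} (h : ‖z - c‖ + r ≤ s) :
    F.shift r c s z = F.tr (affOf 1 one_ne_zero z) (affImage_translate_disc_le h) :=
  F.rho_eq_tr one_ne_zero _

theorem act_eq_shift {r : ℝ} {z : ℂ} (x : F.obj (disc 0 r)) :
    F.act (affOf 1 one_ne_zero z) (affImage_translation_disc z r) x = F.shift r z r z x := by
  rw [F.act_eq_tr, F.shift_eq_tr (by simp)]

theorem ext_shift {r s s' : ℝ} {c c' z : ℂ} (h : ‖z - c‖ + r ≤ s) (h' : disc c s ≤ disc c' s')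
    (h'' : ‖z - c'‖ + r ≤ s') (x : F.obj (disc 0 r)) :
    F.ext h' (F.shift r c s z x) = F.shift r c' s' z x := by
  rw [F.shift_eq_tr h, F.shift_eq_tr h'', ← F.tr_one (by rwa [affImage_one])]
  rw [F.tr_tr _ _ _ _ (by rw [one_mul]; exact affImage_translate_disc_le h''),
    F.tr_congr (one_mul _)]

theorem shift_ext {r r' s : ℝ} {c z : ℂ} (hr : r ≤ r') (h : ‖z - c‖ + r' ≤ s)
    (x : F.obj (disc 0 r)) :
    F.shift r' c s z (F.ext (disc_mono 0 hr) x) = F.shift r c s z x := by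
  have h' : ‖z - c‖ + r ≤ s := by linarith
  rw [F.shift_eq_tr h, F.shift_eq_tr h', ← F.tr_one (by rw [affImage_one]; exact disc_mono 0 hr)]
  rw [F.tr_tr _ _ _ _ (by rw [_root_.mul_one]; exact affImage_translate_disc_le h'),
    F.tr_congr (_root_.mul_one _)]

/-- Both sides are transport along `w ↦ q * w + q * z`. -/
theorem tr_scale_shift {r s r' s' : ℝ} {c c' z q : ℂ} (hq : q ≠ 0) (h : ‖z - c‖ + r ≤ s)
    (hg : affImage (affOf q hq 0) (disc c s) ≤ disc c' s') (hr : ‖q‖ * r ≤ r')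
    (h' : ‖q * z - c'‖ + r' ≤ s') (x : F.obj (disc 0 r)) :
    F.tr (affOf q hq 0) hg (F.shift r c s z x) = F.shift r' c' s' (q * z) (F.scal r r' q x) := by
  have e₁ : affOf q hq 0 * affOf 1 one_ne_zero z = affOf q hq (q * z) := by
    rw [affOf_mul]; congr 1 <;> simp
  have e₂ : affOf 1 one_ne_zero (q * z) * affOf q hq 0 = affOf q hq (q * z) := by
    rw [affOf_mul]; congr 1 <;> simp
  have hle : affImage (affOf q hq (q * z)) (disc 0 r) ≤ disc c' s' :=
    affImage_affOf_disc_le hq (by simp only [mul_zero, zero_add]; linarith)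
  rw [F.shift_eq_tr h, F.shift_eq_tr h', F.scal_eq_tr hq hr, F.tr_tr _ _ _ _ (e₁ ▸ hle),
    F.tr_tr _ _ _ _ (e₂ ▸ hle), F.tr_congr e₁ _ hle, F.tr_congr e₂ _ hle]

/-- The insertion of `a` at `z` by means of the disc `B_r(z) ⊆ B_s(c)`. -/
noncomputable def insAt (r : {r : ℝ // 0 < r}) (c : ℂ) (s : ℝ) (z : ℂ)
    (a : ⨁ k, F.weightSpace k) : F.Elt :=
  ⟨disc c s, F.shift r c s z (F.P r a)⟩

/-- The insertion of `a` at `z` by means of the disc `B_r(z)`. -/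
noncomputable def ins (r : {r : ℝ // 0 < r}) (z : ℂ) (a : ⨁ k, F.weightSpace k) : F.Elt :=
  F.insAt r z r z a

theorem DiscConfig_compat {m : ℕ} {z : Fin m → ℂ} {r : Fin m → {r : ℝ // 0 < r}}
    {R : {r : ℝ // 0 < r}} (h : DiscConfig z r R) (a : Fin m → ⨁ k, F.weightSpace k) :
    Compat (List.ofFn fun i => F.ins (r i) (z i) (a i)) (disc 0 R) :=
  compat_ofFn h.disjoint h.le _

theorem discProduct_eq_mulN {m : ℕ} {z : Fin m → ℂ} {r : Fin m → {r : ℝ // 0 < r}}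
    {R : {r : ℝ // 0 < r}} (h : DiscConfig z r R) (a : Fin m → ⨁ k, F.weightSpace k) :
    F.discProduct z r R h a = F.mulN (fun i => disc (z i) (r i)) (disc 0 R) h.disjoint h.le
      fun i => F.shift (r i) (z i) (r i) (z i) (F.P (r i) (a i)) := by
  rw [discProduct]
  simp only [act_eq_shift]

theorem discProduct_eq_lprod {m : ℕ} {z : Fin m → ℂ} {r : Fin m → {r : ℝ // 0 < r}}
    {R : {r : ℝ // 0 < r}} (h : DiscConfig z r R) (a : Fin m → ⨁ k, F.weightSpace k) :
    F.discProduct z r R h a =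
      F.lprod (List.ofFn fun i => F.ins (r i) (z i) (a i)) (disc 0 R) (F.DiscConfig_compat h a) := by
  rw [discProduct_eq_mulN, mulN_eq_lprod]
  rfl

/-- The discs used to define an insertion may be enlarged. -/
theorem lprod_insAt {m : ℕ} {z : Fin m → ℂ} {r : Fin m → {r : ℝ // 0 < r}} {c : Fin m → ℂ}
    {s : Fin m → ℝ} {R : {r : ℝ // 0 < r}} (h : ∀ i, ‖z i - c i‖ + r i ≤ s i)
    (a : Fin m → ⨁ k, F.weightSpace k) {V : Opens ℂ}
    (hc : Compat (List.ofFn fun i => F.insAt (r i) (c i) (s i) (z i) (a i)) V)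
    (hV : V ≤ disc 0 R)
    (hz : DiscConfig z r R) :
    F.ext hV (F.lprod _ V hc) = F.discProduct z r R hz a := by
  have hd : ∀ i, disc (z i) (r i) ≤ disc (c i) (s i) := fun i => disc_le_disc (h i)
  have hc' : Compat (List.ofFn fun i => F.ins (r i) (z i) (a i)) V :=
    compat_ofFn hz.disjoint (fun i => (hd i).trans
      (hc.le _ ((List.mem_ofFn' _ _).2 ⟨i, rfl⟩))) _
  have hV1 : affImage 1 V ≤ V := (affImage_one V).le
  -- Transport along the identity is extension, so this instance replaces each disc by the larger
  -- one without changing the product.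
  have := F.tr_lprod_ofFn 1 (p := fun i => F.ins (r i) (z i) (a i))
    (q := fun i => F.insAt (r i) (c i) (s i) (z i) (a i)) (fun i => by
      have hi : affImage 1 (disc (z i) (r i)) ≤ disc (c i) (s i) := by
        rw [affImage_one]; exact hd i
      refine ⟨hi, ?_⟩
      change F.shift _ _ _ _ _ = F.tr 1 hi (F.shift _ _ _ _ _)
      rw [F.tr_one hi (hd i), F.ext_shift (by simp) _ (h i)]) hV1 hc' hc
  rw [← this, F.tr_one _ le_rfl, F.ext_self, discProduct_eq_lprod]
  exact ext_lprod _ _ _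

theorem ext_discProduct {m : ℕ} {z : Fin m → ℂ} {r r' : Fin m → {r : ℝ // 0 < r}}
    {R R' : {r : ℝ // 0 < r}} (h : DiscConfig z r R) (h' : DiscConfig z r' R')
    (hr : ∀ i, r i ≤ r' i) (hR : R.1 ≤ R'.1) (a : Fin m → ⨁ k, F.weightSpace k) :
    F.ext (disc_mono 0 hR) (F.discProduct z r R h a) = F.discProduct z r' R' h' a := by
  have hb := (h'.shrink hr)
  have key : F.discProduct z r R' hb a = F.discProduct z r' R' h' a := by
    rw [discProduct_eq_mulN, discProduct_eq_mulN, mulN_eq_lprod, mulN_eq_lprod]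
    have := F.tr_lprod_ofFn 1 (p := fun i => F.ins (r i) (z i) (a i))
      (q := fun i => F.ins (r' i) (z i) (a i)) (fun i => by
        have hi : disc (z i) (r i) ≤ disc (z i) (r' i) := disc_mono _ (hr i)
        have hi' : affImage 1 (disc (z i) (r i)) ≤ disc (z i) (r' i) := by
          rw [affImage_one]; exact hi
        have hi'' : (r i).1 ≤ (r' i).1 := hr i
        refine ⟨hi', ?_⟩
        change F.shift _ _ _ _ _ = F.tr 1 hi' (F.shift _ _ _ _ _)
        rw [F.tr_one hi' hi, F.ext_shift (by simp) _ (by rwa [sub_self, norm_zero, zero_add]), ← ext_P hi'',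
          F.shift_ext hi'' (by simp)])
      (affImage_one _).le (F.DiscConfig_compat hb a) (F.DiscConfig_compat h' a)
    rw [F.tr_one _ le_rfl, F.ext_self] at this
    exact this
  rw [← key, discProduct_eq_lprod, discProduct_eq_lprod]
  exact ext_lprod _ _ _

variable {F}

/-- Shrinking the small discs changes nothing, and enlarging the big one is absorbed by `L_ext`. Any
two choices meet at the minima of the `rᵢ` and the maximum of the `R`. -/
theorem IsHolomorphic.L_discProduct_eq (hol : F.IsHolomorphic) {m : ℕ} {z : Fin m → ℂ}
    {r r' : Fin m → {r : ℝ // 0 < r}} {R R' : {r : ℝ // 0 < r}} (h : DiscConfig z r R)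
    (h' : DiscConfig z r' R') (a : Fin m → ⨁ k, F.weightSpace k) (k : ℤ) :
    F.L R (F.discProduct z r R h a) k = F.L R' (F.discProduct z r' R' h' a) k := by
  have mono : ∀ {r r' : Fin m → {r : ℝ // 0 < r}} {R R' : {r : ℝ // 0 < r}}
      (h : DiscConfig z r R) (h' : DiscConfig z r' R') (_ : ∀ i, r i ≤ r' i) (_ : R.1 ≤ R'.1),
      F.L R (F.discProduct z r R h a) k = F.L R' (F.discProduct z r' R' h' a) k := by
    intro r r' R R' h h' hr hR
    rw [← F.ext_discProduct h h' hr hR, hol.L_ext k hR]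
  let t : Fin m → {r : ℝ // 0 < r} := fun i => min (r i) (r' i)
  have ht : ∀ i, t i ≤ r i := fun i => min_le_left _ _
  have ht' : ∀ i, t i ≤ r' i := fun i => min_le_right _ _
  have h₁ := h.shrink ht
  have h₂ := h'.shrink ht'
  have h₃ := h₁.enlarge (le_max_left R R')
  rw [← mono h₁ h ht le_rfl, ← mono h₂ h' ht' le_rfl,
    mono h₁ h₃ (fun _ => le_rfl) (le_max_left R R'), mono h₂ h₃ (fun _ => le_rfl) (le_max_right R R')]

/-- The formula for `μ` holds for all choices of radii. -/
theorem IsHolomorphic.mu_eq (hol : F.IsHolomorphic) {m : ℕ} (a : Fin m → ⨁ k, F.weightSpace k)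
    (z : Conf m) {r : Fin m → {r : ℝ // 0 < r}} {R : {r : ℝ // 0 < r}} (h : DiscConfig z.1 r R)
    (k : ℤ) : F.mu m a z k = F.L R (F.discProduct z.1 r R h a) k :=
  hol.L_discProduct_eq _ h a k

theorem IsHolomorphic.hasContourIntegral_discProduct (hol : F.IsHolomorphic) {m : ℕ} (z : Conf m)
    (r : Fin m → {r : ℝ // 0 < r}) (R : {r : ℝ // 0 < r}) (h : DiscConfig z.1 r R)
    (a : Fin m → ⨁ k, F.weightSpace k) (k : ℤ) (t : ℝ) (ht : 0 < t) (ht' : t < 1) :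
    HasContourIntegral
      (fun q : ℂ => q ^ (-k - 1) • F.discAction R q (F.discProduct z.1 r R h a)) t
      ((2 * Real.pi * Complex.I : ℂ) • F.weightToDisc R k (F.mu m a z k)) := by
  rw [hol.mu_eq a z h, hol.weightToDisc_L]
  exact hol.hasContourIntegral_weightProj R.2 k _ ht ht'

/-! ## The algebraic axioms -/

theorem IsHolomorphic.mu_multilinear (hol : F.IsHolomorphic) (m : ℕ) :
    ∃ T : MultilinearMap ℂ (fun _ : Fin m => ⨁ k, F.weightSpace k)
      (Conf m → ∀ k, F.weightSpace k), ⇑T = F.mu m := by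
  have h : ∀ (z : Conf m) (k : ℤ), ∃ T : MultilinearMap ℂ (fun _ : Fin m => ⨁ k, F.weightSpace k)
      (F.weightSpace k), ∀ a, T a = F.mu m a z k := by
    intro z k
    obtain ⟨⟨r, R⟩, hz : DiscConfig z.1 r R⟩ := exists_discConfig z
    obtain ⟨T, hT⟩ := F.exists_multilinearMap_mulN (fun i => disc (z.1 i) (r i)) (disc 0 R)
      hz.disjoint hz.le
    refine ⟨((hol.linearL R k).compMultilinearMap T).compLinearMap fun i =>
      (F.shift (r i) (z.1 i) (r i) (z.1 i)).comp (F.P (r i)), fun a => ?_⟩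
    rw [hol.mu_eq a z hz, discProduct_eq_mulN, ← hT]
    rfl
  choose T hT using h
  refine ⟨MultilinearMap.pi fun z => MultilinearMap.pi fun k => T z k, ?_⟩
  ext a z k
  simp [hT]

theorem IsHolomorphic.mu_perm (hol : F.IsHolomorphic) {m : ℕ} (a : Fin m → ⨁ k, F.weightSpace k)
    (z : Conf m) (s : Equiv.Perm (Fin m)) : F.mu m (fun i => a (s i)) (z.perm s) = F.mu m a z := by
  ext1 k
  obtain ⟨⟨r, R⟩, hz : DiscConfig z.1 r R⟩ := exists_discConfig z
  have hzs : DiscConfig (z.perm s).1 (fun i => r (s i)) R := hz.perm s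
  rw [hol.mu_eq _ _ hz, hol.mu_eq _ _ hzs, discProduct_eq_lprod,
    discProduct_eq_lprod]
  congr 1
  exact lprod_perm (s.ofFn_comp_perm fun i => F.ins (r i) (z.1 i) (a i)) _ _

theorem IsHolomorphic.mu_equivariant (hol : F.IsHolomorphic) {m : ℕ}
    (a : Fin m → ⨁ k, F.weightSpace k) (z : Conf m) (q : ℂˣ) (k : ℤ) :
    F.mu m (fun i => gradedScale (fun k => F.weightSpace k) q (a i)) (z.scale q) k =
      (q : ℂ) ^ k • F.mu m a z k := by
  obtain ⟨⟨r, R⟩, hz : DiscConfig z.1 r R⟩ := exists_discConfig z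
  have hz' : DiscConfig (z.scale q).1 _ _ := hz.scale q.ne_zero
  rw [hol.mu_eq _ _ hz, hol.mu_eq _ (z.scale q) hz', ← hol.L_scal k q.ne_zero
    (s := ⟨‖(q : ℂ)‖ * R, mul_pos (norm_pos_iff.2 q.ne_zero) R.2⟩) le_rfl,
    F.scal_eq_tr q.ne_zero le_rfl, discProduct_eq_lprod, discProduct_eq_lprod]
  congr 1
  refine (F.tr_lprod_ofFn _ (fun i => ?_) _ _ _).symm
  have hi := (affImage_scale_disc_eq q.ne_zero (z.1 i) (r i)).le
  refine ⟨hi, ?_⟩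
  refine Eq.trans ?_ (F.tr_scale_shift q.ne_zero (by simp) hi le_rfl (by simp) _).symm
  rw [scal_P (s := ⟨‖(q : ℂ)‖ * r i, mul_pos (norm_pos_iff.2 q.ne_zero) (r i).2⟩) q le_rfl]
  rfl

theorem discConfig_single_zero :
    DiscConfig (Conf.single 0).1 (fun _ => ⟨1, one_pos⟩) ⟨1, one_pos⟩ :=
  ⟨fun i j hij => (hij (Subsingleton.elim i j)).elim, fun _ => le_rfl⟩

theorem IsHolomorphic.mu_single_zero (hol : F.IsHolomorphic) (a : ⨁ k, F.weightSpace k) (k : ℤ) :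
    F.mu 1 (fun _ => a) (Conf.single 0) k = a k := by
  rw [hol.mu_eq _ _ discConfig_single_zero, discProduct_eq_lprod, ← hol.L_P ⟨1, one_pos⟩ a k]
  congr 1
  have hl : List.ofFn (fun i : Fin 1 => F.ins ⟨1, one_pos⟩ ((Conf.single 0).1 i) a) =
      [F.ins ⟨1, one_pos⟩ 0 a] := by simp [Conf.single]
  rw [lprod_congr hl _ (hl ▸ F.DiscConfig_compat discConfig_single_zero fun _ => a)]
  rw [lprod_singleton]
  refine (F.ext_self (U := disc 0 1) le_rfl _).trans ?_
  change F.shift 1 0 1 0 _ = _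
  rw [F.shift_eq_tr (by simp), F.tr_congr affOf_one_zero, F.tr_one _ le_rfl, F.ext_self]
  rw [affImage_one]

end AffInvPrefactorizationAlgebra

/-! ## Holomorphic functions with values in a vector space without topology -/

/-- Identity theorem: a functional that kills the finite-dimensional space used near one point `p`
vanishes along `f` near `p` on the complex line to any other point, hence at that point as well. -/
theorem exists_global_finite {E V : Type*} [NormedAddCommGroup E] [NormedSpace ℂ E]
    [AddCommGroup V] [Module ℂ V] {S : Set E} {f : E → V}
    (hloc : ∀ p ∈ S, ∃ (N : Set E) (d : ℕ) (φ : (Fin d → ℂ) →ₗ[ℂ] V) (g : E → Fin d → ℂ),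
      IsOpen N ∧ p ∈ N ∧ DifferentiableOn ℂ g N ∧ ∀ x ∈ N, φ (g x) = f x)
    (hconn : ∀ p ∈ S, ∀ q ∈ S, ∃ U : Set ℂ, IsOpen U ∧ IsPreconnected U ∧ 0 ∈ U ∧ 1 ∈ U ∧
      ∀ t ∈ U, p + t • (q - p) ∈ S) :
    ∃ (d : ℕ) (φ : (Fin d → ℂ) →ₗ[ℂ] V) (g : E → Fin d → ℂ),
      DifferentiableOn ℂ g S ∧ ∀ x ∈ S, φ (g x) = f x := by
  -- `V` has no topology, but a linear map out of it becomes continuous after composition with a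
  -- local parametrization `φ`.
  have hdiff : ∀ (n : ℕ) (ψ : V →ₗ[ℂ] (Fin n → ℂ)), ∀ p ∈ S,
      DifferentiableAt ℂ (fun x => ψ (f x)) p := by
    intro n ψ p hp
    obtain ⟨N, d, φ, g, hN, hpN, hg, h⟩ := hloc p hp
    have h₁ : DifferentiableAt ℂ (fun x => LinearMap.toContinuousLinearMap (ψ ∘ₗ φ) (g x)) p :=
      (ContinuousLinearMap.differentiableAt _).comp p (hg.differentiableAt (hN.mem_nhds hpN))
    refine h₁.congr_of_eventuallyEq ?_
    filter_upwards [hN.mem_nhds hpN] with x hx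
    simp [h x hx]
  rcases S.eq_empty_or_nonempty with rfl | ⟨p, hp⟩
  · exact ⟨0, 0, fun _ => 0, differentiableOn_empty, fun x hx => hx.elim⟩
  obtain ⟨N, n, φ', g, hN, hpN, hg, h⟩ := hloc p hp
  obtain ⟨d, φ, ψ₀, hφ, rfl⟩ := exists_injective_finite φ'
  have hmem : ∀ q ∈ S, f q ∈ LinearMap.range φ := by
    intro q hq
    by_contra hcon
    obtain ⟨ψ, hψ, hψ'⟩ := Submodule.exists_le_ker_of_notMem hcon
    obtain ⟨U, hU, hUc, h0, h1, hUS⟩ := hconn p hp q hq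
    let l : ℂ → E := fun t => p + t • (q - p)
    have hl : Differentiable ℂ l := by fun_prop
    let ψ' : V →ₗ[ℂ] (Fin 1 → ℂ) := LinearMap.pi fun _ => ψ
    have hd : DifferentiableOn ℂ (fun t => ψ (f (l t))) U := by
      intro t ht
      have h₁ : DifferentiableAt ℂ (fun t => ψ' (f (l t))) t :=
        DifferentiableAt.comp (g := fun x => ψ' (f x)) t (hdiff 1 ψ' (l t) (hUS t ht)) (hl t)
      exact (differentiableAt_pi.1 h₁ 0).differentiableWithinAt
    have hz : (fun t => ψ (f (l t))) =ᶠ[nhds 0] 0 := by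
      have hl0 : l 0 ∈ N := by simpa [l] using hpN
      filter_upwards [(hN.preimage hl.continuous).mem_nhds hl0] with t ht
      exact hψ' ⟨_, h (l t) ht⟩
    have := (hd.analyticOnNhd hU).eqOn_zero_of_preconnected_of_eventuallyEq_zero hUc h0 hz h1
    simp [l] at this
    exact hψ this
  -- A linear left inverse provides global coordinates, differentiable by `hdiff`.
  obtain ⟨ψ, hψ⟩ := φ.exists_leftInverse_of_injective (LinearMap.ker_eq_bot.2 hφ)
  refine ⟨d, φ, fun x => ψ (f x), fun x hx => (hdiff d ψ x hx).differentiableWithinAt,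
    fun x hx => ?_⟩
  obtain ⟨y, hy⟩ := hmem x hx
  change φ (ψ (f x)) = f x
  rw [← hy]
  exact congrArg φ (LinearMap.congr_fun hψ y)

/-- Two given points collide for at most one `t`, since their difference is affine in `t` and
nonzero at `0`. The complement of a finite set in `ℂ` is connected. -/
theorem exists_line_conf {m : ℕ} (z w : Fin m → ℂ) (hz : Function.Injective z)
    (hw : Function.Injective w) : ∃ U : Set ℂ, IsOpen U ∧ IsPreconnected U ∧ 0 ∈ U ∧ 1 ∈ U ∧
      ∀ t ∈ U, Function.Injective (z + t • (w - z)) := by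
  let B : Set ℂ := ⋃ (i : Fin m) (j : Fin m) (_ : i ≠ j),
    {t | (z + t • (w - z)) i = (z + t • (w - z)) j}
  have hB : B.Finite := by
    refine Set.finite_iUnion fun i => Set.finite_iUnion fun j => Set.finite_iUnion fun hij =>
      Set.Subsingleton.finite ?_
    intro t ht t' ht'
    simp only [Set.mem_ofPred_eq, Pi.add_apply, Pi.smul_apply, Pi.sub_apply, smul_eq_mul] at ht ht'
    have h0 : z i - z j ≠ 0 := sub_ne_zero.2 (hz.ne hij)
    by_contra hne
    have hb : (w i - z i) - (w j - z j) = 0 := by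
      have : (t - t') * ((w i - z i) - (w j - z j)) = 0 := by linear_combination ht - ht'
      exact (mul_eq_zero.1 this).resolve_left (sub_ne_zero.2 hne)
    exact h0 (by linear_combination ht - t * hb)
  have hmem : ∀ t, t ∈ Bᶜ ↔ Function.Injective (z + t • (w - z)) := by
    intro t
    simp only [B, Set.mem_compl_iff, Set.mem_iUnion, Set.mem_ofPred_eq, not_exists]
    exact ⟨fun h i j e => by_contra fun hij => h i j hij e, fun h i j hij e => hij (h e)⟩
  refine ⟨Bᶜ, hB.isClosed.isOpen_compl,
    (hB.countable.isPathConnected_compl_of_one_lt_rank (by simp)).isConnected.isPreconnected,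
    (hmem 0).2 (by simpa using hz), (hmem 1).2 (by simpa using hw), fun t ht => (hmem t).1 ht⟩

theorem DiscConfig.of_near {m : ℕ} {z c : Fin m → ℂ} {r s : Fin m → {r : ℝ // 0 < r}}
    {R : {r : ℝ // 0 < r}} (h : DiscConfig c s R) (hz : ∀ i, ‖z i - c i‖ + r i ≤ s i) :
    DiscConfig z r R :=
  ⟨fun i j hij => (h.disjoint hij).mono (disc_le_disc (hz i)) (disc_le_disc (hz j)),
    fun i => (disc_le_disc (hz i)).trans (h.le i)⟩

theorem DiscConfig.injective {m : ℕ} {z : Fin m → ℂ} {r : Fin m → {r : ℝ // 0 < r}}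
    {R : {r : ℝ // 0 < r}} (h : DiscConfig z r R) : Function.Injective z := by
  intro i j hij
  by_contra hne
  have hd := Opens.coe_disjoint.2 (h.disjoint hne)
  refine Set.disjoint_left.1 hd (Metric.mem_ball_self (r i).2) ?_
  rw [hij]
  exact Metric.mem_ball_self (r j).2

/-! ### Holomorphy in the insertion points -/

namespace AffInvPrefactorizationAlgebra

open PrefactorizationAlgebra

variable {F : AffInvPrefactorizationAlgebra.{u}}

/-- On the right the discs are fixed, so `z` enters only through `shift` into fixed spaces, where
holomorphy and boundedness in `z` make sense. -/
theorem discProduct_of_near {m : ℕ} (a : Fin m → ⨁ k, F.weightSpace k)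
    {z c : Fin m → ℂ} {r s : Fin m → {r : ℝ // 0 < r}} {R : {r : ℝ // 0 < r}}
    (h : DiscConfig c s R) (hz : ∀ i, ‖z i - c i‖ + r i ≤ s i) :
    F.discProduct z r R (h.of_near hz) a =
      F.mulN (fun i => disc (c i) (s i)) (disc 0 R) h.disjoint h.le
        fun i => F.shift (r i) (c i) (s i) (z i) (F.P (r i) (a i)) := by
  rw [mulN_eq_lprod, ← F.lprod_insAt (V := disc 0 R) hz a
    (compat_ofFn h.disjoint h.le _) le_rfl, F.ext_self]
  rfl

theorem IsHolomorphic.bornHolomorphicOn_shift (hol : F.IsHolomorphic) {r s : ℝ} {c : ℂ}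
    (x : F.obj (disc 0 r)) : BornHolomorphicOn (fun z => F.shift r c s z x) {z | ‖z - c‖ + r < s} :=
  (hol.translate c r s).apply (F.obj _).complete (F.obj _).complete x

theorem IsHolomorphic.exists_local_lift_mu (hol : F.IsHolomorphic)
    (dis : F.HasDiscreteWeightSpaces) {m : ℕ} (a : Fin m → ⨁ k, F.weightSpace k) (z₀ : Conf m)
    (k : ℤ) : ∃ (N : Set (Fin m → ℂ)) (d : ℕ) (φ : (Fin d → ℂ) →ₗ[ℂ] F.weightSpace k)
      (g : (Fin m → ℂ) → Fin d → ℂ), IsOpen N ∧ z₀.1 ∈ N ∧ DifferentiableOn ℂ g N ∧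
        ∀ z ∈ N, ∃ hz : Function.Injective z, φ (g z) = F.mu m a ⟨z, hz⟩ k := by
  obtain ⟨⟨s, R⟩, hs : DiscConfig z₀.1 s R⟩ := exists_discConfig z₀
  -- Half the radius leaves room for `z i` to move inside the fixed disc of radius `s i`.
  let r : Fin m → {r : ℝ // 0 < r} := fun i => ⟨s i / 2, half_pos (s i).2⟩
  let N : Set (Fin m → ℂ) := {z | ∀ i, ‖z i - z₀.1 i‖ + r i < s i}
  have hN : IsOpen N := by
    simp only [N, Set.ofPred_forall]
    exact isOpen_iInter_of_finite fun i => isOpen_lt (by fun_prop) continuous_const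
  have hz₀ : z₀.1 ∈ N := fun i => by
    have := (s i).2
    simp only [r, sub_self, norm_zero]
    linarith
  have hb := F.bornHolomorphicOn_mulN hN (fun i => disc (z₀.1 i) (s i)) (disc 0 R) hs.disjoint hs.le
    (fun i z => F.shift (r i) (z₀.1 i) (s i) (z i) (F.P (r i) (a i))) fun i =>
      (hol.bornHolomorphicOn_shift (F.P (r i) (a i))).comp_differentiableOn hN
        (h := fun z : Fin m → ℂ => z i) (by fun_prop) fun z hz => hz i
  obtain ⟨N', W, g, hN', hzN', hNN', hg, hgf⟩ := hb z₀.1 hz₀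
  -- `L` maps the unit ball of `W` to a bounded subset of a discrete space, so its restriction to
  -- `W` has finite-dimensional range.
  obtain ⟨d, φ, M, T, -, hT⟩ := (dis k).exists_lift (A := W.E) (ι := Unit)
    (fun _ => (hol.linearL R k).comp W.incl) (by
      simp only [LinearMap.coe_comp, Set.image_comp, Set.iUnion_const]
      exact hol.isBounded_L R k (W.bounded _ Metric.isBounded_closedBall))
  refine ⟨N', d, φ, fun z => T () (g z), hN', hzN', (T ()).differentiable.comp_differentiableOn hg,
    fun z hz => ?_⟩
  have hle : ∀ i, ‖z i - z₀.1 i‖ + r i ≤ s i := fun i => (hNN' hz i).le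
  refine ⟨(hs.of_near hle).injective, ?_⟩
  rw [(hT ()).2, hol.mu_eq a _ (hs.of_near hle), discProduct_of_near a hs hle,
    LinearMap.comp_apply, hgf z hz]
  rfl

theorem IsHolomorphic.mu_holomorphic (hol : F.IsHolomorphic)
    (dis : F.HasDiscreteWeightSpaces) (m : ℕ) (a : Fin m → ⨁ k, F.weightSpace k) :
    ProdHolomorphic (fun k => F.weightSpace k) {z : Fin m → ℂ | Function.Injective z}
      (F.mu m a) := by
  classical
  intro k
  let f : (Fin m → ℂ) → F.weightSpace k := fun z =>
    if hz : Function.Injective z then F.mu m a ⟨z, hz⟩ k else 0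
  obtain ⟨d, φ, g, hg, h⟩ := exists_global_finite (S := {z : Fin m → ℂ | Function.Injective z})
    (f := f) (fun p hp => by
      obtain ⟨N, d, φ, g, hN, hpN, hg, h⟩ := hol.exists_local_lift_mu dis a ⟨p, hp⟩ k
      refine ⟨N, d, φ, g, hN, hpN, hg, fun x hx => ?_⟩
      obtain ⟨hz, e⟩ := h x hx
      rw [e]
      exact (show f x = F.mu m a ⟨x, hz⟩ k from dif_pos hz).symm) fun p hp q hq => exists_line_conf p q hp hq
  exact ⟨d, φ, g, hg, fun x => (h x.1 x.2).trans (dif_pos x.2)⟩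

end AffInvPrefactorizationAlgebra

namespace PrefactorizationAlgebra

variable {F : PrefactorizationAlgebra.{u}}

theorem Compat.of_nested {l₁ l₂ : List F.Elt} {V W : Opens ℂ} {v : F.obj V} (h₁ : Compat l₁ V)
    (h : Compat (⟨V, v⟩ :: l₂) W) : Compat (l₁ ++ l₂) W := by
  refine ⟨List.pairwise_append.2 ⟨h₁.pairwise, h.tail.pairwise, fun p hp q hq => ?_⟩, fun p hp => ?_⟩
  · exact ((List.pairwise_cons.1 h.pairwise).1 q hq).mono_left (h₁.le p hp)
  · rcases List.mem_append.1 hp with hp | hp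
    · exact (h₁.le p hp).trans h.head
    · exact h.tail.le p hp

end PrefactorizationAlgebra

/-- The discs `B_s(cᵢ)` and `B_{s'}(c')` are pairwise disjoint and contained in `B_R(0)`. -/
structure OuterConfig {m : ℕ} (c : Fin m → ℂ) (c' : ℂ) (s s' : ℝ) (R : {r : ℝ // 0 < r}) :
    Prop where
  disjoint : Pairwise fun i j => Disjoint (disc (c i) s) (disc (c j) s)
  disjoint' : ∀ i, Disjoint (disc c' s') (disc (c i) s)
  le : ∀ i, disc (c i) s ≤ disc 0 R
  le' : disc c' s' ≤ disc 0 R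

namespace AffInvPrefactorizationAlgebra

open PrefactorizationAlgebra

variable {F : AffInvPrefactorizationAlgebra.{u}}

/-! ## Multiplication with insertions away from a disc -/

theorem IsHolomorphic.mu_eq_lprod (hol : F.IsHolomorphic) {m : ℕ}
    (a : Fin m → ⨁ k, F.weightSpace k)
    (z : Conf m) {c : Fin m → ℂ} {s : Fin m → ℝ} {r : Fin m → {r : ℝ // 0 < r}}
    {R : {r : ℝ // 0 < r}} (hz : ∀ i, ‖z.1 i - c i‖ + r i ≤ s i) {l : List F.Elt}
    (hl : l.Perm (List.ofFn fun i => F.insAt (r i) (c i) (s i) (z.1 i) (a i)))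
    (h : Compat l (disc 0 R)) (k : ℤ) : F.mu m a z k = F.L R (F.lprod l (disc 0 R) h) k := by
  have hc := h.perm hl
  have hd : Pairwise fun i j => Disjoint (disc (c i) (s i)) (disc (c j) (s j)) := by
    have := List.pairwise_ofFn.1 hc.pairwise
    intro i j hij
    rcases lt_or_gt_of_ne hij with hij | hij
    · exact this hij
    · exact (this hij).symm
  have hconf : DiscConfig z.1 r R :=
    ⟨fun i j hij => (hd hij).mono (disc_le_disc (hz i)) (disc_le_disc (hz j)),
      fun i => (disc_le_disc (hz i)).trans (hc.le _ ((List.mem_ofFn' _ _).2 ⟨i, rfl⟩))⟩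
  rw [hol.mu_eq a z hconf, ← F.lprod_insAt hz a hc le_rfl, F.ext_self, lprod_perm hl h hc]

variable (F) in
/-- Multiplication with the insertions of `aᵢ` at `zᵢ`, and shift by `z'`. -/
noncomputable def outer {m : ℕ} {c : Fin m → ℂ} {c' : ℂ} {s s' : ℝ} {R : {r : ℝ // 0 < r}}
    (h : OuterConfig c c' s s' R) (r r' : {r : ℝ // 0 < r}) (a : Fin m → ⨁ k, F.weightSpace k)
    (z : Fin m → ℂ) (z' : ℂ) : F.obj (disc 0 r') →ₗ[ℂ] F.obj (disc 0 R) :=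
  ((F.mul (disjoint_iSup_iff.2 h.disjoint') h.le' (iSup_le h.le)).flip
    (F.mulN (fun i => disc (c i) s) (⨆ i, disc (c i) s) h.disjoint
      (le_iSup fun i => disc (c i) s) fun i => F.shift r (c i) s (z i) (F.P r (a i)))).comp
    (F.shift r' c' s' z')

theorem compat_outer {m : ℕ} {c : Fin m → ℂ} {c' : ℂ} {s s' : ℝ} {R : {r : ℝ // 0 < r}}
    (h : OuterConfig c c' s s' R) (r : {r : ℝ // 0 < r}) (a : Fin m → ⨁ k, F.weightSpace k)
    (z : Fin m → ℂ) (x : F.obj (disc c' s')) :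
    Compat (⟨disc c' s', x⟩ :: List.ofFn fun i => F.insAt r (c i) s (z i) (a i)) (disc 0 R) := by
  have hc : Compat (List.ofFn fun i => F.insAt r (c i) s (z i) (a i)) (disc 0 R) :=
    compat_ofFn h.disjoint h.le _
  refine ⟨List.pairwise_cons.2 ⟨fun p hp => ?_, hc.pairwise⟩, fun p hp => ?_⟩
  · obtain ⟨i, rfl⟩ := (List.mem_ofFn' _ _).1 hp
    exact h.disjoint' i
  · rcases List.mem_cons.1 hp with rfl | hp
    · exact h.le'
    · exact hc.le p hp

section Outer

variable {m : ℕ} {c : Fin m → ℂ} {c' : ℂ} {s s' : ℝ} {R : {r : ℝ // 0 < r}}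
  (h : OuterConfig c c' s s' R) (r r' : {r : ℝ // 0 < r}) (a : Fin m → ⨁ k, F.weightSpace k)

theorem outer_eq_lprod (z : Fin m → ℂ) (z' : ℂ) (x : F.obj (disc 0 r')) :
    F.outer h r r' a z z' x =
      F.lprod (⟨disc c' s', F.shift r' c' s' z' x⟩ ::
        List.ofFn fun i => F.insAt r (c i) s (z i) (a i)) (disc 0 R) (compat_outer h r a z _) := by
  rw [outer, LinearMap.comp_apply, LinearMap.flip_apply, mulN_eq_lprod]
  exact mul_lprod (p := ⟨disc c' s', F.shift r' c' s' z' x⟩) _ _ _ _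

/-- Together with `mu_append`, this presents the two sides of associativity as the same linear map
`F.L R ∘ outer`, applied to a single inserted vector and to a whole inner product. -/
theorem IsHolomorphic.mu_snoc (hol : F.IsHolomorphic) (v : ⨁ k, F.weightSpace k)
    (z : Conf (m + 1)) (hz : ∀ i : Fin m, ‖z.1 i.castSucc - c i‖ + r ≤ s)
    (hz' : ‖z.1 (Fin.last m) - c'‖ + r' ≤ s') (l : ℤ) :
    F.mu (m + 1) (Fin.snoc a v) z l =
      F.L R (F.outer h r r' a (fun i => z.1 i.castSucc) (z.1 (Fin.last m)) (F.P r' v)) l := by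
  rw [outer_eq_lprod]
  refine hol.mu_eq_lprod _ z (c := Fin.snoc (α := fun _ => ℂ) c c')
    (s := Fin.snoc (α := fun _ => ℝ) (fun _ => s) s')
    (r := Fin.snoc (α := fun _ => {r : ℝ // 0 < r}) (fun _ => r) r') (fun i => ?_) ?_ _ l
  · refine Fin.lastCases ?_ (fun i => ?_) i
    · simpa using hz'
    · simpa using hz i
  · rw [List.ofFn_succ']
    simp only [Fin.snoc_castSucc, Fin.snoc_last, List.concat_eq_append]
    exact (List.perm_append_singleton _ _).symm

theorem tr_translate_ins (r₀ : {r : ℝ // 0 < r}) (z w : ℂ) (b : ⨁ k, F.weightSpace k)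
    (hi : affImage (affOf 1 one_ne_zero z) (disc w r₀) ≤ disc (w + z) r₀) :
    (F.ins r₀ (w + z) b).2 = F.tr (affOf 1 one_ne_zero z) hi (F.ins r₀ w b).2 := by
  change F.shift _ _ _ _ _ = F.tr _ hi (F.shift _ _ _ _ _)
  have e : affOf 1 one_ne_zero z * affOf 1 one_ne_zero w = affOf 1 one_ne_zero (w + z) := by
    rw [affOf_mul]
    congr 1 <;> simp
  have hle : affImage (affOf 1 one_ne_zero (w + z)) (disc 0 r₀) ≤ disc (w + z) r₀ :=
    affImage_translate_disc_le (by simp)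
  rw [F.shift_eq_tr (by simp), F.shift_eq_tr (by simp), F.tr_tr _ _ _ _ (e ▸ hle), F.tr_congr e]

/-- Translating the inner product by `z'` translates each of its insertions, and a nested product
may be flattened. -/
theorem IsHolomorphic.mu_append (hol : F.IsHolomorphic) {n : ℕ} (b : Fin n → ⨁ k, F.weightSpace k)
    {z : Fin m → ℂ} {z' : ℂ} (hz : ∀ i : Fin m, ‖z i - c i‖ + r ≤ s)
    (hz' : ‖z' - c'‖ + r' ≤ s') {w : Fin n → ℂ} {r₀ : Fin n → {r : ℝ // 0 < r}}
    {r₁ : {r : ℝ // 0 < r}} (hr : r₁.1 ≤ r'.1) (hw : DiscConfig w r₀ r₁) (x : Conf (m + n))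
    (hx : x.1 = Fin.append z fun j => w j + z') (l : ℤ) :
    F.mu (m + n) (Fin.append a b) x l =
      F.L R (F.outer h r r' a z z' (F.ext (disc_mono 0 hr) (F.discProduct w r₀ r₁ hw b))) l := by
  have hi : ∀ j, affImage (affOf 1 one_ne_zero z') (disc (w j) (r₀ j)) ≤
      disc (w j + z') (r₀ j) := fun j => affImage_affOf_disc_le one_ne_zero (by simp)
  have hW : affImage (affOf 1 one_ne_zero z') (disc 0 r₁) ≤ disc c' s' :=
    affImage_translate_disc_le (by linarith)
  have hle : ∀ j, disc (w j + z') (r₀ j) ≤ disc c' s' := by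
    intro j
    refine le_trans ?_ ((affImage_mono (affOf 1 one_ne_zero z') (hw.le j)).trans hW)
    intro y hy
    refine ⟨y - z', ?_, by simp [affOf_apply]⟩
    have hy' : ‖y - (w j + z')‖ < r₀ j := by simpa [disc, dist_eq_norm] using hy
    change dist _ _ < (r₀ j).1
    rwa [dist_eq_norm, sub_sub, add_comm z']
  have hd : Pairwise fun i j => Disjoint (disc (w i + z') (r₀ i)) (disc (w j + z') (r₀ j)) := by
    intro i j hij
    have := Opens.coe_disjoint.2 (hw.disjoint hij)
    refine Opens.coe_disjoint.1 (Set.disjoint_left.2 fun y hy hy' =>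
      Set.disjoint_left.1 this (show y - z' ∈ _ from ?_) ?_)
    · simpa [disc, dist_eq_norm, sub_sub, add_comm] using hy
    · simpa [disc, dist_eq_norm, sub_sub, add_comm] using hy'
  have hins : Compat (F := F.toPrefactorizationAlgebra)
      (List.ofFn fun j => F.ins (r₀ j) (w j + z') (b j)) (disc c' s') :=
    compat_ofFn hd hle _
  have hshift : F.shift r' c' s' z' (F.ext (disc_mono 0 hr) (F.discProduct w r₀ r₁ hw b)) =
      F.lprod (List.ofFn fun j => F.ins (r₀ j) (w j + z') (b j)) (disc c' s') hins := by
    rw [F.shift_ext hr hz', F.shift_eq_tr (by linarith), discProduct_eq_lprod]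
    exact F.tr_lprod_ofFn _ (fun j => ⟨hi j, tr_translate_ins _ _ _ _ (hi j)⟩) _ _ _
  have hcomp := compat_outer h r a z (F.shift r' c' s' z'
    (F.ext (disc_mono 0 hr) (F.discProduct w r₀ r₁ hw b)))
  have hcomp' := hcomp
  rw [hshift] at hcomp'
  have hl : F.lprod _ _ hcomp = F.lprod _ _ hcomp' := lprod_congr (by rw [hshift]) _ _
  rw [outer_eq_lprod, hl, lprod_nested hins hcomp' (hins.of_nested hcomp')]
  refine hol.mu_eq_lprod _ x (c := Fin.append c fun j => w j + z')
    (s := Fin.append (fun _ => s) fun j => (r₀ j).1) (r := Fin.append (fun _ => r) r₀)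
    (fun i => ?_) ?_ _ l
  · rw [hx]
    refine Fin.addCases (fun i => ?_) (fun j => ?_) i
    · simpa using hz i
    · simp
  · have hofn : (List.ofFn fun i : Fin (m + n) => F.insAt (Fin.append (fun _ => r) r₀ i)
        (Fin.append c (fun j => w j + z') i) (Fin.append (fun _ => s) (fun j => (r₀ j).1) i)
        (x.1 i) (Fin.append a b i)) =
        List.ofFn (Fin.append (fun i => F.insAt r (c i) s (z i) (a i))
          fun j => F.ins (r₀ j) (w j + z') (b j)) := by
      congr 1
      ext1 i
      rw [hx]
      refine Fin.addCases (fun i => ?_) (fun j => ?_) i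
      · simp
      · simp [ins]
    rw [hofn, List.ofFn_fin_append]
    exact List.perm_append_comm

end Outer

/-! ## Local boundedness -/

theorem IsHolomorphic.exists_nhds_isBounded_shift (hol : F.IsHolomorphic) {r s : ℝ} {c z : ℂ}
    (h : ‖z - c‖ + r < s) : ∃ N ∈ nhds z, ∀ B : Set (F.obj (disc 0 r)), Bornology.IsBounded B →
      Bornology.IsBounded (Set.image2 (fun z x => F.shift r c s z x) N B) := by
  obtain ⟨N, hN, hz, -, hb⟩ := (hol.translate c r s).exists_isBounded_nhds h
  refine ⟨N, hN.mem_nhds hz, fun B hB => ?_⟩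
  obtain ⟨D, hD, h⟩ := boundedMaps.isBounded_iff.1 hb B hB
  refine hD.subset ?_
  rintro _ ⟨z, hz, x, hx, rfl⟩
  exact h _ ⟨z, hz, rfl⟩ ⟨x, hx, rfl⟩

theorem IsHolomorphic.exists_nhds_isBounded_mulN (hol : F.IsHolomorphic) {m : ℕ} {c : Fin m → ℂ}
    {s : Fin m → ℝ} {W : Opens ℂ} (hd : Pairwise fun i j => Disjoint (disc (c i) (s i)) (disc (c j) (s j)))
    (hW : ∀ i, disc (c i) (s i) ≤ W) (r : Fin m → {r : ℝ // 0 < r}) {z : Fin m → ℂ}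
    (hz : ∀ i, ‖z i - c i‖ + r i < s i) (a : Fin m → ⨁ k, F.weightSpace k) :
    ∃ N ∈ nhds z, Bornology.IsBounded ((fun z : Fin m → ℂ => F.mulN (fun i => disc (c i) (s i)) W
      hd hW fun i => F.shift (r i) (c i) (s i) (z i) (F.P (r i) (a i))) '' N) := by
  choose N hN hNb using fun i => hol.exists_nhds_isBounded_shift (hz i)
  refine ⟨Set.univ.pi N, set_pi_mem_nhds Set.finite_univ fun i _ => hN i,
    (F.isBounded_mulN (fun i => disc (c i) (s i)) W hd hW _ fun i =>
      hNb i {F.P (r i) (a i)} Bornology.isBounded_singleton).subset ?_⟩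
  rintro _ ⟨z, hz, rfl⟩
  exact ⟨_, fun i _ => ⟨z i, hz i trivial, _, rfl, rfl⟩, rfl⟩

/-- Holomorphic families are locally equibounded. This supplies one bound for the outer operation at
all nearby insertion points. -/
theorem IsHolomorphic.exists_nhds_isBounded_outer (hol : F.IsHolomorphic) {m : ℕ} {c : Fin m → ℂ}
    {c' : ℂ} {s s' : ℝ} {R : {r : ℝ // 0 < r}} (h : OuterConfig c c' s s' R)
    (r r' : {r : ℝ // 0 < r}) (a : Fin m → ⨁ k, F.weightSpace k) {z : Fin m → ℂ} {z' : ℂ}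
    (hz : ∀ i, ‖z i - c i‖ + r < s) (hz' : ‖z' - c'‖ + r' < s') :
    ∃ N ∈ nhds z, ∃ N' ∈ nhds z', ∀ B : Set (F.obj (disc 0 r')), Bornology.IsBounded B →
      Bornology.IsBounded (⋃ p : N ×ˢ N', F.outer h r r' a p.1.1 p.1.2 '' B) := by
  obtain ⟨N, hN, hNb⟩ := hol.exists_nhds_isBounded_mulN h.disjoint (le_iSup fun i => disc (c i) s)
    (fun _ => r) hz a
  obtain ⟨N', hN', hNb'⟩ := hol.exists_nhds_isBounded_shift hz'
  refine ⟨N, hN, N', hN', fun B hB => ?_⟩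
  refine (F.mul_bounded (disjoint_iSup_iff.2 h.disjoint') h.le' (iSup_le h.le) _ _
    (hNb' B hB) hNb).subset ?_
  refine Set.iUnion_subset ?_
  rintro ⟨⟨y, y'⟩, hy, hy'⟩ _ ⟨x, hx, rfl⟩
  exact ⟨_, ⟨y', hy', x, hx, rfl⟩, _, ⟨y, hy, rfl⟩, rfl⟩

/-- The expansion of the elements of a bounded subset of `F(B_r(0))` into weight vectors converges
absolutely and uniformly in `F(B_{r'}(0))`, `r < r'`. -/
theorem IsHolomorphic.exists_expansion (hol : F.IsHolomorphic) {r r' : {r : ℝ // 0 < r}}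
    (hr : r.1 < r'.1) {B : Set (F.obj (disc 0 r))} (hB : Bornology.IsBounded B) :
    ∃ (W : BanachSubobject (F.obj (disc 0 r'))) (t : ℤ → F.obj (disc 0 r) → W.E)
      (T : F.obj (disc 0 r) → W.E) (C : ℤ → ℝ), Summable C ∧ ∀ x ∈ B, (∀ k, ‖t k x‖ ≤ C k) ∧
        (∀ k, W.incl (t k x) = F.weightToDisc r' k (F.L r x k)) ∧ HasSum (fun k => t k x) (T x) ∧
        W.incl (T x) = F.ext (disc_mono 0 hr.le) x := by
  obtain ⟨Z, D, hD, rfl⟩ := (F.obj (disc 0 r)).complete B hB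
  obtain ⟨M, hM⟩ := isBounded_iff_forall_norm_le.1 hD
  have hb := Z.bounded _ (Metric.isBounded_closedBall (x := 0) (r := 1))
  have hr0 := r.2
  -- The outer radius of the annulus is the midpoint of `1` and `r' / r`: beyond the unit circle,
  -- yet still scaling `B_r(0)` into a smaller disc than `B_{r'}(0)`.
  have h1 : 1 < (1 + r'.1 / r.1) / 2 := by
    have : 1 < r'.1 / r.1 := (one_lt_div hr0).2 hr
    linarith
  have h2 : (1 + r'.1 / r.1) / 2 * r.1 < r'.1 := by
    have : r'.1 / r.1 * r.1 = r'.1 := div_mul_cancel₀ _ hr0.ne'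
    nlinarith
  obtain ⟨W, G, hG, hGj⟩ := hol.exists_scal_lift Z.incl hb one_half_pos hr0.le h2
  obtain ⟨C, hC, hCb, hsum⟩ := exists_laurent_expansion one_half_pos one_half_lt_one h1 hG
  have hinv : ∀ e, Function.invFun Z.incl (Z.incl e) = e := Function.leftInverse_invFun Z.injective
  -- `invFun` returns the unique Banach-space representative of `x`, so the terms are functions of
  -- `x` itself.
  refine ⟨W, fun k x => laurentCoeff G (1 / 2) k (Function.invFun Z.incl x),
    fun x => G 1 (Function.invFun Z.incl x), fun k => C k * M, hC.mul_right M, ?_⟩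
  rintro _ ⟨e, he, rfl⟩
  simp only [hinv]
  have hle : (1 / 2 : ℝ) ≤ (1 + r'.1 / r.1) / 2 := by linarith
  refine ⟨fun k => ?_, fun k => ?_, ?_, ?_⟩
  · refine ((laurentCoeff G (1 / 2) k).le_opNorm e).trans ?_
    exact mul_le_mul (hCb k) (hM e he) (norm_nonneg _) ((norm_nonneg _).trans (hCb k))
  · rw [hol.weightProj_of_lift hr0 k Z.incl hr.le hb one_half_pos one_half_lt_one
      (fun q hq => hG q hq.ge (hq.trans_le hle)) (fun q hq => hGj q hq.ge (hq.trans_le hle)),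
      ← hol.weightToDisc_L, ← F.scal_one hr.le,
      F.scal_weightToDisc _ one_ne_zero (by simpa using hr.le), one_zpow, one_smul]
  · exact hsum.mapL (ContinuousLinearMap.apply ℂ W.E e)
  · rw [hGj 1 (by norm_num) (by simpa using h1.le), F.scal_one hr.le]

end AffInvPrefactorizationAlgebra

/-! ## From local to compact convergence -/

/-- The extension by zero of the first `d₁` coordinates. -/
noncomputable def appendZeroRight (d₁ d₂ : ℕ) : (Fin d₁ → ℂ) →L[ℂ] (Fin (d₁ + d₂) → ℂ) :=
  LinearMap.toContinuousLinearMap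
    { toFun := fun x => Fin.append x 0
      map_add' := fun x y => by ext i; refine Fin.addCases (fun i => ?_) (fun i => ?_) i <;> simp
      map_smul' := fun c x => by ext i; refine Fin.addCases (fun i => ?_) (fun i => ?_) i <;> simp }

/-- The extension by zero of the last `d₂` coordinates. -/
noncomputable def appendZeroLeft (d₁ d₂ : ℕ) : (Fin d₂ → ℂ) →L[ℂ] (Fin (d₁ + d₂) → ℂ) :=
  LinearMap.toContinuousLinearMap
    { toFun := fun x => Fin.append 0 x
      map_add' := fun x y => by ext i; refine Fin.addCases (fun i => ?_) (fun i => ?_) i <;> simp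
      map_smul' := fun c x => by ext i; refine Fin.addCases (fun i => ?_) (fun i => ?_) i <;> simp }

theorem norm_appendZeroRight_le (d₁ d₂ : ℕ) (x : Fin d₁ → ℂ) : ‖appendZeroRight d₁ d₂ x‖ ≤ ‖x‖ := by
  refine (pi_norm_le_iff_of_nonneg (norm_nonneg x)).2 fun i => ?_
  change ‖Fin.append x 0 i‖ ≤ _
  refine Fin.addCases (fun i => ?_) (fun i => ?_) i
  · simpa using norm_le_pi_norm x i
  · simp

theorem norm_appendZeroLeft_le (d₁ d₂ : ℕ) (x : Fin d₂ → ℂ) : ‖appendZeroLeft d₁ d₂ x‖ ≤ ‖x‖ := by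
  refine (pi_norm_le_iff_of_nonneg (norm_nonneg x)).2 fun i => ?_
  change ‖Fin.append 0 x i‖ ≤ _
  refine Fin.addCases (fun i => ?_) (fun i => ?_) i
  · simp
  · simpa using norm_le_pi_norm x i

theorem exists_common_extension {V : Type*} [AddCommGroup V] [Module ℂ V] {d₁ d₂ : ℕ}
    (φ₁ : (Fin d₁ → ℂ) →ₗ[ℂ] V) (φ₂ : (Fin d₂ → ℂ) →ₗ[ℂ] V) :
    ∃ φ : (Fin (d₁ + d₂) → ℂ) →ₗ[ℂ] V,
      (∀ x, φ (appendZeroRight d₁ d₂ x) = φ₁ x) ∧ ∀ x, φ (appendZeroLeft d₁ d₂ x) = φ₂ x := by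
  refine ⟨φ₁.comp (LinearMap.funLeft ℂ ℂ (Fin.castAdd d₂)) +
    φ₂.comp (LinearMap.funLeft ℂ ℂ (Fin.natAdd d₁)), fun x => ?_, fun x => ?_⟩
  · have h₁ : LinearMap.funLeft ℂ ℂ (Fin.castAdd d₂) (appendZeroRight d₁ d₂ x) = x := by
      ext i
      exact Fin.append_left x 0 i
    have h₂ : LinearMap.funLeft ℂ ℂ (Fin.natAdd d₁) (appendZeroRight d₁ d₂ x) = 0 := by
      ext i
      exact Fin.append_right x 0 i
    rw [LinearMap.add_apply, LinearMap.comp_apply, LinearMap.comp_apply, h₁, h₂, map_zero, add_zero]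
  · have h₁ : LinearMap.funLeft ℂ ℂ (Fin.castAdd d₂) (appendZeroLeft d₁ d₂ x) = 0 := by
      ext i
      exact Fin.append_left 0 x i
    have h₂ : LinearMap.funLeft ℂ ℂ (Fin.natAdd d₁) (appendZeroLeft d₁ d₂ x) = x := by
      ext i
      exact Fin.append_right 0 x i
    rw [LinearMap.add_apply, LinearMap.comp_apply, LinearMap.comp_apply, h₁, h₂, map_zero, zero_add]

/-- `φ` maps the terms of some series in `ℂᵈ` bounded by `C` to `A`, and its sum to `B`. -/
def LiftsSeries {V : Type*} [AddCommGroup V] [Module ℂ V] {d : ℕ} (φ : (Fin d → ℂ) →ₗ[ℂ] V)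
    (C : ℤ → ℝ) (A : ℤ → V) (B : V) : Prop :=
  ∃ g : ℤ → Fin d → ℂ, (∀ k, ‖g k‖ ≤ C k) ∧ (∀ k, φ (g k) = A k) ∧ φ (∑' k, g k) = B

theorem LiftsSeries.map {V : Type*} [AddCommGroup V] [Module ℂ V] {d d' : ℕ}
    {φ : (Fin d → ℂ) →ₗ[ℂ] V} {C : ℤ → ℝ} {A : ℤ → V} {B : V} (h : LiftsSeries φ C A B)
    (hC : Summable C) {C' : ℤ → ℝ} (hCC' : ∀ k, C k ≤ C' k) {φ' : (Fin d' → ℂ) →ₗ[ℂ] V}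
    (ψ : (Fin d → ℂ) →L[ℂ] (Fin d' → ℂ)) (hψ : ∀ x, ‖ψ x‖ ≤ ‖x‖) (hφ : ∀ x, φ' (ψ x) = φ x) :
    LiftsSeries φ' C' A B := by
  obtain ⟨g, hg, hA, hB⟩ := h
  refine ⟨fun k => ψ (g k), fun k => (hψ _).trans ((hg k).trans (hCC' k)), fun k => by rw [hφ, hA],
    ?_⟩
  rw [← ψ.map_tsum (Summable.of_norm_bounded hC hg), hφ, hB]

/-- Finitely many neighbourhoods suffice; their coordinate spaces are combined into a direct sum and
their majorants added. The combined `φ` need not be injective. -/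
theorem exists_uniform_of_local {E V : Type*} [TopologicalSpace E] [AddCommGroup V] [Module ℂ V]
    {S K : Set E} (hK : IsCompact K) (A : S → ℤ → V) (B : S → V)
    (hloc : ∀ p ∈ K, ∃ N ∈ nhds p, ∃ (d : ℕ) (φ : (Fin d → ℂ) →ₗ[ℂ] V) (C : ℤ → ℝ), Summable C ∧
      ∀ q : S, q.1 ∈ N → LiftsSeries φ C (A q) (B q)) :
    ∃ (d : ℕ) (φ : (Fin d → ℂ) →ₗ[ℂ] V) (C : ℤ → ℝ), Summable C ∧
      ∀ q : S, q.1 ∈ K → LiftsSeries φ C (A q) (B q) := by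
  refine hK.induction_on (p := fun K => ∃ (d : ℕ) (φ : (Fin d → ℂ) →ₗ[ℂ] V) (C : ℤ → ℝ),
    Summable C ∧ ∀ q : S, q.1 ∈ K → LiftsSeries φ C (A q) (B q)) ?_ ?_ ?_ ?_
  · exact ⟨0, 0, 0, summable_zero, fun q hq => hq.elim⟩
  · rintro s t hst ⟨d, φ, C, hC, h⟩
    exact ⟨d, φ, C, hC, fun q hq => h q (hst hq)⟩
  · rintro s t ⟨d₁, φ₁, C₁, hC₁, h₁⟩ ⟨d₂, φ₂, C₂, hC₂, h₂⟩
    obtain ⟨φ, hφ₁, hφ₂⟩ := exists_common_extension φ₁ φ₂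
    refine ⟨d₁ + d₂, φ, fun k => |C₁ k| + |C₂ k|, hC₁.abs.add hC₂.abs, fun q hq => ?_⟩
    rcases hq with hq | hq
    · exact (h₁ q hq).map hC₁ (fun k => (le_abs_self _).trans (le_add_of_nonneg_right (abs_nonneg _)))
        _ (norm_appendZeroRight_le _ _) hφ₁
    · exact (h₂ q hq).map hC₂ (fun k => (le_abs_self _).trans (le_add_of_nonneg_left (abs_nonneg _)))
        _ (norm_appendZeroLeft_le _ _) hφ₂
  · intro p hp
    obtain ⟨N, hN, h⟩ := hloc p hp
    exact ⟨N, mem_nhdsWithin_of_mem_nhds hN, h⟩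

/-! ## Associativity -/

/-- The gaps are chosen for discs of radius `2ε` about the `zᵢ` and `wⱼ` and a disc of radius `M +
4ε` about the last `z`: disjointness needs `2ε + 2ε` and `(M + 4ε) + 2ε`. -/
theorem exists_assoc_radii {m n : ℕ} {p : (Fin (m + 1) → ℂ) × (Fin n → ℂ)}
    (hp : p ∈ assocDomain m n) : ∃ M ε : ℝ, 0 ≤ M ∧ 0 < ε ∧ (∀ j, ‖p.2 j‖ ≤ M) ∧
      (∀ i : Fin m, M + 6 * ε ≤ ‖p.1 i.castSucc - p.1 (Fin.last m)‖) ∧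
      (∀ i j, i ≠ j → 4 * ε ≤ ‖p.1 i - p.1 j‖) ∧ ∀ i j, i ≠ j → 4 * ε ≤ ‖p.2 i - p.2 j‖ := by
  obtain ⟨h₁, h₂, h₃⟩ := hp
  -- In `NNReal` the supremum over an empty family is `0`, which covers `n = 0`.
  let M : NNReal := Finset.univ.sup fun j => ‖p.2 j‖₊
  have hM : ∀ j, ‖p.2 j‖ ≤ M := fun j =>
    NNReal.coe_le_coe.2 (Finset.le_sup (f := fun j => ‖p.2 j‖₊) (Finset.mem_univ j))
  have hM' : ∀ i : Fin m, (M : ℝ) < ‖p.1 i.castSucc - p.1 (Fin.last m)‖ := by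
    intro i
    have hne : p.1 i.castSucc - p.1 (Fin.last m) ≠ 0 :=
      sub_ne_zero.2 (h₁.ne (Fin.castSucc_lt_last i).ne)
    have hpos : (⊥ : NNReal) < ‖p.1 i.castSucc - p.1 (Fin.last m)‖₊ := nnnorm_pos.2 hne
    exact NNReal.coe_lt_coe.2 ((Finset.sup_lt_iff hpos).2 fun j _ => h₃ i j)
  have ev : ∀ a b c : ℝ, a < b → ∀ᶠ ε : ℝ in nhdsWithin 0 (Set.Ioi 0), a + c * ε ≤ b := by
    intro a b c hab
    have ht : Filter.Tendsto (fun ε : ℝ => a + c * ε) (nhdsWithin 0 (Set.Ioi 0)) (nhds a) := by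
      have : Continuous fun ε : ℝ => a + c * ε := by fun_prop
      simpa using (this.tendsto 0).mono_left nhdsWithin_le_nhds
    filter_upwards [ht.eventually (gt_mem_nhds hab)] with ε h using h.le
  have e₁ : ∀ᶠ ε : ℝ in nhdsWithin 0 (Set.Ioi 0),
      ∀ i : Fin m, M + 6 * ε ≤ ‖p.1 i.castSucc - p.1 (Fin.last m)‖ :=
    Filter.eventually_all.2 fun i => ev _ _ _ (hM' i)
  have e₂ : ∀ᶠ ε : ℝ in nhdsWithin 0 (Set.Ioi 0),
      ∀ i j, i ≠ j → 4 * ε ≤ ‖p.1 i - p.1 j‖ := by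
    refine Filter.eventually_all.2 fun i => Filter.eventually_all.2 fun j => ?_
    by_cases hij : i = j
    · exact Filter.Eventually.of_forall fun _ h => (h hij).elim
    · filter_upwards [ev 0 _ 4 (norm_pos_iff.2 (sub_ne_zero.2 (h₁.ne hij)))] with ε h _
      simpa using h
  have e₃ : ∀ᶠ ε : ℝ in nhdsWithin 0 (Set.Ioi 0),
      ∀ i j, i ≠ j → 4 * ε ≤ ‖p.2 i - p.2 j‖ := by
    refine Filter.eventually_all.2 fun i => Filter.eventually_all.2 fun j => ?_
    by_cases hij : i = j
    · exact Filter.Eventually.of_forall fun _ h => (h hij).elim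
    · filter_upwards [ev 0 _ 4 (norm_pos_iff.2 (sub_ne_zero.2 (h₂.ne hij)))] with ε h _
      simpa using h
  obtain ⟨ε, ⟨⟨h₁, h₂⟩, h₃⟩, hε⟩ := (((e₁.and e₂).and e₃).and self_mem_nhdsWithin).exists
  exact ⟨M, ε, M.2, hε, hM, h₁, h₂, h₃⟩

namespace AffInvPrefactorizationAlgebra

open PrefactorizationAlgebra

variable {F : AffInvPrefactorizationAlgebra.{u}}

/-- The inner products for nearby `w` form a bounded set, so their weight expansions share a
summable majorant. The outer operation followed by `L` is an equibounded family of operators into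
one finite-dimensional space, and it is applied termwise. -/
theorem IsHolomorphic.exists_local_assoc (hol : F.IsHolomorphic) (dis : F.HasDiscreteWeightSpaces)
    {m n : ℕ} (a : Fin m → ⨁ k, F.weightSpace k) (b : Fin n → ⨁ k, F.weightSpace k) (l : ℤ)
    {p₀ : (Fin (m + 1) → ℂ) × (Fin n → ℂ)} (hp₀ : p₀ ∈ assocDomain m n) :
    ∃ N ∈ nhds p₀, ∃ (d : ℕ) (φ : (Fin d → ℂ) →ₗ[ℂ] F.weightSpace l) (C : ℤ → ℝ), Summable C ∧
      ∀ p : assocDomain m n, p.1 ∈ N → LiftsSeries φ C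
        (fun k => F.mu (m + 1) (Fin.snoc a (DirectSum.of (fun k => F.weightSpace k) k
          (F.mu n b ⟨p.1.2, p.2.2.1⟩ k))) ⟨p.1.1, p.2.1⟩ l)
        (F.mu (m + n) (Fin.append a b) (assocConf p.1 p.2) l) := by
  obtain ⟨M, ε, hM, hε, hw, hzl, hzz, hww⟩ := exists_assoc_radii hp₀
  -- Insertions use radius `ε` inside fixed discs of radius `2ε`, so points may move by `ε`. The
  -- inner product lives on radius `M + 2ε`, its expansion converges on `M + 3ε`, and the last `ε`
  -- up to `M + 4ε` lets the last `z` move.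
  let e : {r : ℝ // 0 < r} := ⟨ε, hε⟩
  let e₂ : {r : ℝ // 0 < r} := ⟨2 * ε, by positivity⟩
  let r₁ : {r : ℝ // 0 < r} := ⟨M + 2 * ε, by positivity⟩
  let r₂ : {r : ℝ // 0 < r} := ⟨M + 3 * ε, by positivity⟩
  have hr : r₁.1 < r₂.1 := by simp only [r₁, r₂]; linarith
  let R : {r : ℝ // 0 < r} := ⟨∑ i, ‖p₀.1 i‖ + (M + 4 * ε), by positivity⟩
  have hle : ∀ i, ‖p₀.1 i‖ ≤ ∑ i, ‖p₀.1 i‖ := fun i =>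
    Finset.single_le_sum (f := fun i => ‖p₀.1 i‖) (fun _ _ => norm_nonneg _) (Finset.mem_univ i)
  have hout : OuterConfig (fun i : Fin m => p₀.1 i.castSucc) (p₀.1 (Fin.last m)) (2 * ε)
      (M + 4 * ε) R := by
    refine ⟨fun i j hij => disjoint_disc ?_, fun i => disjoint_disc ?_, fun i => disc_le_disc ?_,
      disc_le_disc ?_⟩
    · linarith [hzz i.castSucc j.castSucc fun h => hij (Fin.castSucc_injective m h)]
    · rw [norm_sub_rev]
      linarith [hzl i]
    · rw [sub_zero]
      linarith [hle i.castSucc]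
    · rw [sub_zero]
      linarith [hle (Fin.last m)]
  have hin : DiscConfig p₀.2 (fun _ => e₂) r₁ := by
    refine ⟨fun i j hij => disjoint_disc ?_, fun i => disc_le_disc ?_⟩
    · simp only [e₂]
      linarith [hww i j hij]
    · simp only [e₂, r₁, sub_zero]
      linarith [hw i]
  obtain ⟨N₁, hN₁, N₂, hN₂, hN⟩ := hol.exists_nhds_isBounded_outer hout e r₂ a
    (z := fun i => p₀.1 i.castSucc) (z' := p₀.1 (Fin.last m))
    (fun i => by simp only [sub_self, norm_zero, e]; linarith)
    (by simp only [sub_self, norm_zero, r₂]; linarith)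
  obtain ⟨N₃, hN₃, hB⟩ := hol.exists_nhds_isBounded_mulN hin.disjoint hin.le (fun _ => e)
    (z := p₀.2) (fun i => by simp only [sub_self, norm_zero, e, e₂]; linarith) b
  obtain ⟨W, t, T, C, hC, hexp⟩ := hol.exists_expansion hr hB
  -- The operators for all nearby outer points are lifted simultaneously, giving one `d`, one `φ`
  -- and one norm bound `M'`.
  obtain ⟨d, φ, M', T', -, hT'⟩ := (dis l).exists_lift (A := W.E)
    (fun q : N₁ ×ˢ N₂ => (hol.linearL R l).comp ((F.outer hout e r₂ a q.1.1 q.1.2).comp W.incl)) (by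
      have := hol.isBounded_L R l (hN _ (W.bounded _ (Metric.isBounded_closedBall (x := 0) (r := 1))))
      refine this.subset (Set.iUnion_subset fun q => ?_)
      rintro _ ⟨y, hy, rfl⟩
      exact ⟨_, Set.mem_iUnion.2 ⟨q, _, ⟨y, hy, rfl⟩, rfl⟩, rfl⟩)
  have hnear : ∀ᶠ p in nhds p₀, (∀ i, ‖p.1 i - p₀.1 i‖ < ε) ∧ ∀ j, ‖p.2 j - p₀.2 j‖ < ε := by
    refine (Filter.eventually_all.2 fun i => ?_).and (Filter.eventually_all.2 fun j => ?_)
    · exact ContinuousAt.eventually_lt (by fun_prop) continuousAt_const (by simpa using hε)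
    · exact ContinuousAt.eventually_lt (by fun_prop) continuousAt_const (by simpa using hε)
  have c₁ : ∀ᶠ p in nhds p₀, (fun i : Fin m => p.1 i.castSucc) ∈ N₁ :=
    (show ContinuousAt (fun p : (Fin (m + 1) → ℂ) × (Fin n → ℂ) =>
      fun i : Fin m => p.1 i.castSucc) p₀ by fun_prop).eventually_mem hN₁
  have c₂ : ∀ᶠ p in nhds p₀, p.1 (Fin.last m) ∈ N₂ :=
    (show ContinuousAt (fun p : (Fin (m + 1) → ℂ) × (Fin n → ℂ) => p.1 (Fin.last m)) p₀ by
      fun_prop).eventually_mem hN₂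
  have c₃ : ∀ᶠ p in nhds p₀, p.2 ∈ N₃ := continuousAt_snd.eventually_mem hN₃
  refine ⟨_, hnear.and (c₁.and (c₂.and c₃)), d, φ, fun k => M' * C k, hC.mul_left M', ?_⟩
  rintro ⟨p, hp⟩ ⟨⟨hpz, hpw⟩, hp₁, hp₂, hp₃⟩
  have hwn : ∀ j, ‖p.2 j - p₀.2 j‖ + e ≤ e₂ := fun j => by
    simp only [e, e₂]
    linarith [hpw j]
  have hconf := hin.of_near hwn
  obtain ⟨hx₁, hx₂, hx₃, hx₄⟩ := hexp (F.discProduct p.2 (fun _ => e) r₁ hconf b)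
    ⟨p.2, hp₃, (discProduct_of_near b hin hwn).symm⟩
  have hz : ∀ i : Fin m, ‖p.1 i.castSucc - p₀.1 i.castSucc‖ + e ≤ 2 * ε := fun i => by
    simp only [e]
    linarith [hpz i.castSucc]
  have hz' : ‖p.1 (Fin.last m) - p₀.1 (Fin.last m)‖ + r₂ ≤ M + 4 * ε := by
    simp only [r₂]
    linarith [hpz (Fin.last m)]
  obtain ⟨hT₁, hT₂⟩ := hT' ⟨⟨fun i => p.1 i.castSucc, p.1 (Fin.last m)⟩, hp₁, hp₂⟩
  refine ⟨fun k => T' ⟨⟨fun i => p.1 i.castSucc, p.1 (Fin.last m)⟩, hp₁, hp₂⟩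
    (t k (F.discProduct p.2 (fun _ => e) r₁ hconf b)), fun k => ?_, fun k => ?_, ?_⟩
  · exact (ContinuousLinearMap.le_opNorm _ _).trans
      (mul_le_mul hT₁ (hx₁ k) (norm_nonneg _) ((norm_nonneg _).trans hT₁))
  · rw [hT₂, LinearMap.comp_apply, LinearMap.comp_apply, hx₂, hol.linearL_apply, ← P_of,
      ← hol.mu_eq b ⟨p.2, hp.2.1⟩ hconf]
    exact (hol.mu_snoc hout e r₂ a _ ⟨p.1, hp.1⟩ hz hz' l).symm
  -- The continuous operator passes through the sum, and the sum of the expansion is the extension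
  -- of the inner product.
  · rw [(hx₃.mapL _).tsum_eq, hT₂, LinearMap.comp_apply, LinearMap.comp_apply, hx₄,
      hol.linearL_apply]
    exact (hol.mu_append hout e r₂ a b hz hz' hr.le hconf (assocConf p hp) rfl l).symm

end AffInvPrefactorizationAlgebra

theorem mainTheorem6 (F : AffInvPrefactorizationAlgebra.{u}) (hol : F.IsHolomorphic)
    (dis : F.HasDiscreteWeightSpaces) (mer : F.HasMeromorphicOPE) :
    (∀ (m : ℕ) (z : Conf m) (r : Fin m → {r : ℝ // 0 < r}) (R : {r : ℝ // 0 < r})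
      (h : DiscConfig z.1 r R) (a : Fin m → ⨁ k, F.weightSpace k) (k : ℤ) (t : ℝ),
      0 < t → t < 1 →
      HasContourIntegral
        (fun q : ℂ => q ^ (-k - 1) • F.discAction R q (F.discProduct z.1 r R h a)) t
        ((2 * Real.pi * Complex.I : ℂ) • F.weightToDisc R k (F.mu m a z k))) ∧
    IsGeometricVertexAlgebra (fun k => F.weightSpace k) F.mu := by
  refine ⟨fun m z r R h a k t ht ht' => hol.hasContourIntegral_discProduct z r R h a k t ht ht', ?_⟩
  refine
    { multilinear := hol.mu_multilinear
      holomorphic := hol.mu_holomorphic dis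
      permutation := fun m a z s => hol.mu_perm a z s
      insertion_at_zero := hol.mu_single_zero
      equivariance := fun m a z q k => hol.mu_equivariant a z q k
      associativity := ?_
      meromorphicity := mer }
  intro m n a b K hK hKc l
  obtain ⟨d, φ, C, hC, h⟩ := exists_uniform_of_local (V := F.weightSpace l)
    (S := assocDomain m n) hKc
    (fun p k => F.mu (m + 1) (Fin.snoc a (DirectSum.of (fun k => F.weightSpace k) k
      (F.mu n b ⟨p.1.2, p.2.2.1⟩ k))) ⟨p.1.1, p.2.1⟩ l)
    (fun p => F.mu (m + n) (Fin.append a b) (assocConf p.1 p.2) l) fun p hp =>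
    hol.exists_local_assoc dis a b l (hK hp)
  choose g hg using h
  classical
  -- The lifts are required only on `K`; the value `0` elsewhere is arbitrary.
  refine ⟨d, φ, fun k p => if hp : p ∈ K then g ⟨p, hK hp⟩ hp k else 0, C, hC, fun p hp => ?_⟩
  simp only [dif_pos hp]
  exact hg ⟨p, hK hp⟩ hp
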